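/- Let $k$ be a field and $G$ a finite group; put $\overline G=G\setminus\{1\}$ and $g_{i,j}=(g_i,\dots,g_j)$. Let $C^n=\mathrm{Map}(\overline G^{\times n},kG)$ and $C_n=kG\otimes k[\overline G^{\times n}]$ ($n\ge 0$) be the normalized Hochschild cochains and chains of $kG$; a cochain is taken to vanish, and a chain $(g_0,g_{1,n})=g_0\otimes g_{1,n}$ to be zero, if one of the entries $g_1,\dots,g_n$ is $1$. Formulas given for $(g_0,g_{1,n})$, $g_0\in G$, are extended linearly, and chains with first entry in $kG$ are read linearly in that entry. Let $\mathcal D^*=\mathcal D^*(kG,kG)$ be the Tate–Hochschild cochain complex, $\mathcal D^n=C^n$ for $n\ge 0$ and $\mathcal D^{-s-1}=C_s$ for $s\ge 0$, with differential $\partial$ given by the Hochschild coboundary $\delta$ on $C^n$, by the Hochschild boundary on $C_s$ ($s\ge1$), and by $\tau(a)=\sum_{g}gag^{-1}$ from $C_0$ to $C^0$. Let $\langle g,h\rangle=1$ if $gh=1$ and $0$ otherwise ($g,h\in G$), and let $\langle\cdot,\cdot\rangle$ also denote the bilinear form on $\mathcal D^*$ with $\langle\alpha,(g_0,g_{1,n})\rangle=\langle(g_0,g_{1,n}),\alpha\rangle=\langle\alpha(g_{1,n}),g_0\rangle$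 for $\alpha\in C^n$, and zero on all other pairs of homogeneous components. Define operations on $\mathcal D^*$ as follows. * $m_1=\partial'$, where $\partial'=\partial$ on $\mathcal D^{\ge 0}$ and $\partial'=(-1)^{s}\partial$ on $C_s=\mathcal D^{-s-1}$. * $m_2=\cup$. For $\alpha\in C^n,\beta\in C^m$: $(\alpha\cup\beta)(g_{1,n+m})=\alpha(g_{1,n})\beta(g_{n+1,n+m})$. For $\alpha=(g_0,g_{1,s})$, $\beta=(h_0,h_{1,t})$: $\alpha\cup\beta=\sum_g(gh_0,h_{1,t},g^{-1}g_0,g_{1,s})$. For $\alpha\in C^n$, $\beta=(h_0,h_{1,t})$: $\alpha\cup\beta=(\alpha(h_{t-n+1,t})h_0,h_{1,t-n})$ if $n\le t$, and $(\alpha\cup\beta)(l_{1,n-t-1})=\sum_g\alpha(l_{1,n-t-1},g^{-1},h_{1,t})h_0g$ if $n>t$. For $\alpha=(g_0,g_{1,s})$, $\beta\in C^m$: $\alpha\cup\beta=(g_0\beta(g_{1,m}),g_{m+1,s})$ if $m\le s$, and $(\alpha\cup\beta)(l_{1,m-s-1})=\sum_g gg_0\beta(g_{1,s},g^{-1},l_{1,m-s-1})$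 if $m>s$. * $m_3$ is zero on all triples of cochains and chains except the following two types. For $\phi\in C^m$, $\alpha=(g_0,g_{1,r})$, $\varphi\in C^n$ with $r+2\le m+n$, $$m_3(\phi,\alpha,\varphi)(h_{1,m+n-r-2})=\sum_{g\in G}\sum_{j}(-1)^{m+r+j-1}\phi(h_{1,m-r+j-2},g,g_{j,r})\,g_0\,\varphi(g_{1,j-1},g^{-1},h_{m-r+j-1,m+n-r-2}),$$ the sum over $\max\{1,r+2-m\}\le j\le\min\{n,r+1\}$ (and $m_3=0$ if $r+2>m+n$). For $\alpha=(g_0,g_{1,r})$, $\phi\in C^m$, $\beta=(h_0,h_{1,s})$ with $m-1\le r+s$, $$m_3(\alpha,\phi,\beta)=\sum_{g\in G}\sum_{j}(-1)^{m+r+s-j}\bigl(g_0\,\phi(g_{1,m-s+j-1},g,h_{j+1,s})\,h_0,\;h_{1,j},\,g^{-1},\,g_{m-s+j,r}\bigr),$$ the sum over $0\le j\le s$ with $0\le m-s+j-1\le r$ (and $m_3=0$ if $m-1>r+s$). * $m_i=0$ for $i>3$. An $A_\infty$-algebra is a graded space with operations $m_n$ of degree $2-n$ ($n\ge1$) satisfying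 $\sum_{r+s+t=n}(-1)^{r+st}m_{r+1+t}(\mathrm{id}^{\otimes r}\otimes m_s\otimes\mathrm{id}^{\otimes t})=0$ for all $n\ge1$ (Koszul sign rule). It is cyclic with respect to a non-degenerate bilinear form, here of degree $-1$ (that is, $\langle a,b\rangle=0$ unless $|a|+|b|=-1$), if $\langle\alpha_0,m_n(\alpha_1,\dots,\alpha_n)\rangle=(-1)^{|\alpha_0|(2-n)+n}\langle m_n(\alpha_0,\dots,\alpha_{n-1}),\alpha_n\rangle$ for all $n\ge 1$. Left and right $A_\infty$-modules $M$ are defined by the same identities with the last, respectively the first, input in $M$. For $x\in G$ with conjugacy class $C_x$ let $\widehat{\mathcal H}{}^*_x\subseteq\mathcal D^*$ be the graded subspace of the cochains $\varphi$ with $\varphi(g_{1,n})\in k[g_1\cdots g_nC_x]$ for all $g_i$, and of the chains spanned by all $(g_s^{-1}\cdots g_1^{-1}u,g_{1,s})$ with $u\in C_x$. Let $\widehat C^*(G,k)$ be the normalized Tate cochain complex with trivial coefficients ($\mathrm{Map}(\overline G^{\times n},k)$ in degree $n\ge0$, $k[\overline G^{\times s}]$ in degree $-s-1<0$, the group cohomology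 and homology differentials, and multiplication by $|G|$ from degree $-1$ to degree $0$), and let $\widehat\iota:\widehat C^*(G,k)\to\mathcal D^*$ send a cochain $\varphi$ to $g_{1,n}\mapsto\varphi(g_{1,n})g_1\cdots g_n$ and a chain $(g_{1,n})$ to $(g_n^{-1}\cdots g_1^{-1},g_{1,n})$. **Theorem.** 1. $(\mathcal D^*,\langle\cdot,\cdot\rangle,\partial',\cup,m_3,m_i=0\ (i>3))$ is a cyclic $A_\infty$-algebra. 2. $\widehat\iota$ is an injective morphism of complexes for the differentials $\partial$, homogeneous of degree $0$, with image $\widehat{\mathcal H}{}^*_1$. For every set $X$ of representatives of the conjugacy classes of $G$, $\mathcal D^*=\bigoplus_{x\in X}\widehat{\mathcal H}{}^*_x$, a direct sum of subcomplexes. 3. $\widehat C^*(G,k)$ is a cyclic $A_\infty$-subalgebra of $\mathcal D^*$ through $\widehat\iota$: it has operations that commute with $\widehat\iota$, whose first one is its differential with the sign change $(-1)^s$ in degree $-s-1$, and with them and with the restricted bilinear form, $\langle\varphi,(g_{1,n})\rangle=\varphi(g_{1,n})$, which is non-degenerate, it is a cyclic $A_\infty$-algebra. 4. For every $x\in G$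 the operations of $\mathcal D^*$ restrict to $\widehat{\mathcal H}{}^*_x$ with all inputs but the last one from $\widehat C^*(G,k)$ and make it a left $A_\infty$-module over $\widehat C^*(G,k)$; likewise, with all inputs but the first one from $\widehat C^*(G,k)$, it is a right $A_\infty$-module. -/

import Mathlib

namespace TateHochschild

/-! ### A-infinity algebras and modules -/

section AInfinity

variable {k V W : Type*} [Field k] [AddCommGroup V] [Module k V] [AddCommGroup W] [Module k W]

/-- The sequence `a 0, …, a (r - 1), b, a (r + s), a (r + s + 1), …` obtained from `a` by
replacing the block of `s ≥ 1` entries that starts in position `r` by the single entry `b`. -/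
def splice (a : ℕ → V) (r s : ℕ) (b : V) (i : ℕ) : V :=
  if i < r then a i else if i = r then b else a (i + s - 1)

/-- Total degree of the entries `0, …, r - 1`. -/
def degSum (d : ℕ → ℤ) (r : ℕ) : ℤ := ∑ i ∈ Finset.range r, d i

/-- The graded vector space `V = ⨁ A i` with the operations `m n : V^{⊗ n} → V` of degree `2 - n`
(`n ≥ 1`) is an `A_∞`-algebra:
`∑_{r + s + t = n} (-1)^{r + s t} m_{r + 1 + t} (id^{⊗ r} ⊗ m_s ⊗ id^{⊗ t}) = 0` for `n ≥ 1`,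
with the Koszul sign rule when this is evaluated on homogeneous elements. -/
structure IsAInfinityAlgebra (A : ℤ → Submodule k V)
    (m : (n : ℕ) → MultilinearMap k (fun _ : Fin n => V) V) : Prop where
  internal : DirectSum.IsInternal A
  zero : m 0 = 0
  degree : ∀ (n : ℕ), 1 ≤ n → ∀ (d : Fin n → ℤ) (a : Fin n → V), (∀ i, a i ∈ A (d i)) →
    m n a ∈ A (∑ i, d i + 2 - n)
  stasheff : ∀ (n : ℕ), 1 ≤ n → ∀ (d : ℕ → ℤ) (a : ℕ → V), (∀ i < n, a i ∈ A (d i)) →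
    ∑ s ∈ Finset.Icc 1 n, ∑ r ∈ Finset.range (n - s + 1),
      Int.negOnePow ((r : ℤ) + s * ((n : ℤ) - r - s) + (2 - (s : ℤ)) * degSum d r) •
        m (n - s + 1) (fun i => splice a r s (m s (fun j => a (r + j))) i) = 0

/-- An `A_∞`-algebra with a non-degenerate bilinear form of degree `p` (that is, `⟨A i, A j⟩ = 0`
unless `i + j = p`) is cyclic if
`⟨a₀, m_n(a₁, …, a_n)⟩ = (-1)^{|a₀| (2 - n) + n} ⟨m_n(a₀, …, a_{n-1}), a_n⟩`. -/
structure IsCyclicAInfinityAlgebra (p : ℤ) (A : ℤ → Submodule k V)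
    (m : (n : ℕ) → MultilinearMap k (fun _ : Fin n => V) V) (B : V →ₗ[k] V →ₗ[k] k) : Prop
    extends IsAInfinityAlgebra A m where
  pairing_degree : ∀ (i j : ℤ), i + j ≠ p → ∀ a ∈ A i, ∀ b ∈ A j, B a b = 0
  nondegenerate : B.Nondegenerate
  cyclic : ∀ (n : ℕ), 1 ≤ n → ∀ (d : ℕ → ℤ) (a : ℕ → V), (∀ i ≤ n, a i ∈ A (d i)) →
    B (a 0) (m n (fun i => a (i + 1))) =
      Int.negOnePow (d 0 * (2 - (n : ℤ)) + n) • B (m n (fun i => a i)) (a n)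

/-- A left `A_∞`-module `W = ⨁ M i` over an `A_∞`-algebra `(V, m)`; here `mM n` is the operation
`m^M_{n+1} : V^{⊗ n} ⊗ W → W`, of degree `2 - (n + 1)`. The module identities are the Stasheff
identities for the inputs `a 0, …, a (n - 1), x`: in the first sum the inner operation does not
involve `x`, in the second one it does. -/
structure IsLeftAInfinityModule (A : ℤ → Submodule k V)
    (m : (n : ℕ) → MultilinearMap k (fun _ : Fin n => V) V) (M : ℤ → Submodule k W)
    (mM : (n : ℕ) → MultilinearMap k (fun _ : Fin n => V) (W →ₗ[k] W)) : Prop where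
  internal : DirectSum.IsInternal M
  degree : ∀ (n : ℕ) (d : Fin n → ℤ) (e : ℤ) (a : Fin n → V) (x : W), (∀ i, a i ∈ A (d i)) →
    x ∈ M e → mM n a x ∈ M (∑ i, d i + e + 2 - (n + 1))
  stasheff : ∀ (n : ℕ) (d : ℕ → ℤ) (e : ℤ) (a : ℕ → V) (x : W), (∀ i < n, a i ∈ A (d i)) →
    x ∈ M e →
    (∑ s ∈ Finset.Icc 1 n, ∑ r ∈ Finset.range (n - s + 1),
      Int.negOnePow ((r : ℤ) + s * ((n : ℤ) + 1 - r - s) + (2 - (s : ℤ)) * degSum d r) •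
        mM (n - s + 1) (fun i => splice a r s (m s (fun j => a (r + j))) i) x) +
    (∑ r ∈ Finset.range (n + 1),
      Int.negOnePow ((r : ℤ) + (2 - ((n : ℤ) + 1 - r)) * degSum d r) •
        mM r (fun i => a i) (mM (n - r) (fun j => a (r + j)) x)) = 0

/-- A right `A_∞`-module `W = ⨁ M i` over an `A_∞`-algebra `(V, m)`; here `mM n` is the operation
`m^M_{n+1} : W ⊗ V^{⊗ n} → W`, of degree `2 - (n + 1)`. The module identities are the Stasheff
identities for the inputs `x, a 0, …, a (n - 1)`: in the first sum the inner operation does not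
involve `x`, in the second one it does. -/
structure IsRightAInfinityModule (A : ℤ → Submodule k V)
    (m : (n : ℕ) → MultilinearMap k (fun _ : Fin n => V) V) (M : ℤ → Submodule k W)
    (mM : (n : ℕ) → MultilinearMap k (fun _ : Fin n => V) (W →ₗ[k] W)) : Prop where
  internal : DirectSum.IsInternal M
  degree : ∀ (n : ℕ) (d : Fin n → ℤ) (e : ℤ) (a : Fin n → V) (x : W), (∀ i, a i ∈ A (d i)) →
    x ∈ M e → mM n a x ∈ M (e + ∑ i, d i + 2 - (n + 1))
  stasheff : ∀ (n : ℕ) (d : ℕ → ℤ) (e : ℤ) (a : ℕ → V) (x : W), (∀ i < n, a i ∈ A (d i)) →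
    x ∈ M e →
    (∑ s ∈ Finset.Icc 1 n, ∑ r ∈ Finset.range (n - s + 1),
      Int.negOnePow (((r : ℤ) + 1) + s * ((n : ℤ) - r - s) +
          (2 - (s : ℤ)) * (e + degSum d r)) •
        mM (n - s + 1) (fun i => splice a r s (m s (fun j => a (r + j))) i) x) +
    (∑ q ∈ Finset.range (n + 1),
      Int.negOnePow (((q : ℤ) + 1) * ((n : ℤ) - q)) •
        mM (n - q) (fun j => a (q + j)) (mM q (fun i => a i) x)) = 0

end AInfinity

/-! ### Words, cochains and chains -/

section Words

variable (k : Type*) [Field k] {G : Type*} [Group G] {M : Type*} [AddCommGroup M] [Module k M]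

/-- Words in `Ḡ = G \ {1}`, i.e. elements of the disjoint union of all `Ḡ^n`, `n ≥ 0`. -/
abbrev Word (G : Type*) [Group G] : Type _ := {w : List G // (1 : G) ∉ w}

/-- The value `φ(g₁, …, g_n)` of a normalized cochain; it is zero if some `g_i` is `1`. -/
noncomputable def ev (l : List G) : (Word G →₀ M) →ₗ[k] M := by
  classical exact if h : (1 : G) ∉ l then Finsupp.lapply ⟨l, h⟩ else 0

/-- The normalized chain `a ⊗ (g₁, …, g_n)`; it is zero if some `g_i` is `1`. -/
noncomputable def tens (l : List G) : M →ₗ[k] (Word G →₀ M) := by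
  classical exact if h : (1 : G) ∉ l then Finsupp.lsingle ⟨l, h⟩ else 0

theorem ev_bounded (φ : Word G →₀ M) : ∃ N : ℕ, ∀ l : List G, N < l.length → ev k l φ = 0 := by
  classical
  refine ⟨φ.support.sup (fun w => w.1.length), fun l hl => ?_⟩
  unfold ev
  split_ifs with h
  · rfl
  · by_contra hne
    have := Finset.le_sup (f := fun w : Word G => w.1.length)
      (Finsupp.mem_support_iff.2 (show φ ⟨l, h⟩ ≠ 0 from hne))
    simp only at this
    omega

/-- The cochain with prescribed values, for a function that vanishes on all long words. -/
noncomputable def ofBounded [Finite G] (F : List G → M)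
    (hF : ∃ N : ℕ, ∀ l : List G, N < l.length → F l = 0) : Word G →₀ M :=
  Finsupp.ofSupportFinite (fun w => F w.1) (by
    obtain ⟨N, hN⟩ := hF
    refine ((List.finite_length_le G N).preimage (f := fun w : Word G => w.1)
      Subtype.val_injective.injOn).subset fun w hw => ?_
    by_contra hlt
    exact hw (hN _ (by simpa using hlt)))

@[simp] theorem ofBounded_apply [Finite G] (F : List G → M)
    (hF : ∃ N : ℕ, ∀ l : List G, N < l.length → F l = 0) (w : Word G) :
    ofBounded F hF w = F w.1 := rfl

/-- `merge i (g₁, …, g_n) = (g₁, …, g_{i+1} g_{i+2}, …, g_n)` for `i + 2 ≤ n`. -/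
def merge : ℕ → List G → List G
  | 0, a :: b :: l => (a * b) :: l
  | i + 1, a :: l => a :: merge i l
  | _, l => l

theorem length_merge (i : ℕ) (l : List G) : l.length ≤ (merge i l).length + 1 := by
  induction i generalizing l with
  | zero => rcases l with _ | ⟨a, _ | ⟨b, l⟩⟩ <;> simp [merge]
  | succ i ih =>
    rcases l with _ | ⟨a, l⟩
    · simp [merge]
    · simpa [merge] using ih l

/-- The coboundary of a cochain `φ` with coefficients in a bimodule `M` (`L g` and `R g` are the
left and the right multiplication by `g`), evaluated at a word:
`(δφ)(g₁, …, g_{n+1}) = g₁ φ(g₂, …, g_{n+1}) + ∑_{i=1}^n (-1)^i φ(…, g_i g_{i+1}, …)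
+ (-1)^{n+1} φ(g₁, …, g_n) g_{n+1}`. -/
noncomputable def coboundaryAt (L R : G → M →ₗ[k] M) (φ : Word G →₀ M) : List G → M
  | [] => 0
  | g :: t => L g (ev k t φ)
      + ∑ i ∈ Finset.range t.length, (-1 : k) ^ (i + 1) • ev k (merge i (g :: t)) φ
      + (-1 : k) ^ (t.length + 1) •
        R ((g :: t).getLast (List.cons_ne_nil g t)) (ev k (g :: t).dropLast φ)

theorem coboundaryAt_bounded (L R : G → M →ₗ[k] M) (φ : Word G →₀ M) :
    ∃ N : ℕ, ∀ l : List G, N < l.length → coboundaryAt k L R φ l = 0 := by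
  obtain ⟨N, hN⟩ := ev_bounded k φ
  refine ⟨N + 1, fun l hl => ?_⟩
  rcases l with _ | ⟨g, t⟩
  · rfl
  · have ht : N < t.length := by simpa using hl
    have h1 : ev k t φ = 0 := hN _ ht
    have h2 : ev k (g :: t).dropLast φ = 0 := hN _ (by simpa using ht)
    have h3 : ∀ i, ev k (merge i (g :: t)) φ = 0 := fun i => hN _ (by
      have := length_merge i (g :: t)
      simp only [List.length_cons] at this
      omega)
    simp [coboundaryAt, h1, h2, h3]

/-- The boundary of the chain `a ⊗ (g₁, …, g_n)` with coefficients in a bimodule: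
`a g₁ ⊗ (g₂, …, g_n) + ∑_{i=1}^{n-1} (-1)^i a ⊗ (…, g_i g_{i+1}, …)
+ (-1)^n g_n a ⊗ (g₁, …, g_{n-1})`, and `0` for `n = 0`. -/
noncomputable def boundaryAt (L R : G → M →ₗ[k] M) : List G → M →ₗ[k] (Word G →₀ M)
  | [] => 0
  | g :: t => tens k t ∘ₗ R g
      + ∑ i ∈ Finset.range t.length, (-1 : k) ^ (i + 1) • tens k (merge i (g :: t))
      + (-1 : k) ^ (t.length + 1) •
        (tens k (g :: t).dropLast ∘ₗ L ((g :: t).getLast (List.cons_ne_nil g t)))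

/-- The differential of the complete complex
`⋯ → M ⊗ k[Ḡ] → M → M → Map(Ḡ, M) → ⋯` with coefficients in a bimodule `M`. A pair `(φ, c)`
consists of a cochain `φ` and a chain `c`; the middle map is the trace `a ↦ ∑ g, g a g⁻¹`. -/
noncomputable def diff [Fintype G] (L R : G → M →ₗ[k] M) :
    ((Word G →₀ M) × (Word G →₀ M)) →ₗ[k] ((Word G →₀ M) × (Word G →₀ M)) where
  toFun x := (ofBounded (coboundaryAt k L R x.1) (coboundaryAt_bounded k L R x.1)
      + tens k ([] : List G) (∑ g : G, L g (R g⁻¹ (ev k [] x.2))),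
    x.2.sum fun w a => boundaryAt k L R w.1 a)
  map_add' x y := by
    ext w
    · rcases w with ⟨_ | ⟨g, t⟩, hw⟩
      · simp [coboundaryAt, Finset.sum_add_distrib]
      · simp only [Prod.fst_add, Prod.snd_add, map_add, Finset.sum_add_distrib, Finsupp.add_apply,
          ofBounded_apply, coboundaryAt, smul_add]
        abel
    · simp only [Prod.snd_add]
      rw [Finsupp.sum_add_index' (fun _ => map_zero _) (fun _ => map_add _)]
  map_smul' r x := by
    ext w
    · rcases w with ⟨_ | ⟨g, t⟩, hw⟩
      · simp [coboundaryAt, Finset.smul_sum]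
      · simp only [Prod.smul_fst, Prod.smul_snd, map_smul, ← Finset.smul_sum, Finsupp.add_apply,
          Finsupp.smul_apply, ofBounded_apply, coboundaryAt, smul_add, RingHom.id_apply,
          smul_comm _ r]
    · simp only [Prod.smul_snd, RingHom.id_apply]
      rw [Finsupp.sum_smul_index' (fun _ => map_zero _), Finsupp.smul_sum]
      simp only [map_smul]

/-- The sign twist `(φ, c) ↦ (φ, (-1)^s c)` for a chain `c` on words of length `s`, that is, for
an element of degree `-s - 1`. -/
noncomputable def signTwist :
    ((Word G →₀ M) × (Word G →₀ M)) →ₗ[k] ((Word G →₀ M) × (Word G →₀ M)) :=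
  LinearMap.prodMap LinearMap.id
    (Finsupp.lsum k fun w : Word G => (-1 : k) ^ w.1.length • Finsupp.lsingle w)

/-- The sign-modified differential: equal to `diff` in degrees `≥ -1`, and to `(-1)^s` times the
boundary on chains on words of length `s`. -/
noncomputable def signedDiff [Fintype G] (L R : G → M →ₗ[k] M) :
    ((Word G →₀ M) × (Word G →₀ M)) →ₗ[k] ((Word G →₀ M) × (Word G →₀ M)) :=
  diff k L R ∘ₗ signTwist k

/-- The homogeneous elements of degree `n`: cochains on words of length `n` if `n ≥ 0`, and chains
on words of length `s` if `n = -s - 1 < 0`. -/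
noncomputable def degreePart (G : Type*) [Group G] (M : Type*) [AddCommGroup M] [Module k M] (n : ℤ) :
    Submodule k ((Word G →₀ M) × (Word G →₀ M)) :=
  (Finsupp.supported M k {w : Word G | (w.1.length : ℤ) = n}).prod
    (Finsupp.supported M k {w : Word G | -(w.1.length : ℤ) - 1 = n})

/-- The bilinear form on pairs (cochain, chain) induced by a bilinear form `b` on `M`:
`⟨φ, a ⊗ (g₁, …, g_n)⟩ = ⟨a ⊗ (g₁, …, g_n), φ⟩ = b (φ(g₁, …, g_n)) a`. -/
noncomputable def pairingOf (G : Type*) [Group G] (b : M →ₗ[k] M →ₗ[k] k) :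
    ((Word G →₀ M) × (Word G →₀ M)) →ₗ[k] ((Word G →₀ M) × (Word G →₀ M)) →ₗ[k] k :=
  LinearMap.mk₂ k
    (fun x y => (y.2.sum fun w a => b (x.1 w) a) + (x.2.sum fun w a => b (y.1 w) a))
    (fun x x' y => by
      simp only [Prod.fst_add, Prod.snd_add, Finsupp.add_apply, map_add, LinearMap.add_apply,
        Finsupp.sum_add]
      rw [Finsupp.sum_add_index' (fun _ => map_zero _) (fun _ => map_add _)]
      abel)
    (fun r x y => by
      simp only [Prod.smul_fst, Prod.smul_snd, Finsupp.smul_apply, map_smul, LinearMap.smul_apply]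
      rw [Finsupp.sum_smul_index' (fun _ => map_zero _)]
      simp only [map_smul, ← Finsupp.smul_sum, smul_add])
    (fun x y y' => by
      simp only [Prod.fst_add, Prod.snd_add, Finsupp.add_apply, map_add, LinearMap.add_apply,
        Finsupp.sum_add]
      rw [Finsupp.sum_add_index' (fun _ => map_zero _) (fun _ => map_add _)]
      abel)
    (fun r x y => by
      simp only [Prod.smul_fst, Prod.smul_snd, Finsupp.smul_apply, map_smul, LinearMap.smul_apply]
      rw [Finsupp.sum_smul_index' (fun _ => map_zero _)]
      simp only [map_smul, ← Finsupp.smul_sum, smul_add])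

end Words

/-! ### The Tate-Hochschild cochain complex of a group algebra -/

section GroupAlgebra

variable (k : Type*) [Field k] (G : Type*) [Group G]

/-- `𝒟^*(kG, kG)`: pairs of a cochain (an element of `⨁_n Map(Ḡ^n, kG)`, that is, a finitely
supported function on words, as `G` is finite) and a chain (an element of `⨁_n kG ⊗ k[Ḡ^n]`). -/
abbrev D : Type _ := (Word G →₀ MonoidAlgebra k G) × (Word G →₀ MonoidAlgebra k G)

variable {G}

/-- The group element `g` as an element of `kG`. -/
noncomputable def el (g : G) : MonoidAlgebra k G := MonoidAlgebra.single g 1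

/-- Left multiplication by `g` on `kG`. -/
noncomputable def lmul (g : G) : MonoidAlgebra k G →ₗ[k] MonoidAlgebra k G :=
  LinearMap.mulLeft k (el k g)

/-- Right multiplication by `g` on `kG`. -/
noncomputable def rmul (g : G) : MonoidAlgebra k G →ₗ[k] MonoidAlgebra k G :=
  LinearMap.mulRight k (el k g)

/-- The symmetrizing form of `kG`: the coefficient of `1` in `a b`, so that `⟨g, h⟩` is `1` if
`g h = 1` and `0` otherwise. -/
noncomputable def symmForm : MonoidAlgebra k G →ₗ[k] MonoidAlgebra k G →ₗ[k] k :=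
  LinearMap.mk₂ k (fun a b => (a * b).coeff 1)
    (fun a a' b => by simp [add_mul])
    (fun r a b => by simp)
    (fun a b b' => by simp [mul_add])
    (fun r a b => by simp)

variable (G) in
/-- The bilinear form on `𝒟^*(kG, kG)`. -/
noncomputable def pairing : D k G →ₗ[k] D k G →ₗ[k] k := pairingOf k G (symmForm k)

/-- The cochain component of the cup product of `x` and `y`, evaluated at a word `l`. The three terms
are the products of a cochain and a cochain, `∑ α(u) β(v)` over `l = u v`, of a cochain and a
chain `a ⊗ w`, `∑_g α(l, g⁻¹, w) a g`, and of a chain `a ⊗ w` and a cochain,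
`∑_g g a β(w, g⁻¹, l)`. -/
noncomputable def cupCochainAt [Fintype G] (x y : D k G) (l : List G) : MonoidAlgebra k G :=
  ∑ i ∈ Finset.range (l.length + 1), ev k (l.take i) x.1 * ev k (l.drop i) y.1
  + (y.2.sum fun w a => ∑ g : G, ev k (l ++ g⁻¹ :: w.1) x.1 * a * el k g)
  + (x.2.sum fun w a => ∑ g : G, el k g * a * ev k (w.1 ++ g⁻¹ :: l) y.1)

/-- The chain component of the cup product of `x` and `y`. The three terms are the products
of a chain `a ⊗ w`, `a = ∑ a_{g₀} g₀`, and a chain `b ⊗ v`,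
`∑ a_{g₀} g b ⊗ (v, g⁻¹ g₀, w)` over `g, g₀ ∈ G`, of a cochain and a chain `b ⊗ v`,
`∑ α(v'') b ⊗ v'` over `v = v' v''`, and of a chain `a ⊗ w` and a cochain,
`∑ a β(w') ⊗ w''` over `w = w' w''`. -/
noncomputable def cupChain [Fintype G] (x y : D k G) : Word G →₀ MonoidAlgebra k G :=
  (x.2.sum fun w a => y.2.sum fun v b => ∑ g : G, ∑ g₀ : G,
      a.coeff g₀ • tens k (v.1 ++ (g⁻¹ * g₀) :: w.1) (el k g * b))
  + (y.2.sum fun v b => ∑ i ∈ Finset.range (v.1.length + 1),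
      tens k (v.1.take i) (ev k (v.1.drop i) x.1 * b))
  + (x.2.sum fun w a => ∑ i ∈ Finset.range (w.1.length + 1),
      tens k (w.1.drop i) (a * ev k (w.1.take i) y.1))

/-- The ternary operation of a cochain `φ`, a chain `a ⊗ (g₁, …, g_r)` and a cochain `ψ`, evaluated
at a word `l`: the sum over `g ∈ G`, over `l = u v` and over `j = j' + 1` of
`(-1)^{m + r + j - 1} φ(u, g, g_j, …, g_r) a ψ(g₁, …, g_{j-1}, g⁻¹, v)`, where `m` is the number of
arguments of `φ`. -/
noncomputable def ternaryCochainAt [Fintype G] (x y z : D k G) (l : List G) :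
    MonoidAlgebra k G :=
  y.2.sum fun w a => ∑ g : G, ∑ i ∈ Finset.range (l.length + 1),
    ∑ j' ∈ Finset.range (w.1.length + 1),
      (-1 : k) ^ ((l.take i ++ g :: w.1.drop j').length + w.1.length + j') •
        (ev k (l.take i ++ g :: w.1.drop j') x.1 * a *
          ev k (w.1.take j' ++ g⁻¹ :: l.drop i) z.1)

/-- The ternary operation of a chain `a ⊗ (g₁, …, g_r)`, a cochain `φ` and a chain
`b ⊗ (h₁, …, h_s)`: the sum over `g ∈ G`, `0 ≤ i ≤ r` and `0 ≤ j ≤ s` of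
`(-1)^{m + r + s - j} a φ(g₁, …, g_i, g, h_{j+1}, …, h_s) b ⊗ (h₁, …, h_j, g⁻¹, g_{i+1}, …, g_r)`,
where `m` is the number of arguments of `φ`. -/
noncomputable def ternaryChain [Fintype G] (x y z : D k G) : Word G →₀ MonoidAlgebra k G :=
  x.2.sum fun w a => z.2.sum fun v b => ∑ g : G, ∑ i ∈ Finset.range (w.1.length + 1),
    ∑ j ∈ Finset.range (v.1.length + 1),
      (-1 : k) ^ ((w.1.take i ++ g :: v.1.drop j).length + w.1.length + (v.1.length - j)) •
        tens k (v.1.take j ++ g⁻¹ :: w.1.drop i)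
          (a * ev k (w.1.take i ++ g :: v.1.drop j) y.1 * b)

section Bounds

variable [Fintype G]

theorem cupCochainAt_bounded (x y : D k G) :
    ∃ N : ℕ, ∀ l : List G, N < l.length → cupCochainAt k x y l = 0 := by
  obtain ⟨N, hN⟩ := ev_bounded k x.1
  obtain ⟨N', hN'⟩ := ev_bounded k y.1
  refine ⟨N + N', fun l hl => ?_⟩
  have h1 : ∀ i ∈ Finset.range (l.length + 1),
      ev k (l.take i) x.1 * ev k (l.drop i) y.1 = 0 := fun i hi => by
    rw [Finset.mem_range] at hi
    by_cases h : N < i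
    · rw [hN _ (by simp only [List.length_take]; omega), zero_mul]
    · rw [hN' _ (by simp only [List.length_drop]; omega), mul_zero]
  have h2 : ∀ (w : Word G) (g : G), ev k (l ++ g⁻¹ :: w.1) x.1 = 0 := fun w g =>
    hN _ (by simp only [List.length_append]; omega)
  have h3 : ∀ (w : Word G) (g : G), ev k (w.1 ++ g⁻¹ :: l) y.1 = 0 := fun w g =>
    hN' _ (by simp only [List.length_append, List.length_cons]; omega)
  rw [cupCochainAt, Finset.sum_eq_zero h1]
  simp [h2, h3]

theorem ternaryCochainAt_bounded (x y z : D k G) :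
    ∃ N : ℕ, ∀ l : List G, N < l.length → ternaryCochainAt k x y z l = 0 := by
  obtain ⟨N, hN⟩ := ev_bounded k x.1
  obtain ⟨N', hN'⟩ := ev_bounded k z.1
  refine ⟨N + N', fun l hl => ?_⟩
  refine Finset.sum_eq_zero fun w _ => Finset.sum_eq_zero fun g _ =>
    Finset.sum_eq_zero fun i hi => Finset.sum_eq_zero fun j _ => ?_
  rw [Finset.mem_range] at hi
  by_cases h : N < i
  · rw [hN _ (by simp only [List.length_append, List.length_take, List.length_cons]; omega),
      zero_mul, zero_mul, smul_zero]
  · rw [hN' (w.1.take j ++ g⁻¹ :: l.drop i)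
      (by simp only [List.length_append, List.length_drop, List.length_cons]; omega),
      mul_zero, smul_zero]

end Bounds

/-- The (generalized) cup product on `𝒟^*(kG, kG)`. -/
noncomputable def cup [Fintype G] (x y : D k G) : D k G :=
  (ofBounded (cupCochainAt k x y) (cupCochainAt_bounded k x y), cupChain k x y)

/-- The ternary product on `𝒟^*(kG, kG)`; it vanishes on all triples of cochains and chains except
(cochain, chain, cochain) and (chain, cochain, chain). -/
noncomputable def ternary [Fintype G] (x y z : D k G) : D k G :=
  (ofBounded (ternaryCochainAt k x y z) (ternaryCochainAt_bounded k x y z), ternaryChain k x y z)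

section Linearity

theorem sum_add_aux {N : Type*} [AddCommGroup N] [Module k N] (c d : Word G →₀ MonoidAlgebra k G)
    (F : Word G → MonoidAlgebra k G → N) (h : ∀ w a b, F w (a + b) = F w a + F w b) :
    (c + d).sum F = c.sum F + d.sum F :=
  Finsupp.sum_add_index' (fun w => by simpa using h w 0 0) h

theorem sum_smul_aux {N : Type*} [AddCommGroup N] [Module k N] (r : k)
    (c : Word G →₀ MonoidAlgebra k G)
    (F : Word G → MonoidAlgebra k G → N) (h : ∀ w (s : k) a, F w (s • a) = s • F w a) :
    (r • c).sum F = r • c.sum F := by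
  rw [Finsupp.sum_smul_index' (fun w => by simpa using h w 0 0), Finsupp.smul_sum]
  simp only [h]

variable [Fintype G]

theorem cup_add_left (x x' y : D k G) : cup k (x + x') y = cup k x y + cup k x' y := by
  refine Prod.ext (Finsupp.ext fun w => ?_) ?_
  · simp only [cup, Prod.fst_add, Prod.snd_add, Finsupp.add_apply, ofBounded_apply, cupCochainAt,
      map_add, add_mul, Finset.sum_add_distrib, Finsupp.sum_add]
    rw [sum_add_aux k _ _ _ fun w a b => by
      simp only [mul_add, add_mul, Finset.sum_add_distrib]]
    abel
  · simp only [cup, Prod.fst_add, Prod.snd_add, cupChain, map_add, add_mul,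
      Finset.sum_add_distrib, Finsupp.sum_add]
    rw [sum_add_aux k _ _ _ fun w a b => by
        simp only [MonoidAlgebra.coeff_add, Finsupp.add_apply, add_smul, Finset.sum_add_distrib,
          Finsupp.sum_add],
      sum_add_aux k _ _ _ fun w a b => by
        simp only [add_mul, map_add, Finset.sum_add_distrib]]
    abel

theorem cup_add_right (x y y' : D k G) : cup k x (y + y') = cup k x y + cup k x y' := by
  refine Prod.ext (Finsupp.ext fun w => ?_) ?_
  · simp only [cup, Prod.fst_add, Prod.snd_add, Finsupp.add_apply, ofBounded_apply, cupCochainAt,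
      map_add, mul_add, Finset.sum_add_distrib, Finsupp.sum_add]
    rw [sum_add_aux k _ _ _ fun w a b => by
      simp only [mul_add, add_mul, Finset.sum_add_distrib]]
    abel
  · simp only [cup, Prod.fst_add, Prod.snd_add, cupChain, map_add, mul_add,
      Finset.sum_add_distrib, Finsupp.sum_add]
    simp only [fun (F : Word G → MonoidAlgebra k G → Word G →₀ MonoidAlgebra k G) h =>
      sum_add_aux k y.2 y'.2 F h, mul_add, map_add, smul_add, Finset.sum_add_distrib,
      implies_true, Finsupp.sum_add]
    abel

theorem cup_smul_left (r : k) (x y : D k G) : cup k (r • x) y = r • cup k x y := by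
  refine Prod.ext (Finsupp.ext fun w => ?_) ?_
  · simp only [cup, Prod.smul_fst, Prod.smul_snd, Finsupp.smul_apply, ofBounded_apply,
      cupCochainAt, map_smul, smul_mul_assoc, ← Finset.smul_sum, ← Finsupp.smul_sum, smul_add]
    rw [sum_smul_aux k _ _ _ fun w s a => by
      simp only [mul_smul_comm, smul_mul_assoc, ← Finset.smul_sum]]
  · simp only [cup, Prod.smul_fst, Prod.smul_snd, cupChain, map_smul, smul_mul_assoc,
      ← Finset.smul_sum, ← Finsupp.smul_sum, smul_add]
    rw [sum_smul_aux k _ _ _ fun w s a => by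
        simp only [MonoidAlgebra.coeff_smul, Finsupp.smul_apply, smul_assoc, ← Finset.smul_sum,
          ← Finsupp.smul_sum],
      sum_smul_aux k _ _ _ fun w s a => by
        simp only [smul_mul_assoc, map_smul, ← Finset.smul_sum]]

theorem cup_smul_right (r : k) (x y : D k G) : cup k x (r • y) = r • cup k x y := by
  refine Prod.ext (Finsupp.ext fun w => ?_) ?_
  · simp only [cup, Prod.smul_fst, Prod.smul_snd, Finsupp.smul_apply, ofBounded_apply,
      cupCochainAt, map_smul, mul_smul_comm, ← Finset.smul_sum, ← Finsupp.smul_sum, smul_add]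
    rw [sum_smul_aux k _ _ _ fun w s a => by
      simp only [mul_smul_comm, smul_mul_assoc, ← Finset.smul_sum]]
  · simp only [cup, Prod.smul_fst, Prod.smul_snd, cupChain, map_smul, mul_smul_comm,
      ← Finset.smul_sum, ← Finsupp.smul_sum, smul_add]
    congr 2
    · rw [Finsupp.smul_sum]
      refine Finsupp.sum_congr fun w _ => sum_smul_aux k _ _ _ fun v s b => ?_
      simp only [mul_smul_comm, map_smul, Finset.smul_sum, smul_comm _ s]
    · exact sum_smul_aux k _ _ _ fun v s b => by
        simp only [mul_smul_comm, map_smul, Finset.smul_sum]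

theorem ternary_add_left (x x' y z : D k G) :
    ternary k (x + x') y z = ternary k x y z + ternary k x' y z := by
  refine Prod.ext (Finsupp.ext fun l => ?_) ?_
  · simp only [ternary, Prod.fst_add, Finsupp.add_apply, ofBounded_apply,
      ternaryCochainAt, map_add, add_mul, smul_add, Finset.sum_add_distrib, Finsupp.sum_add]
  · simp only [ternary, Prod.snd_add, ternaryChain]
    exact sum_add_aux k _ _ _ fun w a b => by
      simp only [add_mul, map_add, smul_add, Finset.sum_add_distrib, Finsupp.sum_add]

theorem ternary_add_mid (x y y' z : D k G) :
    ternary k x (y + y') z = ternary k x y z + ternary k x y' z := by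
  refine Prod.ext (Finsupp.ext fun l => ?_) ?_
  · simp only [ternary, Prod.fst_add, Prod.snd_add, Finsupp.add_apply, ofBounded_apply,
      ternaryCochainAt]
    exact sum_add_aux k _ _ _ fun w a b => by
      simp only [mul_add, add_mul, smul_add, Finset.sum_add_distrib]
  · simp only [ternary, Prod.fst_add, Prod.snd_add, ternaryChain, map_add, mul_add, add_mul,
      smul_add, Finset.sum_add_distrib, Finsupp.sum_add]

theorem ternary_add_right (x y z z' : D k G) :
    ternary k x y (z + z') = ternary k x y z + ternary k x y z' := by
  refine Prod.ext (Finsupp.ext fun l => ?_) ?_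
  · simp only [ternary, Prod.fst_add, Finsupp.add_apply, ofBounded_apply,
      ternaryCochainAt, map_add, mul_add, smul_add, Finset.sum_add_distrib, Finsupp.sum_add]
  · simp only [ternary, Prod.snd_add, ternaryChain]
    rw [← Finsupp.sum_add]
    refine Finsupp.sum_congr fun w _ => sum_add_aux k _ _ _ fun v a b => ?_
    simp only [mul_add, map_add, smul_add, Finset.sum_add_distrib]

theorem ternary_smul_left (r : k) (x y z : D k G) :
    ternary k (r • x) y z = r • ternary k x y z := by
  refine Prod.ext (Finsupp.ext fun l => ?_) ?_
  · simp only [ternary, Prod.smul_fst, Finsupp.smul_apply, ofBounded_apply,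
      ternaryCochainAt, map_smul, smul_mul_assoc, Finset.smul_sum, Finsupp.smul_sum,
      smul_comm _ r]
  · simp only [ternary, Prod.smul_snd, ternaryChain]
    exact sum_smul_aux k _ _ _ fun w s a => by
      simp only [smul_mul_assoc, map_smul, Finset.smul_sum, Finsupp.smul_sum, smul_comm _ s]

theorem ternary_smul_mid (r : k) (x y z : D k G) :
    ternary k x (r • y) z = r • ternary k x y z := by
  refine Prod.ext (Finsupp.ext fun l => ?_) ?_
  · simp only [ternary, Prod.smul_fst, Prod.smul_snd, Finsupp.smul_apply, ofBounded_apply,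
      ternaryCochainAt]
    exact sum_smul_aux k _ _ _ fun w s a => by
      simp only [mul_smul_comm, smul_mul_assoc, Finset.smul_sum, smul_comm _ s]
  · simp only [ternary, Prod.smul_fst, Prod.smul_snd, ternaryChain, map_smul, mul_smul_comm,
      smul_mul_assoc, Finset.smul_sum, Finsupp.smul_sum, smul_comm _ r]

theorem ternary_smul_right (r : k) (x y z : D k G) :
    ternary k x y (r • z) = r • ternary k x y z := by
  refine Prod.ext (Finsupp.ext fun l => ?_) ?_
  · simp only [ternary, Prod.smul_fst, Finsupp.smul_apply, ofBounded_apply,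
      ternaryCochainAt, map_smul, mul_smul_comm, Finset.smul_sum, Finsupp.smul_sum,
      smul_comm _ r]
  · simp only [ternary, Prod.smul_snd, ternaryChain]
    rw [Finsupp.smul_sum]
    refine Finsupp.sum_congr fun w _ => sum_smul_aux k _ _ _ fun v s b => ?_
    simp only [mul_smul_comm, map_smul, Finset.smul_sum, smul_comm _ s]

end Linearity

variable (G) in
/-- The differential of `𝒟^*(kG, kG)`. -/
noncomputable def hochDiff [Fintype G] : D k G →ₗ[k] D k G := diff k (lmul k) (rmul k)

variable (G) in
/-- The sign-modified differential `∂'` of `𝒟^*(kG, kG)`. -/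
noncomputable def hochDiff' [Fintype G] : D k G →ₗ[k] D k G := signedDiff k (lmul k) (rmul k)

variable (G) in
/-- The operations `m₁ = ∂'`, `m₂ = ∪`, `m₃` and `m_n = 0` for `n > 3` on `𝒟^*(kG, kG)`. -/
noncomputable def ops [Fintype G] : (n : ℕ) → MultilinearMap k (fun _ : Fin n => D k G) (D k G)
  | 1 => MultilinearMap.mk' (fun a => hochDiff' k G (a 0))
      (by intro a i x y; fin_cases i; simp)
      (by intro a i c x; fin_cases i; simp)
  | 2 => MultilinearMap.mk' (fun a => cup k (a 0) (a 1))
      (by intro a i x y; fin_cases i <;> simp [cup_add_left, cup_add_right])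
      (by intro a i c x; fin_cases i <;> simp [cup_smul_left, cup_smul_right])
  | 3 => MultilinearMap.mk' (fun a => ternary k (a 0) (a 1) (a 2))
      (by
        intro a i x y
        fin_cases i <;>
          simp [Function.update, ternary_add_left, ternary_add_mid, ternary_add_right])
      (by
        intro a i c x
        fin_cases i <;>
          simp [Function.update, ternary_smul_left, ternary_smul_mid, ternary_smul_right])
  | _ => 0

/-- The subspace `k[S]` of `kG` for a subset `S` of `G`. -/
noncomputable def spanOf (S : Set G) : Submodule k (MonoidAlgebra k G) :=
  Submodule.span k (el k '' S)

/-- The summand of `𝒟^*(kG, kG)` that belongs to the conjugacy class `C` of `x`: cochains with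
`φ(g₁, …, g_n) ∈ k[g₁ ⋯ g_n C]`, and chains spanned by all `(g_s⁻¹ ⋯ g₁⁻¹ u, g₁, …, g_s)` with
`u ∈ C`. -/
noncomputable def summand (x : G) : Submodule k (D k G) where
  carrier := {p | (∀ w : Word G, p.1 w ∈ spanOf k {g | ∃ u, IsConj x u ∧ g = w.1.prod * u}) ∧
    (∀ w : Word G, p.2 w ∈ spanOf k {g | ∃ u, IsConj x u ∧ g = w.1.prod⁻¹ * u})}
  add_mem' ha hb := ⟨fun w => add_mem (ha.1 w) (hb.1 w), fun w => add_mem (ha.2 w) (hb.2 w)⟩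
  zero_mem' := ⟨fun _ => zero_mem _, fun _ => zero_mem _⟩
  smul_mem' r _ ha :=
    ⟨fun w => Submodule.smul_mem _ r (ha.1 w), fun w => Submodule.smul_mem _ r (ha.2 w)⟩

/-- The homogeneous elements of degree `n` of a summand. -/
noncomputable def summandPart (x : G) (n : ℤ) : Submodule k (summand k x) :=
  (degreePart k G (MonoidAlgebra k G) n).comap (summand k x).subtype

/-! ### The Tate cochain complex with trivial coefficients -/

variable (G)

/-- `Ĉ^*(G, k)`: pairs of a group cochain and a group chain with coefficients in `k`. -/
abbrev Tate : Type _ := (Word G →₀ k) × (Word G →₀ k)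

/-- The differential of `Ĉ^*(G, k)`; the middle map is multiplication by `|G|`. -/
noncomputable def tateDiff [Fintype G] : Tate k G →ₗ[k] Tate k G :=
  diff k (fun _ => LinearMap.id) (fun _ => LinearMap.id)

/-- The sign-modified differential of `Ĉ^*(G, k)`. -/
noncomputable def tateDiff' [Fintype G] : Tate k G →ₗ[k] Tate k G :=
  signedDiff k (fun _ => LinearMap.id) (fun _ => LinearMap.id)

/-- The duality pairing on `Ĉ^*(G, k)`: `⟨φ, (g₁, …, g_n)⟩ = φ(g₁, …, g_n)`. -/
noncomputable def tatePairing : Tate k G →ₗ[k] Tate k G →ₗ[k] k :=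
  pairingOf k G (LinearMap.mul k k)

/-- The embedding `Ĉ^*(G, k) → 𝒟^*(kG, kG)`: a cochain `φ` goes to
`(g₁, …, g_n) ↦ φ(g₁, …, g_n) g₁ ⋯ g_n`, a chain `(g₁, …, g_n)` to
`(g_n⁻¹ ⋯ g₁⁻¹, g₁, …, g_n)`. -/
noncomputable def tateEmb : Tate k G →ₗ[k] D k G :=
  LinearMap.prodMap
    (Finsupp.lsum k fun w : Word G =>
      Finsupp.lsingle w ∘ₗ LinearMap.toSpanSingleton k _ (el k w.1.prod))
    (Finsupp.lsum k fun w : Word G =>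
      Finsupp.lsingle w ∘ₗ LinearMap.toSpanSingleton k _ (el k w.1.prod⁻¹))

end GroupAlgebra

end TateHochschild

/-!
All identities are reduced to identities between scalars by duality. The trace form of `kG` makes
cochains and chains on words dual to each other (`dual`), and for this duality each operation is
determined by a multilinear form: the two components of `∂'` other than the trace are transposes of
each other (`dual_bdry`), all components of the cup product are obtained from the two forms
`⟨φ ∪ ψ, c⟩` and `⟨φ ∪ c, d⟩` by rotation (`dual_chH`, `dual_hcH`, `dual_hhH`, `dual_hcC`), and both
components of `m₃` from the single form `⟨φ, m₃(c, ψ, d)⟩`, which is itself invariant up to sign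
under rotation by two places (`dual_chcC`, `dual_hchH_rotate`). This yields cyclicity, and since
the pairing is non-degenerate, a Stasheff identity needs to be checked only after pairing with one
more element. There the many cases of cochain and chain inputs collapse to rotations of a few.

The remaining identities are sums over the cuts of words into consecutive pieces (`splitSum`).

* `∂'` squares to zero because the bar differential does (`bar_bar`, `cob_cob`).
* The Leibniz rule is `cob_splitSum_mul` for two cochains, and `dual_chC_coD` for one cochain and
  two chains: merging the inserted letter `g⁻¹` with a neighbour becomes, by a translation in the
  sum over `g`, an outer face of the product, and where there is no neighbour, that is, for an
  empty word, it becomes a trace.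
* Associativity up to the homotopy `m₃` holds strictly (`dual_ccC_hhH`, `dual_hcC_hhH`) unless two
  cochains and two chains alternate. In that case (`dual_coD_chcC`) the differential of `m₃`
  telescopes: by the translation `g ↦ g x` of the inserted letter, merging it with its neighbour on
  one side for one cut of a word cancels against merging on the other side for the next cut, and
  only the two extreme cuts survive, which are the two bracketings of the cup product.
* The identity with four inputs follows from cutting a word at a marked letter (`dual_ccC_hchH`,
  `dual_hcC_hchH`). In the one with five inputs (`dual_hchH_hchH`) each of the three terms is a
  difference of two of three sums, which differ by the word that is cut twice. With six or more
  inputs there is nothing to prove.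

The grading and the decomposition by conjugacy classes are treated together. A family of
conjugation invariant subsets of `G`, indexed by the degree (`ConjFamily`), cuts out a subspace of
`𝒟^*`, and an inclusion between products of such subsets implies one for the operations
(`cup_mem_graded`, `ternary_mem_graded`, `hochDiff'_mem_graded`). The family that is all of `G` in
one degree gives the homogeneous components, and a conjugacy class in all degrees gives the
summands. The class of `1` is the image of the Tate complex, so the operations restrict to it, and
its products with another class lie in that class. The identities for the subalgebra and for the
modules are then those of `𝒟^*`, where for the modules the sum over blocks of consecutive inputs is
split according to whether the block contains the module element (`sum_blocks_last`,
`sum_blocks_first`).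
-/

namespace TateHochschild

/-! ### Sums over the decompositions of a word -/

section Splitting

variable {α N N' : Type*} [AddCommMonoid N] [AddCommMonoid N']

/-- The sum of `F u v` over all decompositions `l = u v` of a word. -/
def splitSum (F : List α → List α → N) : List α → N
  | [] => F [] []
  | g :: t => F [] (g :: t) + splitSum (fun u v => F (g :: u) v) t

/-- The sum of `F u x v` over all decompositions `l = u x v` of a word with a marked letter `x`. -/
def markSum (F : List α → α → List α → N) : List α → N
  | [] => 0
  | g :: t => F [] g t + markSum (fun u x v => F (g :: u) x v) t

theorem sum_range_take_drop (F : List α → List α → N) (l : List α) :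
    ∑ i ∈ Finset.range (l.length + 1), F (l.take i) (l.drop i) = splitSum F l := by
  induction l generalizing F with
  | nil => simp [splitSum]
  | cons g t ih =>
    rw [List.length_cons, Finset.sum_range_succ', splitSum, add_comm, ← ih]
    simp

theorem splitSum_congr {F F' : List α → List α → N} {l : List α}
    (h : ∀ u v, u ++ v = l → F u v = F' u v) : splitSum F l = splitSum F' l := by
  induction l generalizing F F' with
  | nil => exact h _ _ rfl
  | cons g t ih =>
    rw [splitSum, splitSum, h _ _ rfl, ih fun u v huv => h _ _ (by simp [huv])]

theorem markSum_congr {F F' : List α → α → List α → N} {l : List α}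
    (h : ∀ u x v, u ++ x :: v = l → F u x v = F' u x v) : markSum F l = markSum F' l := by
  induction l generalizing F F' with
  | nil => rfl
  | cons g t ih =>
    rw [markSum, markSum, h _ _ _ rfl, ih fun u x v huv => h _ _ _ (by simp [huv])]

theorem splitSum_add (F F' : List α → List α → N) (l : List α) :
    splitSum (fun u v => F u v + F' u v) l = splitSum F l + splitSum F' l := by
  induction l generalizing F F' with
  | nil => rfl
  | cons g t ih => simp only [splitSum, ih]; exact add_add_add_comm _ _ _ _

theorem splitSum_zero (l : List α) : splitSum (fun _ _ => (0 : N)) l = 0 := by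
  induction l with
  | nil => rfl
  | cons g t ih => simp only [splitSum, ih, add_zero]

theorem splitSum_eq_zero {F : List α → List α → N} {l : List α}
    (h : ∀ u v, u ++ v = l → F u v = 0) : splitSum F l = 0 := by
  rw [splitSum_congr h, splitSum_zero]

theorem map_splitSum {Φ : Type*} [FunLike Φ N N'] [AddMonoidHomClass Φ N N'] (f : Φ)
    (F : List α → List α → N) (l : List α) :
    f (splitSum F l) = splitSum (fun u v => f (F u v)) l := by
  induction l generalizing F with
  | nil => rfl
  | cons g t ih => simp only [splitSum, map_add, ih]

theorem smul_splitSum {R : Type*} [Monoid R] [DistribMulAction R N] (r : R)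
    (F : List α → List α → N) (l : List α) :
    r • splitSum F l = splitSum (fun u v => r • F u v) l :=
  map_splitSum (DistribSMul.toAddMonoidHom N r) F l

theorem sum_splitSum {ι : Type*} (s : Finset ι) (F : ι → List α → List α → N) (l : List α) :
    ∑ i ∈ s, splitSum (F i) l = splitSum (fun u v => ∑ i ∈ s, F i u v) l := by
  induction l generalizing F with
  | nil => rfl
  | cons g t ih => simp only [splitSum, Finset.sum_add_distrib, ih]

theorem sum_markSum {ι : Type*} (s : Finset ι) (F : ι → List α → α → List α → N) (l : List α) :
    ∑ i ∈ s, markSum (F i) l = markSum (fun u x v => ∑ i ∈ s, F i u x v) l := by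
  induction l generalizing F with
  | nil => simp [markSum]
  | cons g t ih => simp only [markSum, Finset.sum_add_distrib, ih]

theorem splitSum_comm {β : Type*} (F : List α → List α → List β → List β → N) (l : List α)
    (m : List β) :
    splitSum (fun u v => splitSum (fun u' v' => F u v u' v') m) l =
      splitSum (fun u' v' => splitSum (fun u v => F u v u' v') l) m := by
  induction l generalizing F with
  | nil => rfl
  | cons g t ih => simp only [splitSum, splitSum_add, ih]

theorem splitSum_append_cons (F : List α → List α → N) (u : List α) (g : α) (v : List α) :
    splitSum F (u ++ g :: v) =
      splitSum (fun u₁ u₂ => F u₁ (u₂ ++ g :: v)) u +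
        splitSum (fun v₁ v₂ => F (u ++ g :: v₁) v₂) v := by
  induction u generalizing F with
  | nil => rfl
  | cons x u ih => simp only [List.cons_append, splitSum, ih, add_assoc]

theorem splitSum_concat (F : List α → List α → N) (u : List α) (g : α) :
    splitSum F (u ++ [g]) = splitSum (fun u₁ u₂ => F u₁ (u₂ ++ [g])) u + F (u ++ [g]) [] := by
  rw [splitSum_append_cons]; rfl

/-- Coassociativity of the decomposition of words. -/
theorem splitSum_splitSum (F : List α → List α → List α → N) (l : List α) :
    splitSum (fun u v => splitSum (fun v₁ v₂ => F u v₁ v₂) v) l =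
      splitSum (fun u v => splitSum (fun u₁ u₂ => F u₁ u₂ v) u) l := by
  induction l generalizing F with
  | nil => rfl
  | cons g t ih => simp only [splitSum, splitSum_add, ih, add_assoc]

/-- All cuts but the last one are in front of a letter. -/
theorem splitSum_eq_add_markSum_right (F : List α → List α → N) (l : List α) :
    splitSum F l = F l [] + markSum (fun u x v => F u (x :: v)) l := by
  induction l generalizing F with
  | nil => simp [splitSum, markSum]
  | cons g t ih => rw [splitSum, markSum, ih]; exact add_left_comm _ _ _

/-- All cuts but the first one are behind a letter. -/
theorem splitSum_eq_add_markSum_left (F : List α → List α → N) (l : List α) :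
    splitSum F l = F [] l + markSum (fun u x v => F (u ++ [x]) v) l := by
  induction l generalizing F with
  | nil => simp [splitSum, markSum]
  | cons g t ih => rw [splitSum, markSum, ih]; rfl

theorem splitSum_neg {α N : Type*} [AddCommGroup N] (F : List α → List α → N) (l : List α) :
    splitSum (fun u v => -F u v) l = -splitSum F l :=
  (map_splitSum (-AddMonoidHom.id N) F l).symm

theorem splitSum_sub {α N : Type*} [AddCommGroup N] (F F' : List α → List α → N) (l : List α) :
    splitSum (fun u v => F u v - F' u v) l = splitSum F l - splitSum F' l := by
  rw [eq_sub_iff_add_eq, ← splitSum_add]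
  simp

theorem mul_splitSum {R α : Type*} [Ring R] (r : R) (F : List α → List α → R) (l : List α) :
    r * splitSum F l = splitSum (fun u v => r * F u v) l :=
  map_splitSum (AddMonoidHom.mulLeft r) F l

end Splitting

/-! ### The bar differential on functions of words -/

section Bar

variable {k : Type*} [Field k] {G : Type*} [Group G] {N N' : Type*} [AddCommGroup N] [Module k N]
  [AddCommGroup N'] [Module k N']

/-- The alternating sum `∑ (-1)^i f (…, g_{i+1} g_{i+2}, …)` over the inner faces of a word. -/
def bar : List G → (List G → N) → N
  | g :: h :: t, f => f ((g * h) :: t) - bar (h :: t) (fun s => f (g :: s))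
  | _, _ => 0

@[simp] theorem bar_nil (f : List G → N) : bar [] f = 0 := rfl

@[simp] theorem bar_singleton (g : G) (f : List G → N) : bar [g] f = 0 := rfl

theorem bar_cons_cons (g h : G) (t : List G) (f : List G → N) :
    bar (g :: h :: t) f = f ((g * h) :: t) - bar (h :: t) (fun s => f (g :: s)) := rfl

theorem map_bar (T : N →ₗ[k] N') (l : List G) (f : List G → N) :
    T (bar l f) = bar l (fun s => T (f s)) := by
  induction l generalizing f with
  | nil => simp
  | cons g l ih =>
    rcases l with _ | ⟨h, t⟩
    · simp
    · rw [bar_cons_cons, bar_cons_cons, map_sub, ih]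

theorem bar_add (l : List G) (f f' : List G → N) :
    bar l (fun s => f s + f' s) = bar l f + bar l f' := by
  induction l generalizing f f' with
  | nil => simp
  | cons g l ih =>
    rcases l with _ | ⟨h, t⟩
    · simp
    · rw [bar_cons_cons, bar_cons_cons, bar_cons_cons, ih]; abel

theorem bar_sub (l : List G) (f f' : List G → N) :
    bar l (fun s => f s - f' s) = bar l f - bar l f' := by
  induction l generalizing f f' with
  | nil => simp
  | cons g l ih =>
    rcases l with _ | ⟨h, t⟩
    · simp
    · rw [bar_cons_cons, bar_cons_cons, bar_cons_cons, ih]; abel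

theorem bar_neg (l : List G) (f : List G → N) : bar l (fun s => -f s) = -bar l f := by
  have := bar_sub l (fun _ => 0) f
  have h0 := bar_sub l f f
  simp only [sub_self, zero_sub] at this h0
  rw [this, h0, zero_sub]

theorem bar_zero (l : List G) : bar l (fun _ => (0 : N)) = 0 := by
  simpa using bar_sub l (fun _ => (0 : N)) (fun _ => 0)

theorem bar_smul (l : List G) (r : k) (f : List G → N) :
    bar l (fun s => r • f s) = r • bar l f :=
  (map_bar (r • LinearMap.id : N →ₗ[k] N) l f).symm

/-- The sum over the inner faces in terms of the recursive operation `bar`. -/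
theorem sum_merge (f : List G → N) (g : G) (t : List G) :
    ∑ i ∈ Finset.range t.length, (-1 : k) ^ (i + 1) • f (merge i (g :: t)) =
      -bar (g :: t) f := by
  induction t generalizing f g with
  | nil => simp
  | cons h t ih =>
    have := ih (fun s => f (g :: s)) h
    rw [List.length_cons, Finset.sum_range_succ', bar_cons_cons]
    simp only [merge, pow_succ _ (_ + 1), mul_neg_one, neg_smul, Finset.sum_neg_distrib] at this ⊢
    rw [this]
    simp; abel

theorem bar_neg_one_pow_smul (l : List G) (f : List G → N) :
    bar l (fun s => (-1 : k) ^ s.length • f s) = -((-1 : k) ^ l.length • bar l f) := by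
  induction l generalizing f with
  | nil => simp
  | cons g l ih =>
    rcases l with _ | ⟨h, t⟩
    · simp
    · have := ih (fun s => f (g :: s))
      have h2 : bar (h :: t) (fun s => (-1 : k) ^ (g :: s).length • f (g :: s)) =
          -bar (h :: t) (fun s => (-1 : k) ^ s.length • f (g :: s)) := by
        rw [← bar_neg]
        simp [pow_succ]
      rw [bar_cons_cons, bar_cons_cons, h2, this]
      simp only [List.length_cons, pow_succ]
      module

/-- The inner faces of a word to the left and to the right of a marked letter. -/
theorem bar_append_cons (u : List G) (x : G) (v : List G) (f : List G → N) :
    bar (u ++ x :: v) f = bar (u ++ [x]) (fun s => f (s ++ v)) +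
      (-1 : k) ^ u.length • bar (x :: v) (fun s => f (u ++ s)) := by
  induction u generalizing f with
  | nil => simp
  | cons y u ih =>
    rcases u with _ | ⟨z, u⟩
    · simp [bar_cons_cons, sub_eq_add_neg]
    · have := ih (fun s => f (y :: s))
      simp only [List.cons_append] at this ⊢
      rw [bar_cons_cons, this, bar_cons_cons y z]
      simp only [List.length_cons, pow_succ, List.cons_append, List.append_assoc, List.nil_append]
      module

/-- The bar differential squares to zero. The faces that merge the first letter are split off, and
the other ones are handled by induction. -/
theorem bar_bar (l : List G) (f : List G → N) : bar l (fun s => bar s f) = 0 := by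
  induction l generalizing f with
  | nil => rfl
  | cons g l ih =>
    rcases l with _ | ⟨h, t⟩
    · rfl
    · rw [bar_cons_cons]
      have key : ∀ s : List G, bar (g :: s) f =
          (match s with | [] => 0 | x :: s' => f ((g * x) :: s')) -
            bar s (fun s => f (g :: s)) := by
        rintro (_ | ⟨x, s⟩)
        · simp
        · rw [bar_cons_cons]
      have h2 : bar (h :: t) (fun s => bar (g :: s) f) =
          bar (h :: t) (fun s => match s with | [] => (0 : N) | x :: s' => f ((g * x) :: s')) := by
        simp only [key]
        rw [bar_sub, ih, sub_zero]
      rw [h2, sub_eq_zero]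
      rcases t with _ | ⟨y, t⟩
      · rfl
      · rw [bar_cons_cons, bar_cons_cons]
        simp only [mul_assoc]

/-- The inner faces of a sum over cuts: each face belongs to one of the two pieces. -/
theorem bar_splitSum (F : List G → List G → N) (w : List G) :
    bar w (splitSum (fun u v => (-1 : k) ^ v.length • F u v)) =
      splitSum (fun u v => (-1 : k) ^ v.length • bar u (fun s => F s v)) w -
        (-1 : k) ^ w.length • splitSum (fun u v => bar v (fun s => F u s)) w := by
  induction w generalizing F with
  | nil => simp [splitSum]
  | cons g l ih =>
    rcases l with _ | ⟨h, t⟩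
    · simp [splitSum]
    · have ih' := ih (fun u v => F (g :: u) v)
      have e1 : bar (h :: t) (fun s => splitSum (fun u v => (-1 : k) ^ v.length • F u v) (g :: s)) =
          (-1 : k) ^ (h :: t).length • bar (h :: t) (fun s => F [] (g :: s)) +
          bar (h :: t) (splitSum (fun u v => (-1 : k) ^ v.length • F (g :: u) v)) := by
        simp only [splitSum, bar_add]
        congr 1
        have := bar_neg_one_pow_smul (k := k) (h :: t) (fun s => F [] (g :: s))
        have e2 : bar (h :: t) (fun s => (-1 : k) ^ (g :: s).length • F [] (g :: s)) =
            -bar (h :: t) (fun s => (-1 : k) ^ s.length • F [] (g :: s)) := by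
          rw [← bar_neg]
          simp [pow_succ]
        rw [e2, this, neg_neg]
      rw [bar_cons_cons, e1, ih']
      simp only [splitSum, bar_cons_cons, bar_nil, bar_singleton, smul_zero, smul_sub,
        List.length_cons, pow_succ]
      rw [splitSum_sub]
      module

end Bar

/-! ### The Hochschild coboundary on functions of words -/

section Coboundary

variable {k : Type*} [Field k] {G : Type*} [Group G]

theorem el_mul_el (g h : G) : el k g * el k h = el k (g * h) := by
  simp [el, MonoidAlgebra.single_mul_single]

@[simp] theorem el_one : el k (1 : G) = 1 := rfl

/-- The outer face `g₁ f(g₂, …, g_n)`, zero on the empty word. -/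
noncomputable def firstFace (f : List G → MonoidAlgebra k G) : List G → MonoidAlgebra k G
  | [] => 0
  | x :: t => el k x * f t

/-- The outer face `f(g₁, …, g_{n-1}) g_n`, zero on the empty word. -/
noncomputable def lastFace (f : List G → MonoidAlgebra k G) : List G → MonoidAlgebra k G
  | [] => 0
  | x :: t => f (x :: t).dropLast * el k ((x :: t).getLast (List.cons_ne_nil x t))

/-- The Hochschild coboundary of a function of words, without any normalization. -/
noncomputable def cob (f : List G → MonoidAlgebra k G) (l : List G) : MonoidAlgebra k G :=
  firstFace f l - bar l f + (-1 : k) ^ l.length • lastFace f l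

/-- The coboundary without the last face. -/
noncomputable def leftCob (f : List G → MonoidAlgebra k G) (l : List G) : MonoidAlgebra k G :=
  firstFace f l - bar l f

/-- The negative of the coboundary without the first face. -/
noncomputable def rightCob (f : List G → MonoidAlgebra k G) (l : List G) : MonoidAlgebra k G :=
  bar l f - (-1 : k) ^ l.length • lastFace f l

theorem cob_eq_leftCob (f : List G → MonoidAlgebra k G) (l : List G) :
    cob f l = leftCob f l + (-1 : k) ^ l.length • lastFace f l := rfl

theorem cob_eq_rightCob (f : List G → MonoidAlgebra k G) (l : List G) :
    cob f l = firstFace f l - rightCob f l := by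
  rw [cob, rightCob]; abel

@[simp] theorem lastFace_concat (f : List G → MonoidAlgebra k G) (u : List G) (x : G) :
    lastFace f (u ++ [x]) = f u * el k x := by
  rcases u with _ | ⟨y, u⟩
  · simp [lastFace]
  · rw [List.cons_append, lastFace]
    simp only [← List.cons_append, List.dropLast_concat, List.getLast_append_singleton]

@[simp] theorem lastFace_nil (f : List G → MonoidAlgebra k G) : lastFace f [] = 0 := rfl

@[simp] theorem firstFace_nil (f : List G → MonoidAlgebra k G) : firstFace f [] = 0 := rfl

@[simp] theorem firstFace_cons (f : List G → MonoidAlgebra k G) (x : G) (t : List G) :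
    firstFace f (x :: t) = el k x * f t := rfl

/-- The face of `f` at a marked letter `g` of `u g v` that multiplies `g` into the last letter of
`u`; if `u` is empty, it is the first outer face. -/
noncomputable def mergeLeft (f : List G → MonoidAlgebra k G) (u : List G) (g : G) (v : List G) :
    MonoidAlgebra k G :=
  if h : u = [] then el k g * f v else f (u.dropLast ++ (u.getLast h * g) :: v)

/-- The face of `f` at a marked letter `g` of `u g v` that multiplies `g` into the first letter of
`v`; if `v` is empty, it is the last outer face. -/
noncomputable def mergeRight (f : List G → MonoidAlgebra k G) (u : List G) (g : G) :
    List G → MonoidAlgebra k G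
  | [] => f u * el k g
  | y :: v => f (u ++ (g * y) :: v)

@[simp] theorem mergeLeft_nil (f : List G → MonoidAlgebra k G) (g : G) (v : List G) :
    mergeLeft f [] g v = el k g * f v := by simp [mergeLeft]

@[simp] theorem mergeLeft_concat (f : List G → MonoidAlgebra k G) (u : List G) (x g : G)
    (v : List G) : mergeLeft f (u ++ [x]) g v = f (u ++ (x * g) :: v) := by simp [mergeLeft]

/-- The coboundary at a word with a marked letter: the faces inside `u`, the faces inside `v`, and
the two faces that involve the marked letter. -/
theorem cob_append_cons (f : List G → MonoidAlgebra k G) (u : List G) (g : G) (v : List G) :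
    cob f (u ++ g :: v) = leftCob (fun s => f (s ++ g :: v)) u +
      (-1 : k) ^ u.length • (rightCob (fun s => f (u ++ g :: s)) v +
        mergeLeft f u g v - mergeRight f u g v) := by
  -- the part to the right of the marked letter
  have hR : (-1 : k) ^ (u ++ g :: v).length • lastFace f (u ++ g :: v) -
      (-1 : k) ^ u.length • bar (g :: v) (fun s => f (u ++ s)) =
      (-1 : k) ^ u.length • (rightCob (fun s => f (u ++ g :: s)) v - mergeRight f u g v) := by
    rcases List.eq_nil_or_concat' v with rfl | ⟨v, y, rfl⟩
    · rw [lastFace_concat]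
      simp only [List.length_append, List.length_cons, List.length_nil, bar_singleton, rightCob,
        bar_nil, lastFace_nil, mergeRight, pow_add]
      module
    · have e : u ++ g :: (v ++ [y]) = (u ++ g :: v) ++ [y] := by simp
      rw [e, lastFace_concat]
      have hv : bar (g :: (v ++ [y])) (fun s => f (u ++ s)) =
          mergeRight f u g (v ++ [y]) - bar (v ++ [y]) (fun s => f (u ++ g :: s)) := by
        rcases v with _ | ⟨z, v⟩
        · simp [bar_cons_cons, mergeRight]
        · simp [bar_cons_cons, mergeRight]
      rw [hv]
      simp only [List.length_append, List.length_cons, List.length_nil, rightCob, lastFace_concat,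
        pow_add]
      module
  -- the part to the left of the marked letter
  have hL : firstFace f (u ++ g :: v) - bar (u ++ [g]) (fun s => f (s ++ v)) =
      leftCob (fun s => f (s ++ g :: v)) u + (-1 : k) ^ u.length • mergeLeft f u g v := by
    rcases List.eq_nil_or_concat' u with rfl | ⟨u, x, rfl⟩
    · simp [leftCob]
    · have hu : bar (u ++ [x] ++ [g]) (fun s => f (s ++ v)) =
          bar (u ++ [x]) (fun s => f (s ++ g :: v)) +
            (-1 : k) ^ u.length • f (u ++ (x * g) :: v) := by
        rw [List.append_assoc, List.singleton_append, bar_append_cons (k := k)]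
        simp [bar_cons_cons]
      have hf : firstFace f (u ++ [x] ++ g :: v) =
          firstFace (fun s => f (s ++ g :: v)) (u ++ [x]) := by
        rcases u with _ | ⟨y, u⟩ <;> simp
      rw [hu, hf, mergeLeft_concat, leftCob]
      simp only [List.length_append, List.length_cons, List.length_nil, pow_add]
      module
  rw [cob, bar_append_cons (k := k), smul_sub, smul_add]
  rw [smul_sub] at hR
  linear_combination (norm := module) hL + hR

/-- The coboundary of a signed sum over the decompositions of a word. -/
theorem cob_splitSum (F : List G → List G → MonoidAlgebra k G) (w : List G) :
    cob (splitSum (fun u v => (-1 : k) ^ v.length • F u v)) w =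
      splitSum (fun u v => (-1 : k) ^ v.length • leftCob (fun s => F s v) u) w +
        (-1 : k) ^ w.length • splitSum (fun u v => rightCob (fun s => F u s) v) w := by
  have h1 : firstFace (splitSum (fun u v => (-1 : k) ^ v.length • F u v)) w =
      splitSum (fun u v => (-1 : k) ^ v.length • firstFace (fun s => F s v) u) w := by
    rcases w with _ | ⟨x, t⟩
    · simp [splitSum]
    · simp only [firstFace_cons, splitSum, firstFace_nil, smul_zero, zero_add,
        ← mul_smul_comm]
      exact map_splitSum (LinearMap.mulLeft k (el k x)) _ _
  have h2 : lastFace (splitSum (fun u v => (-1 : k) ^ v.length • F u v)) w =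
      -splitSum (fun u v => (-1 : k) ^ v.length • lastFace (fun s => F u s) v) w := by
    rcases List.eq_nil_or_concat' w with rfl | ⟨t, y, rfl⟩
    · simp [splitSum]
    · rw [lastFace_concat, splitSum_concat]
      simp only [lastFace_concat, lastFace_nil, smul_zero, add_zero, List.length_append,
        List.length_singleton, pow_succ, mul_neg_one, neg_smul]
      rw [splitSum_neg, neg_neg]
      simp only [← smul_mul_assoc]
      exact map_splitSum (LinearMap.mulRight k (el k y)) _ _
  rw [cob, h1, h2, bar_splitSum]
  simp only [leftCob, rightCob, smul_sub, splitSum_sub]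
  module

/-- The coboundary preserves normalized cochains: at a letter `1` only two faces can be non-zero,
and they cancel. -/
theorem cob_eq_zero_of_mem {f : List G → MonoidAlgebra k G}
    (hf : ∀ l : List G, (1 : G) ∈ l → f l = 0) {l : List G} (hl : (1 : G) ∈ l) : cob f l = 0 := by
  obtain ⟨u, v, rfl⟩ := List.append_of_mem hl
  have h0 : ∀ s : List G, f (s ++ 1 :: v) = 0 := fun s => hf _ (by simp)
  have h1 : ∀ s : List G, f (u ++ 1 :: s) = 0 := fun s => hf _ (by simp)
  have hL : ∀ s : List G, leftCob (fun _ => (0 : MonoidAlgebra k G)) s = 0 := by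
    rintro (_ | ⟨x, s⟩) <;> simp [leftCob, bar_zero]
  have hR : ∀ s : List G, rightCob (fun _ => (0 : MonoidAlgebra k G)) s = 0 := by
    rintro (_ | ⟨x, s⟩) <;> simp [rightCob, bar_zero, lastFace]
  have h2 : mergeLeft f u 1 v = f (u ++ v) := by
    rcases List.eq_nil_or_concat' u with rfl | ⟨u, x, rfl⟩ <;> simp
  have h3 : mergeRight f u 1 v = f (u ++ v) := by
    rcases v with _ | ⟨y, v⟩ <;> simp [mergeRight]
  rw [cob_append_cons]
  simp only [h0, h1, h2, h3, hL, hR]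
  simp

/-- The coboundary squares to zero: `x (cob f)(u) y` is the bar differential of `x f(u) y`. -/
theorem cob_cob (f : List G → MonoidAlgebra k G) (l : List G) : cob (cob f) l = 0 := by
  let hat : (List G → MonoidAlgebra k G) → List G → MonoidAlgebra k G := fun f l =>
    match l with
    | [] => 0
    | x :: s => el k x * lastFace f s
  have key : ∀ (f : List G → MonoidAlgebra k G) (s : List G), hat (cob f) s = bar s (hat f) := by
    intro f s
    rcases s with _ | ⟨x, s⟩
    · rfl
    rcases List.eq_nil_or_concat' s with rfl | ⟨s, y, rfl⟩
    · simp [hat]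
    rcases s with _ | ⟨z, s⟩
    · simp [hat, bar_cons_cons, cob, lastFace]
    have h1 : bar (x :: (z :: s ++ [y])) (hat f) = el k (x * z) * (f s * el k y) -
        bar (z :: s ++ [y]) (fun t => el k x * lastFace f t) := by
      rw [List.cons_append, bar_cons_cons]
      simp [hat]
    have h2 : bar (z :: s ++ [y]) (fun t => el k x * lastFace f t) =
        el k x * bar (z :: s ++ [y]) (lastFace f) :=
      (map_bar (LinearMap.mulLeft k (el k x)) _ _).symm
    have h3 : bar (z :: s ++ [y]) (lastFace f) = bar (z :: s) f * el k y -
        (-1 : k) ^ (z :: s).length • (lastFace f (z :: s) * el k y) := by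
      rcases List.eq_nil_or_concat' (z :: s) with h | ⟨t, a, h⟩
      · simp at h
      rw [h, List.append_assoc, List.singleton_append, bar_append_cons (k := k)]
      have : bar (t ++ [a]) (fun s => lastFace f (s ++ [y])) = bar (t ++ [a]) f * el k y := by
        simp only [lastFace_concat]
        exact (map_bar (LinearMap.mulRight k (el k y)) _ _).symm
      rw [this]
      have e : ∀ g : G, lastFace f (t ++ g :: []) = f t * el k g := fun g => lastFace_concat f t g
      simp only [bar_cons_cons, bar_singleton, e, List.length_append,
        List.length_singleton, pow_succ, ← el_mul_el, mul_assoc]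
      module
    rw [h1, h2, h3]
    simp only [hat, lastFace_concat, cob, firstFace_cons, ← el_mul_el]
    simp only [mul_add, mul_sub, add_mul, sub_mul, mul_smul_comm, smul_mul_assoc, mul_assoc]
    abel
  have h := key (cob f) (1 :: (l ++ [1]))
  have h2 : bar (1 :: (l ++ [1])) (hat (cob f)) = 0 := by
    rw [show hat (cob f) = fun s => bar s (hat f) from funext (key f)]
    exact bar_bar _ _
  rw [h2] at h
  simpa [hat] using h

end Coboundary

/-! ### Normalized cochains and chains -/

section EvTens

variable {k : Type*} [Field k] {G : Type*} [Group G] {M : Type*} [AddCommGroup M] [Module k M]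

theorem ev_of_mem {l : List G} (h : (1 : G) ∈ l) (φ : Word G →₀ M) : ev k l φ = 0 := by
  simp [ev, h]

theorem ev_of_notMem {l : List G} (h : (1 : G) ∉ l) (φ : Word G →₀ M) :
    ev k l φ = φ ⟨l, h⟩ := by
  simp [ev, h]

theorem tens_of_mem {l : List G} (h : (1 : G) ∈ l) (a : M) : tens k l a = 0 := by
  simp [tens, h]

theorem tens_of_notMem {l : List G} (h : (1 : G) ∉ l) (a : M) :
    tens k l a = Finsupp.single ⟨l, h⟩ a := by
  simp [tens, h]

theorem single_eq_tens (w : Word G) (a : M) : Finsupp.single w a = tens k w.1 a := by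
  rw [tens_of_notMem w.2]

theorem ev_ofBounded [Finite G] (F : List G → M)
    (hF : ∃ N : ℕ, ∀ l : List G, N < l.length → F l = 0)
    (h1 : ∀ l : List G, (1 : G) ∈ l → F l = 0) (l : List G) :
    ev k l (ofBounded F hF) = F l := by
  by_cases h : (1 : G) ∈ l
  · rw [ev_of_mem h, h1 l h]
  · rw [ev_of_notMem h]; rfl

theorem ev_ext {φ ψ : Word G →₀ M} (h : ∀ l : List G, ev k l φ = ev k l ψ) : φ = ψ := by
  ext w
  have := h w.1
  rwa [ev_of_notMem w.2, ev_of_notMem w.2] at this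

/-- A sum over the support of the elementary chain `a ⊗ l`, including the case where `l` contains
`1`. -/
theorem tens_sum {N : Type*} [AddCommMonoid N] (l : List G) (a : M) (F : Word G → M → N)
    (h0 : ∀ w, F w 0 = 0) (f : M → N) (hf : ∀ h : (1 : G) ∉ l, F ⟨l, h⟩ a = f a)
    (hf' : (1 : G) ∈ l → f a = 0) : (tens k l a).sum F = f a := by
  by_cases h : (1 : G) ∈ l
  · rw [tens_of_mem h, hf' h, Finsupp.sum_zero_index]
  · rw [tens_of_notMem h, Finsupp.sum_single_index (h0 _), hf h]

variable (k) in
/-- The degree involution `(-1)^n` on words of length `n`. -/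
noncomputable def sgn : (Word G →₀ M) →ₗ[k] (Word G →₀ M) :=
  Finsupp.lsum k fun w : Word G => (-1 : k) ^ w.1.length • Finsupp.lsingle w

theorem sgn_tens (l : List G) (a : M) :
    sgn k (tens k l a) = (-1 : k) ^ l.length • tens k l a := by
  by_cases h : (1 : G) ∈ l
  · simp [tens_of_mem h]
  · simp [tens_of_notMem h, sgn]

theorem ev_tens_self [DecidableEq G] (l l' : List G) (a : M) :
    ev k l (tens k l' a) = if l = l' ∧ (1 : G) ∉ l' then a else 0 := by
  classical
  by_cases h : (1 : G) ∈ l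
  · rw [ev_of_mem h, if_neg]
    rintro ⟨rfl, h'⟩; exact h' h
  · by_cases h' : (1 : G) ∈ l'
    · rw [tens_of_mem h', map_zero, if_neg]
      rintro ⟨_, h''⟩; exact h'' h'
    · rw [ev_of_notMem h, tens_of_notMem h', Finsupp.single_apply]
      simp [h', eq_comm]

theorem ev_sgn (l : List G) (φ : Word G →₀ M) :
    ev k l (sgn k φ) = (-1 : k) ^ l.length • ev k l φ := by
  classical
  induction φ using Finsupp.induction_linear with
  | zero => simp
  | add c d hc hd => simp only [map_add, hc, hd, smul_add]
  | single w a =>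
    rw [single_eq_tens (k := k), sgn_tens, map_smul, ev_tens_self]
    split_ifs with h
    · rw [h.1]
    · simp

theorem neg_one_pow_mul_self (n : ℕ) : (-1 : k) ^ n * (-1 : k) ^ n = 1 := by
  rw [← pow_add, ← two_mul, pow_mul]; simp

@[simp] theorem sgn_sgn (φ : Word G →₀ M) : sgn k (sgn k φ) = φ :=
  ev_ext (k := k) fun l => by
    rw [ev_sgn, ev_sgn, smul_smul, neg_one_pow_mul_self, one_smul]

theorem ev_nil_sgn (φ : Word G →₀ M) : ev k [] (sgn k φ) = ev k [] φ := by
  simp [ev_sgn]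

end EvTens

/-! ### The trace form and the duality between cochains and chains -/

section Duality

variable {k : Type*} [Field k] {G : Type*} [Group G]

/-- The coefficient of the unit element. -/
noncomputable def tr : MonoidAlgebra k G →ₗ[k] k where
  toFun a := a.coeff 1
  map_add' a b := by simp
  map_smul' r a := by simp

theorem tr_apply (a : MonoidAlgebra k G) : tr a = a.coeff 1 := rfl

theorem tr_el [DecidableEq G] (g : G) : tr (el k g) = if g = 1 then 1 else 0 := by
  simp [tr_apply, el, Finsupp.single_apply]

theorem smul_el_induction {P : MonoidAlgebra k G → Prop} (a : MonoidAlgebra k G) (zero : P 0)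
    (add : ∀ a b, P a → P b → P (a + b)) (smul_el : ∀ (r : k) (g : G), P (r • el k g)) : P a :=
  MonoidAlgebra.induction_linear a zero add fun g r => by simpa [el] using smul_el r g

theorem tr_mul_comm (a b : MonoidAlgebra k G) : tr (a * b) = tr (b * a) := by
  classical
  induction a using smul_el_induction with
  | zero => simp
  | add a a' h h' => simp only [add_mul, mul_add, map_add, h, h']
  | smul_el r g =>
    induction b using smul_el_induction with
    | zero => simp
    | add a a' h h' => simp only [add_mul, mul_add, map_add, h, h']
    | smul_el s h =>
      simp only [smul_mul_assoc, mul_smul_comm, el_mul_el, map_smul, tr_el, smul_comm r s,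
        mul_eq_one_comm (a := g)]

theorem symmForm_apply (a b : MonoidAlgebra k G) : symmForm k a b = tr (a * b) := rfl

theorem tr_mul_right_splitSum (F : List G → List G → MonoidAlgebra k G) (a : MonoidAlgebra k G)
    (l : List G) : tr (splitSum F l * a) = splitSum (fun u v => tr (F u v * a)) l :=
  map_splitSum (tr ∘ₗ LinearMap.mulRight k a) F l

theorem tr_el_mul_eq_coeff (a : MonoidAlgebra k G) (g : G) :
    tr (a * el k g⁻¹) = a.coeff g := by
  simp [tr_apply, el, MonoidAlgebra.coeff_mul_single_apply]

/-- The trace form of the group algebra is non-degenerate. -/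
theorem eq_zero_of_tr_mul {a : MonoidAlgebra k G} (h : ∀ b, tr (a * b) = 0) : a = 0 := by
  apply MonoidAlgebra.coeff_injective
  ext g
  rw [← tr_el_mul_eq_coeff, h]
  rfl

/-- The duality pairing of a cochain and a chain. Cochains and chains are functions on the same set
of words, so the order of the arguments tells them apart. -/
noncomputable def dual : (Word G →₀ MonoidAlgebra k G) →ₗ[k] (Word G →₀ MonoidAlgebra k G) →ₗ[k] k :=
  (pairing k G).compl₁₂ (LinearMap.inl k _ _) (LinearMap.inr k _ _)

theorem dual_apply (φ c : Word G →₀ MonoidAlgebra k G) :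
    dual φ c = c.sum fun w a => tr (φ w * a) := by
  simp [dual, pairing, pairingOf, symmForm_apply]

theorem pairing_eq_dual (x y : D k G) : pairing k G x y = dual x.1 y.2 + dual y.1 x.2 := by
  rw [dual_apply, dual_apply]; rfl

theorem pairing_comm (x y : D k G) : pairing k G x y = pairing k G y x := by
  rw [pairing_eq_dual, pairing_eq_dual, add_comm]

theorem dual_tens (φ : Word G →₀ MonoidAlgebra k G) (l : List G) (a : MonoidAlgebra k G) :
    dual φ (tens k l a) = tr (ev k l φ * a) := by
  rw [dual_apply]
  exact tens_sum (k := k) l a _ (by simp) (fun a => tr (ev k l φ * a))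
    (fun h => by rw [ev_of_notMem h]) fun h => by simp [ev_of_mem h]

theorem dual_sgn (φ c : Word G →₀ MonoidAlgebra k G) : dual (sgn k φ) c = dual φ (sgn k c) := by
  induction c using Finsupp.induction_linear with
  | zero => simp
  | add c d hc hd => simp only [map_add, hc, hd]
  | single w a => simp [single_eq_tens (k := k), dual_tens, sgn_tens, ev_sgn]

theorem eq_zero_of_dual_left {φ : Word G →₀ MonoidAlgebra k G} (h : ∀ c, dual φ c = 0) : φ = 0 :=
  ev_ext (k := k) fun l => by
    rw [map_zero]
    exact eq_zero_of_tr_mul fun b => by rw [← dual_tens, h]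

theorem eq_zero_of_dual_right {c : Word G →₀ MonoidAlgebra k G} (h : ∀ φ, dual φ c = 0) : c = 0 := by
  classical
  ext1 w
  refine eq_zero_of_tr_mul fun b => ?_
  rw [tr_mul_comm]
  have := h (Finsupp.single w b)
  rw [dual_apply, Finsupp.sum] at this
  rw [Finset.sum_eq_single w] at this
  · simpa using this
  · intro v _ hv
    simp [hv.symm]
  · intro hw
    rw [Finsupp.notMem_support_iff.1 hw, mul_zero, map_zero]

theorem dual_sgn_right (φ c : Word G →₀ MonoidAlgebra k G) : dual φ (sgn k c) = dual (sgn k φ) c :=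
  (dual_sgn φ c).symm

theorem wordMod_ext_left {φ ψ : Word G →₀ MonoidAlgebra k G} (h : ∀ c, dual φ c = dual ψ c) : φ = ψ :=
  sub_eq_zero.1 (eq_zero_of_dual_left fun c => by simp [h])

theorem wordMod_ext_right {c d : Word G →₀ MonoidAlgebra k G} (h : ∀ φ, dual φ c = dual φ d) : c = d :=
  sub_eq_zero.1 (eq_zero_of_dual_right fun φ => by simp [h])

theorem eq_zero_of_pairing {x : D k G} (h : ∀ y, pairing k G y x = 0) : x = 0 := by
  refine Prod.ext (eq_zero_of_dual_left fun c => ?_) (eq_zero_of_dual_right fun φ => ?_)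
  · simpa [pairing_eq_dual] using h (0, c)
  · simpa [pairing_eq_dual] using h (φ, 0)

theorem pairing_nondegenerate : (pairing k G).Nondegenerate :=
  ⟨fun x h => eq_zero_of_pairing fun y => by rw [pairing_comm]; exact h y,
    fun _ h => eq_zero_of_pairing h⟩

end Duality

/-! ### The components of the operations -/

section Components

variable {k : Type*} [Field k] {G : Type*} [Group G]

variable (k G) in
/-- The space that underlies both the cochains and the chains of `kG`. -/
abbrev WordMod : Type _ := Word G →₀ MonoidAlgebra k G

variable [Fintype G]

variable (k G) in
/-- The cup product as a bilinear map. -/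
noncomputable def cupL : D k G →ₗ[k] D k G →ₗ[k] D k G :=
  LinearMap.mk₂ k (cup k) (cup_add_left k) (cup_smul_left k) (cup_add_right k) (cup_smul_right k)

variable (k G) in
/-- The ternary operation as a trilinear map. -/
noncomputable def ternaryL : D k G →ₗ[k] D k G →ₗ[k] D k G →ₗ[k] D k G :=
  LinearMap.mk₂ k
    (fun x y =>
      { toFun := ternary k x y
        map_add' := ternary_add_right k x y
        map_smul' := fun r => ternary_smul_right k r x y })
    (fun x x' y => LinearMap.ext fun z => ternary_add_left k x x' y z)
    (fun r x y => LinearMap.ext fun z => ternary_smul_left k r x y z)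
    (fun x y y' => LinearMap.ext fun z => ternary_add_mid k x y y' z)
    (fun r x y => LinearMap.ext fun z => ternary_smul_mid k r x y z)

@[simp] theorem cupL_apply (x y : D k G) : cupL k G x y = cup k x y := rfl

@[simp] theorem ternaryL_apply (x y z : D k G) : ternaryL k G x y z = ternary k x y z := rfl

/-- The product of two cochains. In the names of the components of the operations, `c` and `h`
stand for a cochain and a chain as inputs, and `C` and `H` for the output. -/
noncomputable def ccC : WordMod k G →ₗ[k] WordMod k G →ₗ[k] WordMod k G :=
  ((cupL k G).compl₁₂ (LinearMap.inl k _ _) (LinearMap.inl k _ _)).compr₂ (LinearMap.fst k _ _)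

/-- The cochain component of the product of a cochain and a chain. -/
noncomputable def chC : WordMod k G →ₗ[k] WordMod k G →ₗ[k] WordMod k G :=
  ((cupL k G).compl₁₂ (LinearMap.inl k _ _) (LinearMap.inr k _ _)).compr₂ (LinearMap.fst k _ _)

/-- The cochain component of the product of a chain and a cochain. -/
noncomputable def hcC : WordMod k G →ₗ[k] WordMod k G →ₗ[k] WordMod k G :=
  ((cupL k G).compl₁₂ (LinearMap.inr k _ _) (LinearMap.inl k _ _)).compr₂ (LinearMap.fst k _ _)

/-- The chain component of the product of a cochain and a chain. -/
noncomputable def chH : WordMod k G →ₗ[k] WordMod k G →ₗ[k] WordMod k G :=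
  ((cupL k G).compl₁₂ (LinearMap.inl k _ _) (LinearMap.inr k _ _)).compr₂ (LinearMap.snd k _ _)

/-- The chain component of the product of a chain and a cochain. -/
noncomputable def hcH : WordMod k G →ₗ[k] WordMod k G →ₗ[k] WordMod k G :=
  ((cupL k G).compl₁₂ (LinearMap.inr k _ _) (LinearMap.inl k _ _)).compr₂ (LinearMap.snd k _ _)

/-- The product of two chains. -/
noncomputable def hhH : WordMod k G →ₗ[k] WordMod k G →ₗ[k] WordMod k G :=
  ((cupL k G).compl₁₂ (LinearMap.inr k _ _) (LinearMap.inr k _ _)).compr₂ (LinearMap.snd k _ _)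

/-- The ternary operation of a cochain, a chain and a cochain. -/
noncomputable def chcC : WordMod k G →ₗ[k] WordMod k G →ₗ[k] WordMod k G →ₗ[k] WordMod k G :=
  LinearMap.mk₂ k
    (fun φ c => LinearMap.fst k _ _ ∘ₗ ternaryL k G (φ, 0) (0, c) ∘ₗ LinearMap.inl k _ _)
    (fun φ φ' c => LinearMap.ext fun ψ => by
      simpa using congrArg Prod.fst (ternary_add_left k (φ, 0) (φ', 0) (0, c) (ψ, 0)))
    (fun r φ c => LinearMap.ext fun ψ => by
      simpa using congrArg Prod.fst (ternary_smul_left k r (φ, 0) (0, c) (ψ, 0)))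
    (fun φ c c' => LinearMap.ext fun ψ => by
      simpa using congrArg Prod.fst (ternary_add_mid k (φ, 0) (0, c) (0, c') (ψ, 0)))
    (fun r φ c => LinearMap.ext fun ψ => by
      simpa using congrArg Prod.fst (ternary_smul_mid k r (φ, 0) (0, c) (ψ, 0)))

/-- The ternary operation of a chain, a cochain and a chain. -/
noncomputable def hchH : WordMod k G →ₗ[k] WordMod k G →ₗ[k] WordMod k G →ₗ[k] WordMod k G :=
  LinearMap.mk₂ k
    (fun c φ => LinearMap.snd k _ _ ∘ₗ ternaryL k G (0, c) (φ, 0) ∘ₗ LinearMap.inr k _ _)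
    (fun c c' φ => LinearMap.ext fun d => by
      simpa using congrArg Prod.snd (ternary_add_left k (0, c) (0, c') (φ, 0) (0, d)))
    (fun r c φ => LinearMap.ext fun d => by
      simpa using congrArg Prod.snd (ternary_smul_left k r (0, c) (φ, 0) (0, d)))
    (fun c φ φ' => LinearMap.ext fun d => by
      simpa using congrArg Prod.snd (ternary_add_mid k (0, c) (φ, 0) (φ', 0) (0, d)))
    (fun r c φ => LinearMap.ext fun d => by
      simpa using congrArg Prod.snd (ternary_smul_mid k r (0, c) (φ, 0) (0, d)))

theorem cupCochainAt_of_mem (x y : D k G) {l : List G} (h : (1 : G) ∈ l) :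
    cupCochainAt k x y l = 0 := by
  have h1 : ∀ i ∈ Finset.range (l.length + 1),
      ev k (l.take i) x.1 * ev k (l.drop i) y.1 = 0 := fun i _ => by
    rw [← List.take_append_drop i l, List.mem_append] at h
    rcases h with h | h
    · rw [ev_of_mem h, zero_mul]
    · rw [ev_of_mem h, mul_zero]
  rw [cupCochainAt, Finset.sum_eq_zero h1]
  have h2 : ∀ (w : List G) (g : G), ev k (l ++ g :: w) x.1 = 0 := fun w g =>
    ev_of_mem (by simp [h]) _
  have h3 : ∀ (w : List G) (g : G), ev k (w ++ g :: l) y.1 = 0 := fun w g =>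
    ev_of_mem (by simp [h]) _
  simp [h2, h3]

theorem ternaryCochainAt_of_mem (x y z : D k G) {l : List G} (h : (1 : G) ∈ l) :
    ternaryCochainAt k x y z l = 0 := by
  refine Finset.sum_eq_zero fun w _ => Finset.sum_eq_zero fun g _ =>
    Finset.sum_eq_zero fun i _ => Finset.sum_eq_zero fun j _ => ?_
  rw [← List.take_append_drop i l, List.mem_append] at h
  rcases h with h | h
  · rw [ev_of_mem (l := l.take i ++ g :: w.1.drop j) (by simp [h]), zero_mul, zero_mul, smul_zero]
  · rw [ev_of_mem (l := w.1.take j ++ g⁻¹ :: l.drop i) (by simp [h]), mul_zero, smul_zero]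

theorem ev_cup_fst (x y : D k G) (l : List G) : ev k l (cup k x y).1 = cupCochainAt k x y l :=
  ev_ofBounded _ (cupCochainAt_bounded k x y) (fun _ h => cupCochainAt_of_mem x y h) l

theorem ev_ternary_fst (x y z : D k G) (l : List G) :
    ev k l (ternary k x y z).1 = ternaryCochainAt k x y z l :=
  ev_ofBounded _ (ternaryCochainAt_bounded k x y z) (fun _ h => ternaryCochainAt_of_mem x y z h) l

theorem ev_ccC (φ ψ : WordMod k G) (l : List G) :
    ev k l (ccC φ ψ) = splitSum (fun u v => ev k u φ * ev k v ψ) l := by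
  rw [← sum_range_take_drop]
  exact (ev_cup_fst (φ, 0) (ψ, 0) l).trans (by simp [cupCochainAt])

theorem ev_chC_sum (φ c : WordMod k G) (l : List G) : ev k l (chC φ c) =
    c.sum fun w a => ∑ g : G, ev k (l ++ g⁻¹ :: w.1) φ * a * el k g :=
  (ev_cup_fst (φ, 0) (0, c) l).trans (by simp [cupCochainAt])

theorem ev_hcC_sum (c φ : WordMod k G) (l : List G) : ev k l (hcC c φ) =
    c.sum fun w a => ∑ g : G, el k g * a * ev k (w.1 ++ g⁻¹ :: l) φ :=
  (ev_cup_fst (0, c) (φ, 0) l).trans (by simp [cupCochainAt])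

theorem chH_eq_sum (φ c : WordMod k G) : chH φ c =
    c.sum fun v b => ∑ i ∈ Finset.range (v.1.length + 1),
      tens k (v.1.take i) (ev k (v.1.drop i) φ * b) :=
  show cupChain k (φ, 0) (0, c) = _ by simp [cupChain]

theorem hcH_eq_sum (c φ : WordMod k G) : hcH c φ =
    c.sum fun w a => ∑ i ∈ Finset.range (w.1.length + 1),
      tens k (w.1.drop i) (a * ev k (w.1.take i) φ) :=
  show cupChain k (0, c) (φ, 0) = _ by simp [cupChain]

theorem hhH_eq_sum (c d : WordMod k G) : hhH c d =
    c.sum fun w a => d.sum fun v b => ∑ g : G, ∑ g₀ : G,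
      a.coeff g₀ • tens k (v.1 ++ (g⁻¹ * g₀) :: w.1) (el k g * b) :=
  show cupChain k (0, c) (0, d) = _ by simp [cupChain]

theorem ev_chcC_sum (φ c ψ : WordMod k G) (l : List G) : ev k l (chcC φ c ψ) =
    c.sum fun w a => ∑ g : G, ∑ i ∈ Finset.range (l.length + 1),
      ∑ j ∈ Finset.range (w.1.length + 1),
        (-1 : k) ^ ((l.take i ++ g :: w.1.drop j).length + w.1.length + j) •
          (ev k (l.take i ++ g :: w.1.drop j) φ * a * ev k (w.1.take j ++ g⁻¹ :: l.drop i) ψ) :=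
  ev_ternary_fst (φ, 0) (0, c) (ψ, 0) l

theorem hchH_eq_sum (c φ d : WordMod k G) : hchH c φ d =
    c.sum fun w a => d.sum fun v b => ∑ g : G, ∑ i ∈ Finset.range (w.1.length + 1),
      ∑ j ∈ Finset.range (v.1.length + 1),
        (-1 : k) ^ ((w.1.take i ++ g :: v.1.drop j).length + w.1.length + (v.1.length - j)) •
          tens k (v.1.take j ++ g⁻¹ :: w.1.drop i) (a * ev k (w.1.take i ++ g :: v.1.drop j) φ * b) :=
  rfl

/-! ### The operations on elementary tensors -/

theorem ev_chC_tens (φ : WordMod k G) (w : List G) (a : MonoidAlgebra k G) (l : List G) :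
    ev k l (chC φ (tens k w a)) = ∑ g : G, ev k (l ++ g⁻¹ :: w) φ * a * el k g := by
  rw [ev_chC_sum]
  refine tens_sum (k := k) w a _ (by simp)
    (fun a => ∑ g : G, ev k (l ++ g⁻¹ :: w) φ * a * el k g) (fun _ => rfl) fun h => ?_
  exact Finset.sum_eq_zero fun g _ => by rw [ev_of_mem (by simp [h]), zero_mul, zero_mul]

theorem ev_hcC_tens (φ : WordMod k G) (w : List G) (a : MonoidAlgebra k G) (l : List G) :
    ev k l (hcC (tens k w a) φ) = ∑ g : G, el k g * a * ev k (w ++ g⁻¹ :: l) φ := by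
  rw [ev_hcC_sum]
  refine tens_sum (k := k) w a _ (by simp)
    (fun a => ∑ g : G, el k g * a * ev k (w ++ g⁻¹ :: l) φ) (fun _ => rfl) fun h => ?_
  exact Finset.sum_eq_zero fun g _ => by rw [ev_of_mem (by simp [h]), mul_zero]

theorem chH_tens (φ : WordMod k G) (w : List G) (a : MonoidAlgebra k G) :
    chH φ (tens k w a) = splitSum (fun u v => tens k u (ev k v φ * a)) w := by
  rw [chH_eq_sum]
  refine tens_sum (k := k) w a _ (by simp)
    (fun a => splitSum (fun u v => tens k u (ev k v φ * a)) w) (fun _ => ?_) fun h => ?_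
  · exact sum_range_take_drop (fun u v => tens k u (ev k v φ * a)) w
  · refine splitSum_eq_zero fun u v huv => ?_
    rw [← huv, List.mem_append] at h
    rcases h with h | h
    · exact tens_of_mem h _
    · rw [ev_of_mem h, zero_mul, map_zero]

theorem hcH_tens (φ : WordMod k G) (w : List G) (a : MonoidAlgebra k G) :
    hcH (tens k w a) φ = splitSum (fun u v => tens k v (a * ev k u φ)) w := by
  rw [hcH_eq_sum]
  refine tens_sum (k := k) w a _ (by simp)
    (fun a => splitSum (fun u v => tens k v (a * ev k u φ)) w) (fun _ => ?_) fun h => ?_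
  · exact sum_range_take_drop (fun u v => tens k v (a * ev k u φ)) w
  · refine splitSum_eq_zero fun u v huv => ?_
    rw [← huv, List.mem_append] at h
    rcases h with h | h
    · rw [ev_of_mem h, mul_zero, map_zero]
    · exact tens_of_mem h _

theorem sum_coeff_smul_el (a : MonoidAlgebra k G) : ∑ g : G, a.coeff g • el k g = a := by
  classical
  apply MonoidAlgebra.coeff_injective
  ext h
  simp [el]

/-- The product of two chains in symmetric form: by the Casimir property of `∑ g⁻¹ ⊗ g`, the
coefficient of the first chain may be moved next to that of the second one. -/
theorem hhH_tens (w v : List G) (a b : MonoidAlgebra k G) :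
    hhH (tens k w a) (tens k v b) = ∑ g : G, tens k (v ++ g⁻¹ :: w) (a * el k g * b) := by
  have key : ∀ a b : MonoidAlgebra k G,
      ∑ g : G, ∑ g₀ : G, a.coeff g₀ • tens k (v ++ (g⁻¹ * g₀) :: w) (el k g * b) =
        ∑ g : G, tens k (v ++ g⁻¹ :: w) (a * el k g * b) := by
    intro a b
    conv_rhs => rw [← sum_coeff_smul_el a]
    simp only [Finset.sum_mul, smul_mul_assoc, map_sum, map_smul, el_mul_el]
    rw [Finset.sum_comm, Finset.sum_comm (f := fun g g₀ => a.coeff g₀ • _)]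
    refine Finset.sum_congr rfl fun g₀ _ => ?_
    exact Fintype.sum_equiv (Equiv.mulLeft g₀⁻¹) _ _ fun g => by simp
  rw [hhH_eq_sum]
  refine tens_sum (k := k) w a _ (by simp)
    (fun a => ∑ g : G, tens k (v ++ g⁻¹ :: w) (a * el k g * b)) (fun h => ?_) fun h => ?_
  · refine tens_sum (k := k) v b _ (by simp)
      (fun b => ∑ g : G, tens k (v ++ g⁻¹ :: w) (a * el k g * b)) (fun h => key a b) fun h => ?_
    exact Finset.sum_eq_zero fun g _ => tens_of_mem (by simp [h]) _
  · exact Finset.sum_eq_zero fun g _ => tens_of_mem (by simp [h]) _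

theorem ev_chcC_tens (φ ψ : WordMod k G) (w : List G) (a : MonoidAlgebra k G) (l : List G) :
    ev k l (chcC φ (tens k w a) ψ) = -∑ g : G, splitSum (fun l₁ l₂ => splitSum (fun w₁ w₂ =>
      (-1 : k) ^ l₁.length • (ev k (l₁ ++ g :: w₂) φ * a * ev k (w₁ ++ g⁻¹ :: l₂) ψ)) w) l := by
  rw [ev_chcC_sum]
  refine tens_sum (k := k) w a _ (by simp)
    (fun a => -∑ g : G, splitSum (fun l₁ l₂ => splitSum (fun w₁ w₂ =>
      (-1 : k) ^ l₁.length • (ev k (l₁ ++ g :: w₂) φ * a * ev k (w₁ ++ g⁻¹ :: l₂) ψ)) w) l)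
    (fun _ => ?_) fun h => ?_
  · rw [← Finset.sum_neg_distrib]
    refine Finset.sum_congr rfl fun g _ => ?_
    rw [← sum_range_take_drop, ← Finset.sum_neg_distrib]
    refine Finset.sum_congr rfl fun i _ => ?_
    rw [← sum_range_take_drop, ← Finset.sum_neg_distrib]
    refine Finset.sum_congr rfl fun j hj => ?_
    rw [← neg_smul]
    congr 1
    rw [Finset.mem_range] at hj
    have e : (l.take i ++ g :: w.drop j).length + w.length + j =
        (l.take i).length + 1 + 2 * w.length := by
      simp only [List.length_append, List.length_cons, List.length_drop]; omega
    simp only [e, pow_add, pow_mul]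
    simp
  · refine neg_eq_zero.2 (Finset.sum_eq_zero fun g _ => splitSum_eq_zero fun l₁ l₂ _ =>
      splitSum_eq_zero fun w₁ w₂ hw => ?_)
    rw [← hw, List.mem_append] at h
    rcases h with h | h
    · rw [ev_of_mem (l := w₁ ++ _) (by simp [h]), mul_zero, smul_zero]
    · rw [ev_of_mem (l := l₁ ++ _) (by simp [h]), zero_mul, zero_mul, smul_zero]

theorem hchH_tens (φ : WordMod k G) (u v : List G) (a b : MonoidAlgebra k G) :
    hchH (tens k u a) φ (tens k v b) = -∑ g : G, splitSum (fun u₁ u₂ => splitSum (fun v₁ v₂ =>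
      (-1 : k) ^ u₂.length • tens k (v₁ ++ g⁻¹ :: u₂) (a * ev k (u₁ ++ g :: v₂) φ * b)) v) u := by
  have h0 : (1 : G) ∈ u ∨ (1 : G) ∈ v → ∀ a b : MonoidAlgebra k G,
      -∑ g : G, splitSum (fun u₁ u₂ => splitSum (fun v₁ v₂ =>
      (-1 : k) ^ u₂.length • tens k (v₁ ++ g⁻¹ :: u₂) (a * ev k (u₁ ++ g :: v₂) φ * b)) v) u = 0 := by
    refine fun h a b => neg_eq_zero.2 (Finset.sum_eq_zero fun g _ => splitSum_eq_zero fun u₁ u₂ hu =>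
      splitSum_eq_zero fun v₁ v₂ hv => ?_)
    rw [← hu, ← hv, List.mem_append, List.mem_append] at h
    rcases h with (h | h) | (h | h)
    · rw [ev_of_mem (l := u₁ ++ _) (by simp [h]), mul_zero, zero_mul, map_zero, smul_zero]
    · rw [tens_of_mem (l := v₁ ++ _) (by simp [h]), smul_zero]
    · rw [tens_of_mem (l := v₁ ++ _) (by simp [h]), smul_zero]
    · rw [ev_of_mem (l := u₁ ++ _) (by simp [h]), mul_zero, zero_mul, map_zero, smul_zero]
  rw [hchH_eq_sum]
  refine tens_sum (k := k) u a _ (by simp)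
    (fun a => -∑ g : G, splitSum (fun u₁ u₂ => splitSum (fun v₁ v₂ =>
      (-1 : k) ^ u₂.length • tens k (v₁ ++ g⁻¹ :: u₂) (a * ev k (u₁ ++ g :: v₂) φ * b)) v) u)
    (fun _ => ?_) fun h => h0 (Or.inl h) _ _
  refine tens_sum (k := k) v b _ (by simp)
    (fun b => -∑ g : G, splitSum (fun u₁ u₂ => splitSum (fun v₁ v₂ =>
      (-1 : k) ^ u₂.length • tens k (v₁ ++ g⁻¹ :: u₂) (a * ev k (u₁ ++ g :: v₂) φ * b)) v) u)
    (fun _ => ?_) fun h => h0 (Or.inr h) _ _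
  rw [← Finset.sum_neg_distrib]
  refine Finset.sum_congr rfl fun g _ => ?_
  rw [← sum_range_take_drop, ← Finset.sum_neg_distrib]
  refine Finset.sum_congr rfl fun i hi => ?_
  rw [← sum_range_take_drop, ← Finset.sum_neg_distrib]
  refine Finset.sum_congr rfl fun j hj => ?_
  rw [← neg_smul]
  congr 1
  rw [Finset.mem_range] at hi hj
  have e : (u.take i ++ g :: v.drop j).length + u.length + (v.length - j) =
      (u.drop i).length + 1 + 2 * i + 2 * (v.length - j) := by
    simp only [List.length_append, List.length_cons, List.length_drop, List.length_take]; omega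
  simp only [e, pow_add, pow_mul]
  simp

end Components

/-! ### Cyclic symmetry of the components -/

section Cyclic

variable {k : Type*} [Field k] {G : Type*} [Group G] [Fintype G]

theorem cup_fst (x y : D k G) : (cup k x y).1 = ccC x.1 y.1 + chC x.1 y.2 + hcC x.2 y.1 := by
  have h : (cup k (0, x.2) (0, y.2)).1 = 0 := ev_ext (k := k) fun l => by
    rw [ev_cup_fst]; simp [cupCochainAt]
  have e : ∀ z : D k G, z = (z.1, 0) + (0, z.2) := fun z => by simp
  rw [e x, e y, cup_add_left, cup_add_right, cup_add_right]
  simp only [Prod.fst_add, h, Prod.snd_add, zero_add, add_zero]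
  rfl

theorem cup_snd (x y : D k G) : (cup k x y).2 = hhH x.2 y.2 + chH x.1 y.2 + hcH x.2 y.1 := by
  have h : (cup k (x.1, 0) (y.1, 0)).2 = 0 := show cupChain k (x.1, 0) (y.1, 0) = 0 by
    simp [cupChain]
  have e : ∀ z : D k G, z = (z.1, 0) + (0, z.2) := fun z => by simp
  rw [e x, e y, cup_add_left, cup_add_right, cup_add_right]
  have h1 : (cup k (x.1, 0) (0, y.2)).2 = chH x.1 y.2 := rfl
  have h2 : (cup k (0, x.2) (y.1, 0)).2 = hcH x.2 y.1 := rfl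
  have h3 : (cup k (0, x.2) (0, y.2)).2 = hhH x.2 y.2 := rfl
  simp only [Prod.snd_add, h, Prod.fst_add, zero_add, add_zero, h1, h2, h3]
  abel

theorem ternary_fst (x y z : D k G) : (ternary k x y z).1 = chcC x.1 y.2 z.1 := rfl

theorem ternary_snd (x y z : D k G) : (ternary k x y z).2 = hchH x.2 y.1 z.2 := rfl

theorem sum_inv_eq {N : Type*} [AddCommMonoid N] (F : G → N) : ∑ g : G, F g⁻¹ = ∑ g : G, F g :=
  Fintype.sum_equiv (Equiv.inv G) _ _ fun _ => rfl

theorem dual_ccC_tens (φ ψ : WordMod k G) (w : List G) (a : MonoidAlgebra k G) :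
    dual (ccC φ ψ) (tens k w a) = splitSum (fun u v => tr (ev k u φ * ev k v ψ * a)) w := by
  rw [dual_tens, ev_ccC]
  exact map_splitSum (tr ∘ₗ LinearMap.mulRight k a) _ _

theorem dual_chC_tens (φ : WordMod k G) (w v : List G) (a b : MonoidAlgebra k G) :
    dual (chC φ (tens k w a)) (tens k v b) = ∑ g : G, tr (ev k (v ++ g⁻¹ :: w) φ * a * el k g * b) := by
  rw [dual_tens, ev_chC_tens, Finset.sum_mul, map_sum]

theorem dual_chH (φ ψ c : WordMod k G) : dual φ (chH ψ c) = dual (ccC φ ψ) c := by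
  induction c using Finsupp.induction_linear with
  | zero => simp
  | add c d hc hd => simp only [map_add, hc, hd]
  | single w a =>
    rw [single_eq_tens (k := k), dual_ccC_tens, chH_tens, map_splitSum]
    simp only [dual_tens, mul_assoc]

theorem dual_hcH (φ ψ c : WordMod k G) : dual ψ (hcH c φ) = dual (ccC φ ψ) c := by
  induction c using Finsupp.induction_linear with
  | zero => simp
  | add c d hc hd => simp only [map_add, LinearMap.add_apply, hc, hd]
  | single w a =>
    rw [single_eq_tens (k := k), dual_ccC_tens, hcH_tens, map_splitSum]
    refine splitSum_congr fun u v _ => ?_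
    rw [dual_tens, ← mul_assoc, tr_mul_comm, mul_assoc]

theorem dual_hhH (φ c d : WordMod k G) : dual φ (hhH c d) = dual (chC φ c) d := by
  induction c using Finsupp.induction_linear with
  | zero => simp
  | add c c' hc hc' => simp only [map_add, LinearMap.add_apply, hc, hc']
  | single w a =>
    induction d using Finsupp.induction_linear with
    | zero => simp
    | add c c' hc hc' => simp only [map_add, hc, hc']
    | single v b =>
      rw [single_eq_tens (k := k), single_eq_tens (k := k), dual_chC_tens, hhH_tens, map_sum]
      simp only [dual_tens, mul_assoc]

theorem dual_hcC (φ c d : WordMod k G) : dual (hcC d φ) c = dual (chC φ c) d := by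
  induction c using Finsupp.induction_linear with
  | zero => simp
  | add c c' hc hc' => simp only [map_add, LinearMap.add_apply, hc, hc']
  | single w a =>
    induction d using Finsupp.induction_linear with
    | zero => simp
    | add c c' hc hc' => simp only [map_add, LinearMap.add_apply, hc, hc']
    | single v b =>
      rw [single_eq_tens (k := k), single_eq_tens (k := k), dual_chC_tens, dual_tens, ev_hcC_tens,
        Finset.sum_mul, map_sum]
      refine Finset.sum_congr rfl fun g _ => ?_
      rw [mul_assoc, tr_mul_comm]
      simp only [mul_assoc]

/-- The potential of the ternary operation on elementary tensors. -/
theorem dual_hchH_tens (φ ψ : WordMod k G) (w v : List G) (a b : MonoidAlgebra k G) :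
    dual φ (hchH (tens k w a) ψ (tens k v b)) = -∑ g : G, splitSum (fun w₁ w₂ => splitSum
      (fun v₁ v₂ => (-1 : k) ^ w₂.length *
        tr (ev k (v₁ ++ g⁻¹ :: w₂) φ * a * ev k (w₁ ++ g :: v₂) ψ * b)) v) w := by
  rw [hchH_tens, map_neg, map_sum]
  simp only [map_splitSum, map_smul, dual_tens, smul_eq_mul, mul_assoc]

theorem dual_chcC_tens (φ ψ : WordMod k G) (w v : List G) (a b : MonoidAlgebra k G) :
    dual (chcC φ (tens k w a) ψ) (tens k v b) = -∑ g : G, splitSum (fun v₁ v₂ => splitSum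
      (fun w₁ w₂ => (-1 : k) ^ v₁.length *
        tr (ev k (v₁ ++ g :: w₂) φ * a * ev k (w₁ ++ g⁻¹ :: v₂) ψ * b)) w) v := by
  rw [dual_tens, ev_chcC_tens, neg_mul, map_neg, Finset.sum_mul, map_sum]
  congr 1
  refine Finset.sum_congr rfl fun g _ => ?_
  rw [← LinearMap.mulRight_apply (R := k), ← LinearMap.comp_apply, map_splitSum]
  simp only [map_splitSum, map_smul, smul_eq_mul, LinearMap.comp_apply, LinearMap.mulRight_apply]

/-- The ternary operation is cyclic: its cochain and its chain component are dual. -/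
theorem dual_chcC (φ c ψ d : WordMod k G) :
    dual (chcC φ c ψ) d = -dual (sgn k φ) (hchH c ψ d) := by
  induction c using Finsupp.induction_linear with
  | zero => simp
  | add c c' hc hc' => simp only [map_add, LinearMap.add_apply, hc, hc', neg_add]
  | single w a =>
    induction d using Finsupp.induction_linear with
    | zero => simp
    | add c c' hc hc' => simp only [map_add, hc, hc', neg_add]
    | single v b =>
      rw [single_eq_tens (k := k), single_eq_tens (k := k), dual_chcC_tens, dual_hchH_tens, neg_neg,
        ← Finset.sum_neg_distrib]
      rw [← sum_inv_eq]
      refine Finset.sum_congr rfl fun g _ => ?_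
      rw [splitSum_comm, ← splitSum_neg]
      refine splitSum_congr fun w₁ w₂ _ => ?_
      rw [← splitSum_neg]
      refine splitSum_congr fun v₁ v₂ _ => ?_
      simp only [ev_sgn, smul_mul_assoc, map_smul, smul_eq_mul, inv_inv, List.length_append,
        List.length_cons, pow_add, pow_one]
      linear_combination ((-1) ^ v₁.length * tr (ev k (v₁ ++ g⁻¹ :: w₂) φ * a *
        ev k (w₁ ++ g :: v₂) ψ * b)) * (neg_one_pow_mul_self (k := k) w₂.length)

/-- The potential of the ternary operation is invariant, up to sign, under rotation by two
places. -/
theorem dual_hchH_rotate (φ c ψ d : WordMod k G) :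
    dual φ (hchH c ψ d) = -dual ψ (hchH (sgn k d) (sgn k φ) c) := by
  induction c using Finsupp.induction_linear with
  | zero => simp
  | add c c' hc hc' => simp only [map_add, LinearMap.add_apply, hc, hc', neg_add]
  | single w a =>
    induction d using Finsupp.induction_linear with
    | zero => simp
    | add c c' hc hc' => simp only [map_add, LinearMap.add_apply, hc, hc', neg_add]
    | single v b =>
      rw [single_eq_tens (k := k), single_eq_tens (k := k), sgn_tens]
      simp only [map_smul, LinearMap.smul_apply]
      rw [dual_hchH_tens, dual_hchH_tens, smul_neg, neg_neg, Finset.smul_sum,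
        ← Finset.sum_neg_distrib]
      rw [← sum_inv_eq]
      refine Finset.sum_congr rfl fun g _ => ?_
      rw [splitSum_comm, ← splitSum_neg, smul_splitSum]
      refine splitSum_congr fun v₁ v₂ hv => ?_
      rw [← splitSum_neg, smul_splitSum]
      refine splitSum_congr fun w₁ w₂ _ => ?_
      rw [← hv]
      have e : tr (ev k (w₁ ++ g⁻¹ :: v₂) ψ * b * ev k (v₁ ++ g :: w₂) φ * a) =
          tr (ev k (v₁ ++ g :: w₂) φ * a * ev k (w₁ ++ g⁻¹ :: v₂) ψ * b) := by
        rw [mul_assoc, tr_mul_comm, ← mul_assoc]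
      simp only [ev_sgn, smul_mul_assoc, mul_smul_comm, map_smul, smul_eq_mul, inv_inv,
        List.length_append, List.length_cons, pow_add, pow_one, e]
      linear_combination ((-1) ^ w₂.length * tr (ev k (v₁ ++ g :: w₂) φ * a *
        ev k (w₁ ++ g⁻¹ :: v₂) ψ * b)) * ((-1) ^ v₁.length * (-1) ^ v₁.length * 
        (neg_one_pow_mul_self (k := k) v₂.length) + neg_one_pow_mul_self (k := k) v₁.length)

theorem sgn_ccC (φ ψ : WordMod k G) : sgn k (ccC φ ψ) = ccC (sgn k φ) (sgn k ψ) :=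
  ev_ext (k := k) fun l => by
    rw [ev_sgn, ev_ccC, ev_ccC, smul_splitSum]
    refine splitSum_congr fun u v huv => ?_
    rw [ev_sgn, ev_sgn, smul_mul_smul_comm, ← huv, List.length_append, pow_add]

theorem dual_sgn_chC (φ c d : WordMod k G) :
    dual (chC (sgn k φ) (sgn k c)) (sgn k d) = -dual (chC φ c) d := by
  induction c using Finsupp.induction_linear with
  | zero => simp
  | add c c' hc hc' => simp only [map_add, LinearMap.add_apply, hc, hc', neg_add]
  | single w a =>
    induction d using Finsupp.induction_linear with
    | zero => simp
    | add c c' hc hc' => simp only [map_add, hc, hc', neg_add]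
    | single v b =>
      rw [single_eq_tens (k := k), single_eq_tens (k := k), sgn_tens, sgn_tens]
      simp only [map_smul, LinearMap.smul_apply]
      rw [dual_chC_tens, dual_chC_tens, Finset.smul_sum, Finset.smul_sum, ← Finset.sum_neg_distrib]
      refine Finset.sum_congr rfl fun g _ => ?_
      simp only [ev_sgn, smul_mul_assoc, map_smul, smul_eq_mul, List.length_append,
        List.length_cons, pow_add, pow_one]
      linear_combination (-tr (ev k (v.1 ++ g⁻¹ :: w.1) φ * a * el k g * b)) *
        ((-1) ^ v.1.length * (-1) ^ v.1.length * (neg_one_pow_mul_self (k := k) w.1.length) +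
          neg_one_pow_mul_self (k := k) v.1.length)

theorem dual_sgn_ccC (φ ψ c : WordMod k G) :
    dual (ccC (sgn k φ) (sgn k ψ)) (sgn k c) = dual (ccC φ ψ) c := by
  rw [← sgn_ccC, dual_sgn, sgn_sgn]

theorem dual_sgn_hchH (φ c ψ d : WordMod k G) :
    dual (sgn k φ) (hchH (sgn k c) (sgn k ψ) (sgn k d)) = dual φ (hchH c ψ d) := by
  rw [dual_hchH_rotate, dual_hchH_rotate]
  simp only [sgn_sgn, neg_neg]

theorem sgn_chC (φ c : WordMod k G) : sgn k (chC φ c) = -chC (sgn k φ) (sgn k c) :=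
  wordMod_ext_left fun d => by
    rw [dual_sgn, map_neg, LinearMap.neg_apply, ← dual_sgn_chC, sgn_sgn, sgn_sgn]

theorem sgn_hcC (c φ : WordMod k G) : sgn k (hcC c φ) = -hcC (sgn k c) (sgn k φ) :=
  wordMod_ext_left fun d => by
    rw [dual_sgn, map_neg, LinearMap.neg_apply, dual_hcC, dual_hcC, ← dual_sgn_chC, sgn_sgn, sgn_sgn]

theorem sgn_chH (φ c : WordMod k G) : sgn k (chH φ c) = chH (sgn k φ) (sgn k c) :=
  wordMod_ext_right fun ψ => by
    rw [← dual_sgn, dual_chH, dual_chH, ← dual_sgn_ccC, sgn_sgn]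

theorem sgn_hcH (c φ : WordMod k G) : sgn k (hcH c φ) = hcH (sgn k c) (sgn k φ) :=
  wordMod_ext_right fun ψ => by
    rw [← dual_sgn, dual_hcH, dual_hcH, ← dual_sgn_ccC, sgn_sgn]

theorem sgn_hhH (c d : WordMod k G) : sgn k (hhH c d) = -hhH (sgn k c) (sgn k d) :=
  wordMod_ext_right fun ψ => by
    have h := dual_sgn_chC (sgn k ψ) c d
    rw [sgn_sgn] at h
    rw [← dual_sgn, map_neg, dual_hhH, dual_hhH, h, neg_neg]

end Cyclic

/-! ### The quadratic relations between the products -/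

section Relations

variable {k : Type*} [Field k] {G : Type*} [Group G] [Fintype G]

theorem ccC_assoc (φ ψ χ : WordMod k G) : ccC (ccC φ ψ) χ = ccC φ (ccC ψ χ) :=
  ev_ext (k := k) fun l => by
    rw [ev_ccC, ev_ccC]
    have h1 : ∀ u v : List G, ev k u (ccC φ ψ) * ev k v χ =
        splitSum (fun u₁ u₂ => ev k u₁ φ * ev k u₂ ψ * ev k v χ) u := fun u v => by
      rw [ev_ccC]; exact map_splitSum (LinearMap.mulRight k (ev k v χ)) _ _
    have h2 : ∀ u v : List G, ev k u φ * ev k v (ccC ψ χ) =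
        splitSum (fun v₁ v₂ => ev k u φ * ev k v₁ ψ * ev k v₂ χ) v := fun u v => by
      rw [ev_ccC]
      simp only [mul_assoc]
      exact map_splitSum (LinearMap.mulLeft k (ev k u φ)) _ _
    simp only [h1, h2]
    exact (splitSum_splitSum (fun u v w => ev k u φ * ev k v ψ * ev k w χ) l).symm

/-- A product of two cochains, evaluated at a word with a marked letter. -/
theorem ev_append_cons_ccC (φ ψ : WordMod k G) (u : List G) (g : G) (v : List G) :
    ev k (u ++ g :: v) (ccC φ ψ) =
      splitSum (fun u₁ u₂ => ev k u₁ φ * ev k (u₂ ++ g :: v) ψ) u +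
        splitSum (fun v₁ v₂ => ev k (u ++ g :: v₁) φ * ev k v₂ ψ) v := by
  rw [ev_ccC, splitSum_append_cons]

/-- Associativity of the product on two cochains and two chains. -/
theorem dual_ccC_hhH (φ ψ c d : WordMod k G) :
    dual (hcC d φ) (chH ψ c) + dual (chC ψ c) (hcH d φ) = dual (ccC φ ψ) (hhH c d) := by
  rw [dual_chH, dual_hcH, dual_hhH]
  induction c using Finsupp.induction_linear with
  | zero => simp
  | add c c' hc hc' =>
    simp only [map_add, LinearMap.add_apply] at hc hc' ⊢
    linear_combination hc + hc'
  | single w a =>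
    induction d using Finsupp.induction_linear with
    | zero => simp
    | add c c' hc hc' =>
      simp only [map_add, LinearMap.add_apply] at hc hc' ⊢
      linear_combination hc + hc'
    | single v b =>
      rw [single_eq_tens (k := k), single_eq_tens (k := k), dual_ccC_tens, dual_ccC_tens,
        dual_chC_tens]
      simp only [ev_hcC_tens, ev_chC_tens, ev_append_cons_ccC, Finset.sum_mul, Finset.mul_sum,
        map_sum, ← sum_splitSum, add_mul, map_add, Finset.sum_add_distrib, mul_assoc,
        tr_mul_right_splitSum]
      rw [add_comm]
      congr 1
      refine Finset.sum_congr rfl fun g _ => splitSum_congr fun u₁ u₂ _ => ?_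
      rw [← mul_assoc (el k g), tr_mul_comm]
      simp only [mul_assoc]

/-- Associativity of the product on one cochain and three chains. -/
theorem dual_hcC_hhH (φ c d e : WordMod k G) :
    dual (hcC e φ) (hhH c d) = dual (chC φ c) (hhH d e) := by
  rw [dual_hhH, dual_hhH]
  induction c using Finsupp.induction_linear with
  | zero => simp
  | add c c' hc hc' => simp only [map_add, LinearMap.add_apply, hc, hc']
  | single w a =>
    induction d using Finsupp.induction_linear with
    | zero => simp
    | add c c' hc hc' => simp only [map_add, LinearMap.add_apply, hc, hc']
    | single v b =>
      induction e using Finsupp.induction_linear with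
      | zero => simp
      | add c c' hc hc' => simp only [map_add, LinearMap.add_apply, hc, hc']
      | single u x =>
        rw [single_eq_tens (k := k), single_eq_tens (k := k), single_eq_tens (k := k),
          dual_chC_tens, dual_chC_tens]
        simp only [ev_hcC_tens, ev_chC_tens, Finset.sum_mul, map_sum]
        rw [Finset.sum_comm]
        refine Finset.sum_congr rfl fun g _ => Finset.sum_congr rfl fun h _ => ?_
        rw [mul_assoc, mul_assoc, mul_assoc, mul_assoc, ← mul_assoc (el k g) x, tr_mul_comm]
        simp only [mul_assoc, List.append_assoc, List.cons_append]

theorem dual_hchH_splitSum_left (φ ψ d : WordMod k G) (F : List G → List G → WordMod k G)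
    (l : List G) : dual φ (hchH (splitSum F l) ψ d) =
      splitSum (fun u v => dual φ (hchH (F u v) ψ d)) l := by
  induction l generalizing F with
  | nil => rfl
  | cons g t ih => simp only [splitSum, map_add, LinearMap.add_apply, ih]

theorem dual_hchH_splitSum_right (φ c ψ : WordMod k G) (F : List G → List G → WordMod k G)
    (l : List G) : dual φ (hchH c ψ (splitSum F l)) =
      splitSum (fun u v => dual φ (hchH c ψ (F u v))) l := by
  rw [map_splitSum, map_splitSum]

/-- The compatibility of the ternary operation with the product, for three cochains of which two
are adjacent and two chains. -/
theorem dual_ccC_hchH (φ ψ χ c d : WordMod k G) :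
    dual (ccC φ ψ) (hchH c χ d) =
      dual φ (hchH (chH (sgn k ψ) c) χ d) + dual ψ (hchH c χ (hcH d φ)) := by
  induction c using Finsupp.induction_linear with
  | zero => simp
  | add c c' hc hc' =>
    simp only [map_add, LinearMap.add_apply] at hc hc' ⊢
    linear_combination hc + hc'
  | single w a =>
    induction d using Finsupp.induction_linear with
    | zero => simp
    | add c c' hc hc' =>
      simp only [map_add, LinearMap.add_apply] at hc hc' ⊢
      linear_combination hc + hc'
    | single v b =>
      rw [single_eq_tens (k := k), single_eq_tens (k := k), hcH_tens, chH_tens]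
      -- both words on the right-hand side are cut once more
      rw [dual_hchH_splitSum_left, dual_hchH_splitSum_right]
      simp only [dual_hchH_tens, splitSum_neg]
      rw [← neg_add]
      congr 1
      rw [← sum_splitSum, ← sum_splitSum, ← Finset.sum_add_distrib]
      refine Finset.sum_congr rfl fun g _ => ?_
      rw [← splitSum_splitSum (fun w₁ w₂ w₃ => splitSum (fun v₁ v₂ => (-1 : k) ^ w₂.length *
        tr (ev k (v₁ ++ g⁻¹ :: w₂) φ * (ev k w₃ (sgn k ψ) * a) * ev k (w₁ ++ g :: v₂) χ * b)) v) w]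
      rw [splitSum_comm (fun u u' w₁ w₂ => splitSum (fun v₁ v₂ => (-1 : k) ^ w₂.length *
        tr (ev k (v₁ ++ g⁻¹ :: w₂) ψ * a * ev k (w₁ ++ g :: v₂) χ * (b * ev k u φ))) u') v w]
      rw [← splitSum_add]
      refine splitSum_congr fun w₁ w₂ _ => ?_
      rw [splitSum_comm, splitSum_splitSum, ← splitSum_add]
      refine splitSum_congr fun v₁ v₂ _ => ?_
      rw [ev_append_cons_ccC, add_mul, add_mul, add_mul, map_add, mul_add, add_comm]
      simp only [mul_assoc, tr_mul_right_splitSum]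
      rw [mul_splitSum, mul_splitSum]
      congr 1
      · refine splitSum_congr fun u u' hu => ?_
        rw [← hu, ev_sgn]
        simp only [smul_mul_assoc, mul_smul_comm, map_smul, smul_eq_mul, List.length_append, pow_add]
        ring_nf
      · refine splitSum_congr fun u u' hu => ?_
        rw [tr_mul_comm]
        simp only [mul_assoc]

/-- The compatibility of the ternary operation with the product, for two cochains and three chains
of which two are adjacent. -/
theorem dual_hcC_hchH (φ ψ a b c : WordMod k G) :
    dual (sgn k (hcC b φ)) (hchH c ψ a) + dual (chC ψ a) (hchH b φ c) =
      -dual (sgn k φ) (hchH c ψ (hhH a (sgn k b))) := by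
  induction a using Finsupp.induction_linear with
  | zero => simp
  | add c c' hc hc' =>
    simp only [map_add, LinearMap.add_apply] at hc hc' ⊢
    linear_combination hc + hc'
  | single u x =>
  induction b using Finsupp.induction_linear with
  | zero => simp
  | add c c' hc hc' =>
    simp only [map_add, LinearMap.add_apply] at hc hc' ⊢
    linear_combination hc + hc'
  | single v y =>
  induction c using Finsupp.induction_linear with
  | zero => simp
  | add c c' hc hc' =>
    simp only [map_add, LinearMap.add_apply] at hc hc' ⊢
    linear_combination hc + hc'
  | single w z =>
  rw [single_eq_tens (k := k), single_eq_tens (k := k), single_eq_tens (k := k), sgn_tens,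
    map_smul, hhH_tens, map_smul, map_smul, map_sum, map_sum]
  simp only [dual_hchH_tens, splitSum_append_cons, Finset.sum_neg_distrib, ev_sgn, ev_hcC_tens,
    ev_chC_tens, splitSum_add, Finset.sum_add_distrib, Finset.smul_sum, smul_add, smul_neg,
    Finset.sum_mul, map_sum, Finset.mul_sum, ← sum_splitSum, neg_add, smul_splitSum]
  rw [add_comm, neg_neg, neg_neg]
  congr 1
  · rw [Finset.sum_comm, ← Finset.sum_neg_distrib]
    refine Finset.sum_congr rfl fun h _ => ?_
    rw [← sum_inv_eq, ← Finset.sum_neg_distrib]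
    refine Finset.sum_congr rfl fun g _ => ?_
    rw [splitSum_comm, ← splitSum_neg]
    refine splitSum_congr fun w₁ w₂ _ => ?_
    rw [← splitSum_neg]
    refine splitSum_congr fun v₁ v₂ hv => ?_
    rw [← hv]
    have e : tr (ev k (w₁ ++ g :: (v₂ ++ h⁻¹ :: u.1)) ψ * (x * (el k h * (y *
        (ev k (v₁ ++ g⁻¹ :: w₂) φ * z))))) = tr (ev k (v₁ ++ g⁻¹ :: w₂) φ * (z *
        (ev k (w₁ ++ g :: (v₂ ++ h⁻¹ :: u.1)) ψ * (x * (el k h * y))))) := by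
      simpa only [mul_assoc] using tr_mul_comm
        (ev k (w₁ ++ g :: (v₂ ++ h⁻¹ :: u.1)) ψ * (x * (el k h * y)))
        (ev k (v₁ ++ g⁻¹ :: w₂) φ * z)
    simp only [smul_mul_assoc, map_smul, smul_eq_mul, inv_inv, mul_assoc, List.append_assoc,
      List.cons_append, e, List.length_append, List.length_cons, pow_add, pow_one]
    linear_combination ((-1) ^ v₂.length * tr (ev k (v₁ ++ g⁻¹ :: w₂) φ * (z *
        (ev k (w₁ ++ g :: (v₂ ++ h⁻¹ :: u.1)) ψ * (x * (el k h * y)))))) *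
        ((-1) ^ w₂.length * (-1) ^ w₂.length * neg_one_pow_mul_self (k := k) v₁.length +
          neg_one_pow_mul_self (k := k) w₂.length)
  · rw [Finset.sum_comm, ← Finset.sum_neg_distrib]
    refine Finset.sum_congr rfl fun h _ => ?_
    rw [← Finset.sum_neg_distrib]
    refine Finset.sum_congr rfl fun g _ => ?_
    rw [← splitSum_neg]
    refine splitSum_congr fun w₁ w₂ _ => ?_
    rw [← splitSum_neg]
    refine splitSum_congr fun u₁ u₂ hu => ?_
    have e : tr (el k h * (y * (ev k (v.1 ++ h⁻¹ :: (u₁ ++ g⁻¹ :: w₂)) φ * (z *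
        (ev k (w₁ ++ g :: u₂) ψ * x))))) = tr (ev k (v.1 ++ h⁻¹ :: (u₁ ++ g⁻¹ :: w₂)) φ * (z *
        (ev k (w₁ ++ g :: u₂) ψ * (x * (el k h * y))))) := by
      rw [← mul_assoc (el k h), tr_mul_comm]
      simp only [mul_assoc]
    simp only [smul_mul_assoc, map_smul, smul_eq_mul, mul_assoc, List.append_assoc,
      List.cons_append, e, List.length_append, List.length_cons, pow_add, pow_one]
    linear_combination (-(-1) ^ u₁.length * (-1) ^ w₂.length * (-1) ^ w₂.length *
        tr (ev k (v.1 ++ h⁻¹ :: (u₁ ++ g⁻¹ :: w₂)) φ * (z *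
        (ev k (w₁ ++ g :: u₂) ψ * (x * (el k h * y)))))) * neg_one_pow_mul_self (k := k) v.1.length

end Relations

/-! ### The quadratic relation of the ternary operation -/

section TernaryRelation

variable {k : Type*} [Field k] {G : Type*} [Group G] [Fintype G]

/-- The cut of the word `u g w` is either inside `u` or inside `w`. -/
theorem ev_append_cons_chcC_tens (ψ χ : WordMod k G) (v : List G) (b : MonoidAlgebra k G)
    (u : List G) (g : G) (w : List G) :
    ev k (u ++ g :: w) (chcC ψ (tens k v b) χ) =
      -∑ h : G, (splitSum (fun u₁ u₂ => splitSum (fun v₁ v₂ => (-1 : k) ^ u₁.length •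
          (ev k (u₁ ++ h :: v₂) ψ * b * ev k (v₁ ++ h⁻¹ :: (u₂ ++ g :: w)) χ)) v) u +
        splitSum (fun w₁ w₂ => splitSum (fun v₁ v₂ => (-1 : k) ^ (u ++ g :: w₁).length •
          (ev k (u ++ g :: (w₁ ++ h :: v₂)) ψ * b * ev k (v₁ ++ h⁻¹ :: w₂) χ)) v) w) := by
  rw [ev_chcC_tens]
  simp only [splitSum_append_cons, List.append_assoc, List.cons_append]

theorem hchH_neg_left (c ψ d : WordMod k G) : hchH (-c) ψ d = -hchH c ψ d := by
  rw [← neg_one_smul k c, map_smul]; simp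

variable (φ ψ χ : WordMod k G) (u v w : List G) (a b x : MonoidAlgebra k G)

/-- The potential of three cochains and three chains that are composed cyclically, where the word
`u` is cut into three pieces and `v` and `w` are cut into two. -/
noncomputable def firstCutSum : k :=
  ∑ h : G, ∑ g : G, splitSum (fun u' u₃ => splitSum (fun u₁ u₂ => splitSum (fun v₁ v₂ =>
    splitSum (fun w₁ w₂ => (-1) ^ u₂.length * tr (ev k (w₁ ++ g⁻¹ :: u₃) φ * (a *
      (ev k (u₁ ++ h :: v₂) ψ * (b * (ev k (v₁ ++ h⁻¹ :: (u₂ ++ g :: w₂)) χ * x)))))) w) v) u') u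

/-- The potential of three cochains and three chains that are composed cyclically, where the word
`v` is cut into three pieces and `u` and `w` are cut into two. -/
noncomputable def secondCutSum : k :=
  ∑ h : G, ∑ g : G, splitSum (fun u₁ u₂ => splitSum (fun v' v₃ => splitSum (fun v₁ v₂ =>
    splitSum (fun w₁ w₂ => (-1) ^ v₂.length * tr (ev k (w₁ ++ g⁻¹ :: (v₂ ++ h⁻¹ :: u₂)) φ * (a *
      (ev k (u₁ ++ h :: v₃) ψ * (b * (ev k (v₁ ++ g :: w₂) χ * x)))))) w) v') v) u

/-- The potential of three cochains and three chains that are composed cyclically, where the word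
`w` is cut into three pieces and `u` and `v` are cut into two. -/
noncomputable def thirdCutSum : k :=
  ∑ h : G, ∑ g : G, splitSum (fun u₁ u₂ => splitSum (fun v₁ v₂ => splitSum (fun w' w₃ =>
    splitSum (fun w₁ w₂ => (-1) ^ w₂.length * tr (ev k (w₁ ++ g⁻¹ :: u₂) φ * (a *
      (ev k (u₁ ++ g :: (w₂ ++ h :: v₂)) ψ * (b * (ev k (v₁ ++ h⁻¹ :: w₃) χ * x)))))) w') w) v) u

set_option maxHeartbeats 1000000 in
theorem dual_hchH_hchH_left_tens :
    dual φ (hchH (hchH (tens k u a) ψ (tens k v b)) χ (tens k w x)) =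
      firstCutSum φ ψ χ u v w a b x - secondCutSum φ ψ χ u v w a b x := by
  rw [hchH_tens]
  simp only [hchH_neg_left, map_neg, map_sum, LinearMap.sum_apply, dual_hchH_splitSum_left,
    map_smul, LinearMap.smul_apply, dual_hchH_tens, splitSum_append_cons, splitSum_neg, smul_neg,
    neg_neg, Finset.sum_neg_distrib, ← sum_splitSum, Finset.smul_sum, splitSum_add, smul_add,
    Finset.sum_add_distrib, smul_splitSum]
  rw [add_comm, sub_eq_add_neg]
  congr 1
  · refine Finset.sum_congr rfl fun h _ => Finset.sum_congr rfl fun g _ => ?_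
    rw [← splitSum_splitSum]
    refine splitSum_congr fun u₁ u' _ => ?_
    rw [splitSum_comm]
    refine splitSum_congr fun u₂ u₃ hu' => splitSum_congr fun v₁ v₂ _ => splitSum_congr
      fun w₁ w₂ _ => ?_
    rw [← hu']
    simp only [List.append_assoc, List.cons_append, mul_assoc, List.length_append, smul_eq_mul,
      pow_add]
    linear_combination ((-1) ^ u₂.length * tr (ev k (w₁ ++ g⁻¹ :: u₃) φ * (a *
      (ev k (u₁ ++ h :: v₂) ψ * (b * (ev k (v₁ ++ h⁻¹ :: (u₂ ++ g :: w₂)) χ * x)))))) *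
      neg_one_pow_mul_self (k := k) u₃.length
  · rw [secondCutSum]
    simp only [← Finset.sum_neg_distrib, ← splitSum_neg]
    refine Finset.sum_congr rfl fun h _ => Finset.sum_congr rfl fun g _ => ?_
    refine splitSum_congr fun u₁ u₂ _ => splitSum_congr fun v' v₃ _ => splitSum_congr
      fun v₁ v₂ _ => splitSum_congr fun w₁ w₂ _ => ?_
    simp only [mul_assoc, List.length_append, List.length_cons, smul_eq_mul, pow_add, pow_one]
    linear_combination (-(-1) ^ v₂.length * tr (ev k (w₁ ++ g⁻¹ :: (v₂ ++ h⁻¹ :: u₂)) φ * (a *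
      (ev k (u₁ ++ h :: v₃) ψ * (b * (ev k (v₁ ++ g :: w₂) χ * x)))))) *
      neg_one_pow_mul_self (k := k) u₂.length

set_option maxHeartbeats 1000000 in
theorem dual_hchH_chcC_tens :
    dual φ (hchH (sgn k (tens k u a)) (chcC ψ (tens k v b) χ) (tens k w x)) =
      firstCutSum φ ψ χ u v w a b x - thirdCutSum φ ψ χ u v w a b x := by
  rw [sgn_tens]
  simp only [map_smul, LinearMap.smul_apply, dual_hchH_tens, ev_append_cons_chcC_tens, mul_neg,
    neg_mul, map_neg, Finset.mul_sum, Finset.sum_mul, map_sum, mul_add, add_mul, map_add,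
    tr_mul_right_splitSum, splitSum_neg, Finset.sum_neg_distrib, neg_neg, ← sum_splitSum,
    splitSum_add, Finset.sum_add_distrib, mul_splitSum, smul_add, Finset.smul_sum, smul_splitSum]
  rw [sub_eq_add_neg]
  congr 1
  · rw [firstCutSum, Finset.sum_comm]
    refine Finset.sum_congr rfl fun h _ => Finset.sum_congr rfl fun g _ => ?_
    refine splitSum_congr fun u' u₃ hu => ?_
    rw [splitSum_comm]
    refine splitSum_congr fun u₁ u₂ hu' => ?_
    rw [splitSum_comm]
    refine splitSum_congr fun v₁ v₂ _ => splitSum_congr fun w₁ w₂ _ => ?_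
    rw [← hu, ← hu']
    simp only [List.append_assoc, mul_assoc, List.length_append, smul_eq_mul,
      mul_smul_comm, smul_mul_assoc, map_smul, pow_add]
    linear_combination ((-1) ^ u₂.length * tr (ev k (w₁ ++ g⁻¹ :: u₃) φ * (a *
      (ev k (u₁ ++ h :: v₂) ψ * (b * (ev k (v₁ ++ h⁻¹ :: (u₂ ++ g :: w₂)) χ * x)))))) *
      ((-1) ^ u₃.length * (-1) ^ u₃.length * neg_one_pow_mul_self (k := k) u₁.length +
        neg_one_pow_mul_self (k := k) u₃.length)
  · rw [thirdCutSum, Finset.sum_comm]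
    simp only [← Finset.sum_neg_distrib, ← splitSum_neg]
    refine Finset.sum_congr rfl fun h _ => Finset.sum_congr rfl fun g _ => ?_
    refine splitSum_congr fun u₁ u₂ hu => ?_
    rw [splitSum_splitSum]
    conv_rhs => rw [splitSum_comm]
    refine splitSum_congr fun w' w₃ _ => ?_
    rw [splitSum_comm]
    refine splitSum_congr fun v₁ v₂ _ => splitSum_congr fun w₁ w₂ _ => ?_
    rw [← hu]
    simp only [mul_assoc, List.length_append, List.length_cons, smul_eq_mul, mul_smul_comm,
      smul_mul_assoc, map_smul, pow_add, pow_one]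
    linear_combination (-(-1) ^ w₂.length * tr (ev k (w₁ ++ g⁻¹ :: u₂) φ * (a *
      (ev k (u₁ ++ g :: (w₂ ++ h :: v₂)) ψ * (b * (ev k (v₁ ++ h⁻¹ :: w₃) χ * x)))))) *
      ((-1) ^ u₁.length * (-1) ^ u₁.length * neg_one_pow_mul_self (k := k) u₂.length +
        neg_one_pow_mul_self (k := k) u₁.length)

set_option maxHeartbeats 1000000 in
theorem dual_hchH_hchH_right_tens :
    dual φ (hchH (sgn k (tens k u a)) (sgn k ψ) (hchH (tens k v b) χ (tens k w x))) =
      thirdCutSum φ ψ χ u v w a b x - secondCutSum φ ψ χ u v w a b x := by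
  rw [sgn_tens, hchH_tens]
  simp only [map_neg, map_sum, dual_hchH_splitSum_right,
    map_smul, LinearMap.smul_apply, dual_hchH_tens, splitSum_append_cons, splitSum_neg, smul_neg,
    neg_neg, Finset.sum_neg_distrib, ← sum_splitSum, Finset.smul_sum, splitSum_add, smul_add,
    Finset.sum_add_distrib, smul_splitSum]
  rw [sub_eq_add_neg]
  congr 1
  · rw [thirdCutSum, ← sum_inv_eq]
    refine Finset.sum_congr rfl fun h _ => Finset.sum_congr rfl fun g _ => ?_
    conv_rhs => rw [splitSum_comm]
    refine splitSum_congr fun v₁ v₂ _ => ?_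
    rw [splitSum_comm]
    refine splitSum_congr fun u₁ u₂ hu => splitSum_congr fun w' w₃ _ => splitSum_congr
      fun w₁ w₂ _ => ?_
    rw [← hu]
    simp only [mul_assoc, List.length_append, List.length_cons, smul_eq_mul, mul_smul_comm, ev_sgn,
      smul_mul_assoc, map_smul, inv_inv, pow_add, pow_one]
    linear_combination ((-1) ^ w₂.length * tr (ev k (w₁ ++ g⁻¹ :: u₂) φ * (a *
      (ev k (u₁ ++ g :: (w₂ ++ h :: v₂)) ψ * (b * (ev k (v₁ ++ h⁻¹ :: w₃) χ * x)))))) *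
      ((-1) ^ u₁.length * (-1) ^ u₁.length * (-1) ^ v₂.length * (-1) ^ v₂.length *
        neg_one_pow_mul_self (k := k) u₂.length +
        (-1) ^ v₂.length * (-1) ^ v₂.length * neg_one_pow_mul_self (k := k) u₁.length +
        neg_one_pow_mul_self (k := k) v₂.length)
  · rw [secondCutSum, Finset.sum_comm]
    simp only [← Finset.sum_neg_distrib, ← splitSum_neg]
    refine Finset.sum_congr rfl fun h _ => Finset.sum_congr rfl fun g _ => ?_
    refine (splitSum_congr fun v₁ v' _ => splitSum_comm _ _ _).trans ?_
    rw [splitSum_comm]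
    refine splitSum_congr fun u₁ u₂ hu => ?_
    conv_rhs => rw [← splitSum_splitSum]
    refine splitSum_congr fun v₁ v' _ => ?_
    rw [splitSum_comm]
    refine splitSum_congr fun v₂ v₃ hv => splitSum_congr fun w₁ w₂ _ => ?_
    rw [← hu, ← hv]
    simp only [mul_assoc, List.length_append, List.length_cons, smul_eq_mul, mul_smul_comm, ev_sgn,
      smul_mul_assoc, map_smul, List.append_assoc, List.cons_append, pow_add, pow_one]
    linear_combination (-(-1) ^ v₂.length * tr (ev k (w₁ ++ g⁻¹ :: (v₂ ++ h⁻¹ :: u₂)) φ * (a *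
      (ev k (u₁ ++ h :: v₃) ψ * (b * (ev k (v₁ ++ g :: w₂) χ * x)))))) *
      ((-1) ^ u₁.length * (-1) ^ u₁.length * (-1) ^ v₃.length * (-1) ^ v₃.length *
        neg_one_pow_mul_self (k := k) u₂.length +
        (-1) ^ v₃.length * (-1) ^ v₃.length * neg_one_pow_mul_self (k := k) u₁.length +
        neg_one_pow_mul_self (k := k) v₃.length)

/-- The Stasheff relation that is quadratic in the ternary operation: each of the three terms is
the difference of two of three sums, which differ by the word that is cut twice. -/
theorem dual_hchH_hchH (φ ψ χ c d e : WordMod k G) :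
    dual φ (hchH (hchH c ψ d) χ e) =
      dual φ (hchH (sgn k c) (chcC ψ d χ) e) + dual φ (hchH (sgn k c) (sgn k ψ) (hchH d χ e)) := by
  induction c using Finsupp.induction_linear with
  | zero => simp
  | add c c' hc hc' =>
    simp only [map_add, LinearMap.add_apply] at hc hc' ⊢
    linear_combination hc + hc'
  | single u a =>
  induction d using Finsupp.induction_linear with
  | zero => simp
  | add c c' hc hc' =>
    simp only [map_add, LinearMap.add_apply] at hc hc' ⊢
    linear_combination hc + hc'
  | single v b =>
  induction e using Finsupp.induction_linear with
  | zero => simp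
  | add c c' hc hc' =>
    simp only [map_add] at hc hc' ⊢
    linear_combination hc + hc'
  | single w x =>
  rw [single_eq_tens (k := k), single_eq_tens (k := k), single_eq_tens (k := k)]
  rw [dual_hchH_hchH_left_tens, dual_hchH_chcC_tens, dual_hchH_hchH_right_tens]
  ring

end TernaryRelation

/-! ### The differential -/

section Differential

variable {k : Type*} [Field k] {G : Type*} [Group G]

theorem coboundaryAt_eq_cob (φ : WordMod k G) (l : List G) :
    coboundaryAt k (lmul k) (rmul k) φ l = cob (fun s => ev k s φ) l := by
  rcases l with _ | ⟨g, t⟩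
  · simp [coboundaryAt, cob]
  · rw [coboundaryAt, sum_merge (fun s => ev k s φ), cob, sub_eq_add_neg]
    rfl

theorem signTwist_apply {M : Type*} [AddCommGroup M] [Module k M] (x : (Word G →₀ M) × (Word G →₀ M)) :
    signTwist k x = (x.1, sgn k x.2) := rfl

variable [Fintype G]

/-- The Hochschild coboundary on normalized cochains. -/
noncomputable def coD : WordMod k G →ₗ[k] WordMod k G :=
  LinearMap.fst k _ _ ∘ₗ hochDiff k G ∘ₗ LinearMap.inl k _ _

/-- The Hochschild boundary on normalized chains. -/
noncomputable def bdry : WordMod k G →ₗ[k] WordMod k G :=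
  LinearMap.snd k _ _ ∘ₗ hochDiff k G ∘ₗ LinearMap.inr k _ _

/-- The trace map from chains of degree `0` to cochains of degree `0`. -/
noncomputable def trace : WordMod k G →ₗ[k] WordMod k G :=
  LinearMap.fst k _ _ ∘ₗ hochDiff k G ∘ₗ LinearMap.inr k _ _

theorem ev_coD (φ : WordMod k G) (l : List G) :
    ev k l (coD φ) = cob (fun s => ev k s φ) l := by
  have e : coD φ = ofBounded (coboundaryAt k (lmul k) (rmul k) φ)
      (coboundaryAt_bounded k (lmul k) (rmul k) φ) := by
    simp [coD, hochDiff, diff]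
  rw [e, ev_ofBounded, coboundaryAt_eq_cob]
  intro l hl
  rw [coboundaryAt_eq_cob]
  exact cob_eq_zero_of_mem (fun s hs => ev_of_mem hs _) hl

theorem trace_eq_tens (c : WordMod k G) :
    trace c = tens k [] (∑ g : G, el k g * ev k [] c * el k g⁻¹) := by
  ext1 w
  rcases w with ⟨_ | ⟨g, t⟩, hw⟩ <;>
    simp [trace, hochDiff, diff, coboundaryAt, lmul, rmul, mul_assoc]

theorem bdry_eq_sum (c : WordMod k G) :
    bdry c = c.sum fun w a => boundaryAt k (lmul k) (rmul k) w.1 a := rfl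

theorem hochDiff_apply (x : D k G) : hochDiff k G x = (coD x.1 + trace x.2, bdry x.2) := by
  have e : x = (x.1, 0) + (0, x.2) := by simp
  have h : (hochDiff k G (x.1, 0)).2 = 0 := by simp [hochDiff, diff]
  conv_lhs => rw [e, map_add]
  refine Prod.ext rfl ?_
  rw [Prod.snd_add, h, zero_add]
  rfl

theorem bdry_single (w : Word G) (a : MonoidAlgebra k G) :
    bdry (Finsupp.single w a) = boundaryAt k (lmul k) (rmul k) w.1 a := by
  rw [bdry_eq_sum]
  exact Finsupp.sum_single_index (h := fun (v : Word G) b => boundaryAt k (lmul k) (rmul k) v.1 b)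
    (map_zero _)

/-- The boundary of chains is dual to the coboundary of cochains. -/
theorem dual_bdry (φ c : WordMod k G) : dual φ (bdry c) = dual (coD φ) c := by
  induction c using Finsupp.induction_linear with
  | zero => simp
  | add c c' hc hc' => simp only [map_add, hc, hc']
  | single w a =>
    rw [bdry_single, single_eq_tens (k := k), dual_tens, ev_coD, ← coboundaryAt_eq_cob]
    rcases w with ⟨_ | ⟨g, t⟩, hw⟩
    · simp [boundaryAt, coboundaryAt]
    · simp only [boundaryAt, coboundaryAt, LinearMap.add_apply, LinearMap.sum_apply, map_add,
        map_sum, LinearMap.smul_apply, map_smul, LinearMap.comp_apply, dual_tens, add_mul,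
        Finset.sum_mul, smul_mul_assoc, lmul, rmul, LinearMap.mulLeft_apply,
        LinearMap.mulRight_apply, ← mul_assoc]
      congr 2
      rw [mul_assoc, tr_mul_comm, mul_assoc, tr_mul_comm, mul_assoc]

theorem coD_coD (φ : WordMod k G) : coD (coD φ) = 0 :=
  ev_ext (k := k) fun l => by
    rw [ev_coD, map_zero]
    simp only [ev_coD]
    exact cob_cob _ _

theorem bdry_bdry (c : WordMod k G) : bdry (bdry c) = 0 :=
  eq_zero_of_dual_right fun φ => by rw [dual_bdry, dual_bdry, coD_coD, map_zero, LinearMap.zero_apply]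

theorem ev_trace_of_ne_nil (c : WordMod k G) {l : List G} (h : l ≠ []) :
    ev k l (trace c) = 0 := by
  classical
  rw [trace_eq_tens, ev_tens_self, if_neg fun h' => h h'.1]

theorem ev_trace_nil (c : WordMod k G) :
    ev k [] (trace c) = ∑ g : G, el k g * ev k [] c * el k g⁻¹ := by
  classical
  rw [trace_eq_tens, ev_tens_self, if_pos ⟨rfl, List.not_mem_nil⟩]

theorem ev_trace_append_cons (c : WordMod k G) (u : List G) (g : G) (v : List G) :
    ev k (u ++ g :: v) (trace c) = 0 :=
  ev_trace_of_ne_nil c (by simp)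

theorem coD_trace (c : WordMod k G) : coD (trace c) = 0 :=
  ev_ext (k := k) fun l => by
    rw [ev_coD, map_zero]
    rcases l with _ | ⟨x, _ | ⟨y, l⟩⟩
    · simp [cob]
    · simp only [cob, firstFace_cons, bar_singleton, ev_trace_nil, lastFace, sub_zero,
        List.dropLast_singleton, List.getLast_singleton, List.length_singleton, pow_one, neg_smul,
        one_smul, Finset.mul_sum, Finset.sum_mul]
      rw [add_neg_eq_zero]
      refine Fintype.sum_equiv (Equiv.mulLeft x) _ _ fun g => ?_
      simp only [Equiv.coe_mulLeft, mul_inv_rev, ← el_mul_el, mul_assoc]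
      rw [el_mul_el x⁻¹ x, inv_mul_cancel, el_one, mul_one]
    · have h0 : ∀ (a : G) (s : List G), ev k (a :: s) (trace c) = 0 := fun a s =>
        ev_trace_of_ne_nil c (by simp)
      have h1 : ∀ (s : List G) (f : List G → MonoidAlgebra k G), (∀ a t, f (a :: t) = 0) →
          bar s f = 0 := by
        intro s
        induction s with
        | nil => intro f _; rfl
        | cons a s ih =>
          intro f hf
          rcases s with _ | ⟨b, s⟩
          · rfl
          · rw [bar_cons_cons, hf, ih (fun s => f (a :: s)) fun b t => hf _ _, sub_zero]
      rw [cob, h1 _ _ h0]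
      simp [h0, lastFace]

/-- The trace map is its own transpose. -/
theorem dual_trace_comm (c d : WordMod k G) : dual (trace c) d = dual (trace d) c := by
  have key : ∀ c d : WordMod k G,
      dual (trace c) d = ∑ g : G, tr (el k g * ev k [] c * el k g⁻¹ * ev k [] d) := by
    intro c d
    classical
    induction d using Finsupp.induction_linear with
    | zero => simp
    | add d d' hd hd' => simp only [map_add, hd, hd', mul_add, Finset.sum_add_distrib]
    | single w a =>
      rw [single_eq_tens (k := k), dual_tens, ev_tens_self]
      rcases w with ⟨_ | ⟨x, t⟩, hw⟩
      · simp [ev_trace_nil, Finset.sum_mul]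
      · simp [ev_trace_of_ne_nil]
  rw [key, key, ← sum_inv_eq]
  refine Finset.sum_congr rfl fun g _ => ?_
  rw [inv_inv, mul_assoc _ (el k g), tr_mul_comm]
  simp only [mul_assoc]

theorem trace_bdry (c : WordMod k G) : trace (bdry c) = 0 :=
  wordMod_ext_left fun d => by
    rw [dual_trace_comm, dual_bdry, coD_trace, map_zero, LinearMap.zero_apply,
      LinearMap.zero_apply]

theorem trace_sgn (c : WordMod k G) : trace (sgn k c) = trace c := by
  rw [trace_eq_tens, trace_eq_tens, ev_nil_sgn]

theorem sgn_trace (c : WordMod k G) : sgn k (trace c) = trace c := by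
  rw [trace_eq_tens, sgn_tens]; simp

theorem coD_sgn (φ : WordMod k G) : coD (sgn k φ) = -sgn k (coD φ) :=
  ev_ext (k := k) fun l => by
    rw [map_neg, ev_sgn, ev_coD, ev_coD]
    simp only [cob, ev_sgn, bar_neg_one_pow_smul]
    rcases l with _ | ⟨x, t⟩
    · simp
    · simp only [firstFace_cons, lastFace, List.length_cons, List.length_dropLast, pow_succ,
        mul_smul_comm, smul_mul_assoc, Nat.add_sub_cancel]
      module

theorem bdry_sgn (c : WordMod k G) : bdry (sgn k c) = -sgn k (bdry c) :=
  wordMod_ext_right fun φ => by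
    rw [dual_bdry, map_neg, dual_sgn_right, dual_sgn_right, dual_bdry, coD_sgn, map_neg,
      LinearMap.neg_apply, neg_neg]

theorem hochDiff'_apply (x : D k G) :
    hochDiff' k G x = (coD x.1 + trace x.2, bdry (sgn k x.2)) := by
  have : hochDiff' k G x = hochDiff k G (signTwist k x) := rfl
  rw [this, signTwist_apply, hochDiff_apply, trace_sgn]

theorem hochDiff'_hochDiff' (x : D k G) : hochDiff' k G (hochDiff' k G x) = 0 := by
  simp only [hochDiff'_apply, map_add, coD_coD, coD_trace, bdry_sgn, bdry_bdry,
    map_neg, trace_sgn, trace_bdry, sgn_sgn, add_zero, neg_zero]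
  rfl

end Differential

/-! ### The Leibniz rules -/

section LeibnizFunctions

variable {k : Type*} [Field k] {G : Type*} [Group G]

theorem firstFace_mul_right (f : List G → MonoidAlgebra k G) (b : MonoidAlgebra k G) (l : List G) :
    firstFace (fun s => f s * b) l = firstFace f l * b := by
  rcases l with _ | ⟨x, l⟩ <;> simp [mul_assoc]

theorem lastFace_mul_left (f : List G → MonoidAlgebra k G) (b : MonoidAlgebra k G) (l : List G) :
    lastFace (fun s => b * f s) l = b * lastFace f l := by
  rcases l with _ | ⟨x, l⟩ <;> simp [lastFace, mul_assoc]

theorem bar_mul_right (f : List G → MonoidAlgebra k G) (b : MonoidAlgebra k G) (l : List G) :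
    bar l (fun s => f s * b) = bar l f * b :=
  (map_bar (LinearMap.mulRight k b) l f).symm

theorem bar_mul_left (f : List G → MonoidAlgebra k G) (b : MonoidAlgebra k G) (l : List G) :
    bar l (fun s => b * f s) = b * bar l f :=
  (map_bar (LinearMap.mulLeft k b) l f).symm

theorem leftCob_mul_right (f : List G → MonoidAlgebra k G) (b : MonoidAlgebra k G) (l : List G) :
    leftCob (fun s => f s * b) l = leftCob f l * b := by
  rw [leftCob, firstFace_mul_right, bar_mul_right, leftCob, sub_mul]

theorem rightCob_mul_left (f : List G → MonoidAlgebra k G) (b : MonoidAlgebra k G) (l : List G) :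
    rightCob (fun s => b * f s) l = b * rightCob f l := by
  rw [rightCob, lastFace_mul_left, bar_mul_left, rightCob, mul_sub, mul_smul_comm]

theorem leftCob_smul (f : List G → MonoidAlgebra k G) (r : k) (l : List G) :
    leftCob (fun s => r • f s) l = r • leftCob f l := by
  have h : firstFace (fun s => r • f s) l = r • firstFace f l := by
    rcases l with _ | ⟨x, l⟩ <;> simp
  rw [leftCob, bar_smul, h, leftCob, smul_sub]

theorem rightCob_neg_one_pow_smul (f : List G → MonoidAlgebra k G) (l : List G) :
    rightCob (fun s => (-1 : k) ^ s.length • f s) l =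
      (-1 : k) ^ l.length • (cob f l - firstFace f l) := by
  have h : lastFace (fun s => (-1 : k) ^ s.length • f s) l =
      -((-1 : k) ^ l.length • lastFace f l) := by
    rcases l with _ | ⟨x, l⟩
    · simp
    · simp [lastFace, pow_succ]
  rw [rightCob, h, bar_neg_one_pow_smul, cob]
  module

/-- In the Leibniz rule the two outer faces at the cut of a word cancel. -/
theorem splitSum_lastFace_add_firstFace (f f' : List G → MonoidAlgebra k G) (l : List G) :
    splitSum (fun u v => (-1 : k) ^ u.length • (lastFace f u * f' v)) l +
      splitSum (fun u v => (-1 : k) ^ u.length • (f u * firstFace f' v)) l = 0 := by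
  rw [splitSum_eq_add_markSum_left, splitSum_eq_add_markSum_right]
  have h : markSum (fun u x v => (-1 : k) ^ (u ++ [x]).length • (lastFace f (u ++ [x]) * f' v)) l =
      -markSum (fun u x v => (-1 : k) ^ u.length • (f u * firstFace f' (x :: v))) l := by
    rw [eq_neg_iff_add_eq_zero]
    have : ∀ (F F' : List G → G → List G → MonoidAlgebra k G),
        (∀ u x v, F u x v + F' u x v = 0) → markSum F l + markSum F' l = 0 := by
      induction l with
      | nil => intros; simp [markSum]
      | cons g t ih =>
        intro F F' h
        rw [markSum, markSum, add_add_add_comm, h, ih _ _ fun u x v => h _ _ _, zero_add]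
    refine this _ _ fun u x v => ?_
    simp [pow_succ, mul_assoc]
  rw [h]
  simp

/-- The Leibniz rule for functions of words. -/
theorem cob_splitSum_mul (f f' : List G → MonoidAlgebra k G) (l : List G) :
    cob (splitSum (fun u v => f u * f' v)) l =
      splitSum (fun u v => cob f u * f' v) l +
        splitSum (fun u v => (-1 : k) ^ u.length • (f u * cob f' v)) l := by
  have h := cob_splitSum (fun u v => (-1 : k) ^ v.length • (f u * f' v)) l
  simp only [smul_smul, neg_one_pow_mul_self, one_smul, leftCob_smul, leftCob_mul_right] at h
  have e1 : ∀ u : List G, rightCob (fun s => (-1 : k) ^ s.length • (f u * f' s)) =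
      fun v => (-1 : k) ^ v.length • (f u * (cob f' v - firstFace f' v)) := by
    intro u
    ext1 v
    simp only [← mul_smul_comm]
    rw [rightCob_mul_left (fun s => (-1 : k) ^ s.length • f' s), rightCob_neg_one_pow_smul]
  simp only [e1] at h
  rw [h, smul_splitSum]
  have h2 := splitSum_lastFace_add_firstFace f f' l
  have e2 : splitSum (fun u v => (-1 : k) ^ l.length • (-1 : k) ^ v.length •
      (f u * (cob f' v - firstFace f' v))) l =
      splitSum (fun u v => (-1 : k) ^ u.length • (f u * cob f' v)) l -
        splitSum (fun u v => (-1 : k) ^ u.length • (f u * firstFace f' v)) l := by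
    rw [← splitSum_sub]
    refine splitSum_congr fun u v huv => ?_
    rw [← huv, List.length_append, pow_add, smul_smul, mul_assoc, neg_one_pow_mul_self, mul_one,
      mul_sub, smul_sub]
  rw [e2]
  simp only [cob_eq_leftCob f, add_mul, smul_mul_assoc, splitSum_add]
  linear_combination (norm := module) -h2

theorem leftCob_sum {ι : Type*} (s : Finset ι) (F : ι → List G → MonoidAlgebra k G)
    (l : List G) : leftCob (fun t => ∑ i ∈ s, F i t) l = ∑ i ∈ s, leftCob (F i) l := by
  classical
  induction s using Finset.induction_on with
  | empty => rcases l with _ | ⟨x, l⟩ <;> simp [leftCob, bar_zero]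
  | insert i s hi ih =>
    simp only [Finset.sum_insert hi, ← ih]
    rw [leftCob, bar_add, leftCob, leftCob]
    rcases l with _ | ⟨x, l⟩
    · simp
    · simp only [firstFace_cons, mul_add]; abel

theorem rightCob_sum {ι : Type*} (s : Finset ι) (F : ι → List G → MonoidAlgebra k G)
    (l : List G) : rightCob (fun t => ∑ i ∈ s, F i t) l = ∑ i ∈ s, rightCob (F i) l := by
  classical
  induction s using Finset.induction_on with
  | empty => rcases l with _ | ⟨x, l⟩ <;> simp [rightCob, bar_zero, lastFace]
  | insert i s hi ih =>
    simp only [Finset.sum_insert hi, ← ih]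
    rw [rightCob, bar_add, rightCob, rightCob]
    rcases l with _ | ⟨x, l⟩
    · simp
    · simp only [lastFace, add_mul]; module

end LeibnizFunctions

section Leibniz

variable {k : Type*} [Field k] {G : Type*} [Group G] [Fintype G]

theorem trace_tens_nil (a : MonoidAlgebra k G) :
    trace (tens k ([] : List G) a) = tens k [] (∑ g : G, el k g * a * el k g⁻¹) := by
  classical
  rw [trace_eq_tens, ev_tens_self, if_pos ⟨rfl, List.not_mem_nil⟩]

theorem trace_tens_of_ne_nil {l : List G} (h : l ≠ []) (a : MonoidAlgebra k G) :
    trace (tens k l a) = 0 := by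
  classical
  rw [trace_eq_tens, ev_tens_self, if_neg fun h' => h h'.1.symm]
  simp

theorem ev_ccC_tens_nil_left (a : MonoidAlgebra k G) (φ : WordMod k G) (l : List G) :
    ev k l (ccC (tens k [] a) φ) = a * ev k l φ := by
  classical
  rw [ev_ccC]
  rcases l with _ | ⟨x, l⟩
  · simp [splitSum, ev_tens_self]
  · rw [splitSum, splitSum_eq_zero fun u v _ => by simp [ev_tens_self], add_zero]
    simp [ev_tens_self]

theorem ev_ccC_tens_nil_right (φ : WordMod k G) (a : MonoidAlgebra k G) (l : List G) :
    ev k l (ccC φ (tens k [] a)) = ev k l φ * a := by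
  classical
  rw [ev_ccC]
  rcases List.eq_nil_or_concat' l with rfl | ⟨l, x, rfl⟩
  · simp [splitSum, ev_tens_self]
  · rw [splitSum_concat, splitSum_eq_zero fun u v _ => by simp [ev_tens_self], zero_add]
    simp [ev_tens_self]

theorem coD_ccC (φ ψ : WordMod k G) :
    coD (ccC φ ψ) = ccC (coD φ) ψ + ccC (sgn k φ) (coD ψ) :=
  ev_ext (k := k) fun l => by
    rw [ev_coD, map_add, ev_ccC, ev_ccC, funext (ev_ccC φ ψ), cob_splitSum_mul]
    simp only [ev_coD, ev_sgn, smul_mul_assoc]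

/-- The Leibniz rule for one cochain and two chains. The trace enters when one of the chains has
degree `0`. -/
theorem dual_chC_coD (φ c d : WordMod k G) :
    dual (chC (coD φ) c) d = dual (coD (chC φ c)) d - dual (coD (hcC (sgn k d) φ)) c +
      dual (ccC (trace d) φ) c - dual (ccC φ (trace c)) (sgn k d) := by
  induction c using Finsupp.induction_linear with
  | zero => simp
  | add c c' hc hc' =>
    simp only [map_add, LinearMap.add_apply] at hc hc' ⊢
    linear_combination hc + hc'
  | single w a =>
  induction d using Finsupp.induction_linear with
  | zero => simp
  | add c c' hc hc' =>
    simp only [map_add, LinearMap.add_apply] at hc hc' ⊢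
    linear_combination hc + hc'
  | single v b =>
  obtain ⟨w, hw⟩ := w
  obtain ⟨v, hv⟩ := v
  rw [single_eq_tens (k := k), single_eq_tens (k := k)]
  -- the last outer face of the word of `d` against the face that merges the marked letter into it
  have h1 : ∑ g : G, tr (mergeLeft (fun s => ev k s φ) v g⁻¹ w * a * el k g * b) =
      tr (lastFace (fun l => ∑ g : G, ev k (l ++ g⁻¹ :: w) φ * a * el k g) v * b) +
        dual (ccC (trace (tens k v b)) φ) (tens k w a) := by
    rw [dual_tens]
    rcases List.eq_nil_or_concat' v with rfl | ⟨v, y, rfl⟩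
    · rw [trace_tens_nil, ev_ccC_tens_nil_left, lastFace_nil, zero_mul, map_zero, zero_add]
      simp only [mergeLeft_nil, Finset.sum_mul, map_sum]
      refine Finset.sum_congr rfl fun g _ => ?_
      simpa only [mul_assoc] using tr_mul_comm (el k g⁻¹ * (ev k w φ * a)) (el k g * b)
    · rw [trace_tens_of_ne_nil (by simp), map_zero, LinearMap.zero_apply, map_zero, zero_mul,
        map_zero, add_zero, lastFace_concat]
      simp only [mergeLeft_concat, Finset.sum_mul, map_sum]
      refine Fintype.sum_equiv (Equiv.mulRight y⁻¹) _ _ fun g => ?_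
      simp [el_mul_el, mul_assoc]
  -- the first outer face of the word of `c` against the face that merges the marked letter into it
  have h2 : ∑ g : G, tr (mergeRight (fun s => ev k s φ) v g⁻¹ w * a * el k g * b) =
      tr (firstFace (fun l => ∑ g : G, el k g * b * ev k (v ++ g⁻¹ :: l) φ) w * a) +
        dual (ccC φ (trace (tens k w a))) (tens k v b) := by
    rw [dual_tens]
    rcases w with _ | ⟨x, w⟩
    · rw [trace_tens_nil, ev_ccC_tens_nil_right, firstFace_nil, zero_mul, map_zero, zero_add,
        ← sum_inv_eq]
      simp only [mergeRight, Finset.sum_mul, Finset.mul_sum, map_sum, inv_inv, mul_assoc]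
    · rw [trace_tens_of_ne_nil (by simp), map_zero, map_zero, zero_mul, map_zero, add_zero,
        firstFace_cons]
      simp only [mergeRight, Finset.sum_mul, Finset.mul_sum, map_sum]
      refine Fintype.sum_equiv (Equiv.mulLeft x⁻¹) _ _ fun g => ?_
      simp only [Equiv.coe_mulLeft, mul_inv_rev, inv_inv]
      rw [← mul_assoc, ← mul_assoc, el_mul_el, mul_inv_cancel_left]
      simpa only [mul_assoc] using tr_mul_comm (ev k (v ++ (g⁻¹ * x) :: w) φ * a) (el k g * b)
  rw [sgn_tens, dual_chC_tens]
  simp only [map_smul, LinearMap.smul_apply, dual_tens, ev_coD, ev_chC_tens, ev_hcC_tens,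
    cob_append_cons]
  rw [cob_eq_leftCob (fun l => ∑ g : G, ev k (l ++ g⁻¹ :: w) φ * a * el k g), leftCob_sum,
    cob_eq_rightCob (fun l => ∑ g : G, el k g * b * ev k (v ++ g⁻¹ :: l) φ), rightCob_sum]
  simp only [rightCob_mul_left, leftCob_mul_right]
  simp only [add_mul, sub_mul, smul_mul_assoc, map_add, map_sub, map_smul, smul_eq_mul,
    Finset.sum_add_distrib, Finset.sum_sub_distrib, ← Finset.mul_sum, h1, h2, Finset.sum_mul,
    map_sum]
  have h3 : ∀ g : G, tr (el k g * b * rightCob (fun s => ev k (v ++ g⁻¹ :: s) φ) w * a) =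
      tr (rightCob (fun s => ev k (v ++ g⁻¹ :: s) φ) w * a * el k g * b) := fun g => by
    simpa only [mul_assoc] using
      tr_mul_comm (el k g * b) (rightCob (fun s => ev k (v ++ g⁻¹ :: s) φ) w * a)
  have h4 : (-1) ^ v.length * tr (ev k w (ccC (trace (tens k v b)) φ) * a) =
      tr (ev k w (ccC (trace (tens k v b)) φ) * a) := by
    rcases v with _ | ⟨y, v⟩
    · simp
    · simp [trace_tens_of_ne_nil]
  simp only [h3, dual_tens]
  linear_combination h4

end Leibniz

/-! ### The ternary operation as a homotopy -/

section Homotopy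

variable {k : Type*} [Field k] {G : Type*} [Group G]

theorem leftCob_splitSum_const {β : Type*} (F : List β → List β → List G → MonoidAlgebra k G)
    (l : List G) (w : List β) :
    leftCob (fun t => splitSum (fun w₁ w₂ => F w₁ w₂ t) w) l =
      splitSum (fun w₁ w₂ => leftCob (F w₁ w₂) l) w := by
  rw [leftCob]
  have h1 : bar l (fun t => splitSum (fun w₁ w₂ => F w₁ w₂ t) w) =
      splitSum (fun w₁ w₂ => bar l (F w₁ w₂)) w := by
    induction w generalizing F with
    | nil => rfl
    | cons x w ih => simp only [splitSum, bar_add, ih]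
  rw [h1]
  rcases l with _ | ⟨x, l⟩
  · simp [leftCob, splitSum_zero]
  · simp only [firstFace_cons, mul_splitSum, leftCob, ← splitSum_sub]

theorem rightCob_splitSum_const {β : Type*} (F : List β → List β → List G → MonoidAlgebra k G)
    (l : List G) (w : List β) :
    rightCob (fun t => splitSum (fun w₁ w₂ => F w₁ w₂ t) w) l =
      splitSum (fun w₁ w₂ => rightCob (F w₁ w₂) l) w := by
  induction w generalizing F with
  | nil => rfl
  | cons x w ih =>
    simp only [splitSum]
    rw [← ih, rightCob, rightCob, rightCob, bar_add]
    rcases l with _ | ⟨y, l⟩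
    · simp
    · simp only [lastFace, add_mul]; module

variable [Fintype G]

theorem ev_sgn_chcC_tens (φ ψ : WordMod k G) (w : List G) (a : MonoidAlgebra k G) :
    (fun l => ev k l (sgn k (chcC φ (tens k w a) ψ))) =
      splitSum (fun l₁ l₂ => (-1 : k) ^ l₂.length • -∑ g : G, splitSum (fun w₁ w₂ =>
      ev k (l₁ ++ g :: w₂) φ * (a * ev k (w₁ ++ g⁻¹ :: l₂) ψ)) w) := by
  ext1 l
  rw [ev_sgn, ev_chcC_tens, sum_splitSum, smul_neg, smul_splitSum, ← splitSum_neg]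
  refine splitSum_congr fun l₁ l₂ hl => ?_
  rw [← hl, smul_neg, Finset.smul_sum, Finset.smul_sum]
  refine congrArg Neg.neg (Finset.sum_congr rfl fun g _ => ?_)
  rw [smul_splitSum, smul_splitSum]
  refine splitSum_congr fun w₁ w₂ _ => ?_
  rw [List.length_append, pow_add, smul_smul, mul_comm ((-1) ^ l₁.length), mul_assoc,
    neg_one_pow_mul_self, mul_one, mul_assoc]

variable (φ ψ : WordMod k G) (w v : List G) (a b : MonoidAlgebra k G)

/-- The part of the differential of the ternary operation where the coboundary is applied to `φ`
in those of its arguments that are letters of `v`. -/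
noncomputable def innerFaceSum : k :=
  ∑ g : G, splitSum (fun v₁ v₂ => splitSum (fun w₁ w₂ => (-1) ^ v₁.length *
    tr (leftCob (fun s => ev k (s ++ g :: w₂) φ) v₁ * (a * (ev k (w₁ ++ g⁻¹ :: v₂) ψ * b)))) w) v

/-- The part of the differential of the ternary operation where the inserted letter `g⁻¹` of `ψ` is
merged into its left neighbour. -/
noncomputable def mergeLeftSum : k :=
  ∑ g : G, splitSum (fun v₁ v₂ => splitSum (fun w₁ w₂ =>
    tr (ev k (v₁ ++ g :: w₂) φ * (a * (mergeLeft (fun s => ev k s ψ) w₁ g⁻¹ v₂ * b)))) w) v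

/-- The part of the differential of the ternary operation where the inserted letter `g⁻¹` of `ψ` is
merged into its right neighbour. -/
noncomputable def mergeRightSum : k :=
  ∑ g : G, splitSum (fun v₁ v₂ => splitSum (fun w₁ w₂ =>
    tr (ev k (v₁ ++ g :: w₂) φ * (a * (mergeRight (fun s => ev k s ψ) w₁ g⁻¹ v₂ * b)))) w) v

/-- The part of the differential of the ternary operation where the coboundary is applied to `ψ`
in those of its arguments that are letters of `v`. -/
noncomputable def outerFaceSum : k :=
  ∑ g : G, splitSum (fun v₁ v₂ => splitSum (fun w₁ w₂ =>
    tr (ev k (v₁ ++ g :: w₂) φ * (a * (rightCob (fun s => ev k (w₁ ++ g⁻¹ :: s) ψ) v₂ * b)))) w) v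

theorem dual_coD_chcC_tens :
    dual (coD (sgn k (chcC φ (tens k w a) ψ))) (sgn k (tens k v b)) =
      -innerFaceSum φ ψ w v a b - outerFaceSum φ ψ w v a b := by
  rw [sgn_tens, map_smul, dual_tens, ev_coD, ev_sgn_chcC_tens,
    cob_splitSum (fun l₁ l₂ => -∑ g : G, splitSum (fun w₁ w₂ =>
      ev k (l₁ ++ g :: w₂) φ * (a * ev k (w₁ ++ g⁻¹ :: l₂) ψ)) w)]
  have hL : ∀ v₁ v₂ : List G, leftCob (fun s => -∑ g : G, splitSum (fun w₁ w₂ =>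
      ev k (s ++ g :: w₂) φ * (a * ev k (w₁ ++ g⁻¹ :: v₂) ψ)) w) v₁ = -∑ g : G,
      splitSum (fun w₁ w₂ => leftCob (fun s => ev k (s ++ g :: w₂) φ) v₁ *
        (a * ev k (w₁ ++ g⁻¹ :: v₂) ψ)) w := fun v₁ v₂ => by
    simp only [← neg_one_smul k (∑ g : G, _), leftCob_smul, leftCob_sum, leftCob_splitSum_const,
      leftCob_mul_right]
  have hR : ∀ v₁ v₂ : List G, rightCob (fun s => -∑ g : G, splitSum (fun w₁ w₂ =>
      ev k (v₁ ++ g :: w₂) φ * (a * ev k (w₁ ++ g⁻¹ :: s) ψ)) w) v₂ = -∑ g : G,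
      splitSum (fun w₁ w₂ => ev k (v₁ ++ g :: w₂) φ * (a *
        rightCob (fun s => ev k (w₁ ++ g⁻¹ :: s) ψ) v₂)) w := fun v₁ v₂ => by
    simp only [← Finset.sum_neg_distrib, ← splitSum_neg, ← neg_mul, rightCob_sum,
      rightCob_splitSum_const, rightCob_mul_left]
  simp only [hL, hR]
  rw [innerFaceSum, outerFaceSum, add_mul, map_add, smul_add, sub_eq_add_neg]
  simp only [smul_mul_assoc, map_smul, smul_smul, neg_one_pow_mul_self, one_smul,
    tr_mul_right_splitSum, neg_mul, Finset.sum_mul, map_neg, map_sum, smul_neg, splitSum_neg,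
    ← sum_splitSum, smul_splitSum, Finset.smul_sum, mul_assoc]
  congr 2
  refine Finset.sum_congr rfl fun g _ => splitSum_congr fun v₁ v₂ hv => splitSum_congr
    fun w₁ w₂ _ => ?_
  rw [← hv, List.length_append, pow_add, smul_eq_mul]
  linear_combination ((-1) ^ v₁.length * tr (leftCob (fun s => ev k (s ++ g :: w₂) φ) v₁ *
    (a * (ev k (w₁ ++ g⁻¹ :: v₂) ψ * b)))) * neg_one_pow_mul_self (k := k) v₂.length

theorem dual_hchH_coD_tens :
    dual φ (hchH (sgn k (tens k w a)) (coD ψ) (tens k v b)) =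
      -innerFaceSum ψ φ v w b a - outerFaceSum φ ψ w v a b - mergeLeftSum φ ψ w v a b
        + mergeRightSum φ ψ w v a b := by
  rw [sgn_tens, map_smul, LinearMap.smul_apply, LinearMap.smul_apply, map_smul, dual_hchH_tens]
  simp only [ev_coD, cob_append_cons, innerFaceSum, outerFaceSum, mergeLeftSum, mergeRightSum]
  rw [← sum_inv_eq, ← sum_inv_eq (fun g => splitSum (fun v₁ v₂ => splitSum (fun w₁ w₂ =>
    (-1) ^ v₁.length * tr (leftCob (fun s => ev k (s ++ g :: w₂) ψ) v₁ * (b * (ev k (w₁ ++ g⁻¹ :: v₂)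
      φ * a)))) v) w)]
  simp only [← Finset.sum_neg_distrib, ← Finset.sum_sub_distrib, ← Finset.sum_add_distrib,
    Finset.smul_sum]
  refine Finset.sum_congr rfl fun g _ => ?_
  simp only [inv_inv]
  rw [splitSum_comm (fun v₁ v₂ w₁ w₂ => tr (ev k (v₁ ++ g :: w₂) φ * (a * (rightCob
      (fun s => ev k (w₁ ++ g⁻¹ :: s) ψ) v₂ * b)))),
    splitSum_comm (fun v₁ v₂ w₁ w₂ => tr (ev k (v₁ ++ g :: w₂) φ * (a * (mergeLeft
      (fun s => ev k s ψ) w₁ g⁻¹ v₂ * b)))),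
    splitSum_comm (fun v₁ v₂ w₁ w₂ => tr (ev k (v₁ ++ g :: w₂) φ * (a * (mergeRight
      (fun s => ev k s ψ) w₁ g⁻¹ v₂ * b))))]
  simp only [← splitSum_neg, ← splitSum_sub, ← splitSum_add, smul_splitSum]
  refine splitSum_congr fun w₁ w₂ hw => splitSum_congr fun v₁ v₂ _ => ?_
  have e := tr_mul_comm (leftCob (fun s => ev k (s ++ g⁻¹ :: v₂) ψ) w₁ * b)
    (ev k (v₁ ++ g :: w₂) φ * a)
  simp only [mul_assoc] at e
  rw [e, ← hw, List.length_append, pow_add]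
  simp only [mul_assoc, add_mul, mul_add, sub_mul, mul_sub, smul_mul_assoc, mul_smul_comm, map_add,
    map_sub, map_smul, smul_eq_mul]
  linear_combination (-(-1) ^ w₁.length * tr (ev k (v₁ ++ g :: w₂) φ * (a *
      (leftCob (fun s => ev k (s ++ g⁻¹ :: v₂) ψ) w₁ * b)))) *
      neg_one_pow_mul_self (k := k) w₂.length -
    (tr (ev k (v₁ ++ g :: w₂) φ * (a * (rightCob (fun s => ev k (w₁ ++ g⁻¹ :: s) ψ) v₂ * b))) +
      tr (ev k (v₁ ++ g :: w₂) φ * (a * (mergeLeft (fun s => ev k s ψ) w₁ g⁻¹ v₂ * b))) -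
      tr (ev k (v₁ ++ g :: w₂) φ * (a * (mergeRight (fun s => ev k s ψ) w₁ g⁻¹ v₂ * b)))) *
    ((-1) ^ w₂.length * (-1) ^ w₂.length * neg_one_pow_mul_self (k := k) w₁.length +
      neg_one_pow_mul_self (k := k) w₂.length)

/-- The telescoping step: merging the inserted letter to the left into the cochain `ψ` for one cut
of the word `w` is merging it to the right into `φ` for the previous cut. The two extreme cuts
remain and give the products `(φ ∪ c) ∪ ψ` and `φ ∪ (c ∪ ψ)`. -/
theorem mergeLeftSum_sub_mergeRightSum :
    mergeLeftSum φ ψ w v a b - mergeRightSum ψ φ v w b a =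
      dual (ccC (chC φ (tens k w a)) ψ) (tens k v b) -
        dual (ccC φ (hcC (tens k w a) ψ)) (tens k v b) := by
  have hR : mergeRightSum ψ φ v w b a = ∑ g : G, splitSum (fun v₁ v₂ => splitSum (fun w₁ w₂ =>
      tr (mergeRight (fun s => ev k s φ) v₁ g w₂ * (a * (ev k (w₁ ++ g⁻¹ :: v₂) ψ * b)))) w) v := by
    rw [mergeRightSum, ← sum_inv_eq]
    refine Finset.sum_congr rfl fun g _ => ?_
    rw [splitSum_comm]
    refine splitSum_congr fun v₁ v₂ _ => splitSum_congr fun w₁ w₂ _ => ?_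
    rw [inv_inv]
    simpa only [mul_assoc] using tr_mul_comm (ev k (w₁ ++ g⁻¹ :: v₂) ψ * b)
      (mergeRight (fun s => ev k s φ) v₁ g w₂ * a)
  rw [hR, mergeLeftSum, sum_splitSum, sum_splitSum, dual_ccC_tens, dual_ccC_tens, ← splitSum_sub,
    ← splitSum_sub]
  refine splitSum_congr fun v₁ v₂ _ => ?_
  -- the letters of `w` can be moved across the cut by translating the inserted letter
  have h : ∑ g : G, markSum (fun u x w₂ => tr (ev k (v₁ ++ g :: w₂) φ *
        (a * (mergeLeft (fun s => ev k s ψ) (u ++ [x]) g⁻¹ v₂ * b)))) w =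
      ∑ g : G, markSum (fun u x w₂ => tr (mergeRight (fun s => ev k s φ) v₁ g (x :: w₂) *
        (a * (ev k (u ++ g⁻¹ :: v₂) ψ * b)))) w := by
    rw [sum_markSum, sum_markSum]
    refine markSum_congr fun u x w₂ _ => ?_
    refine (Fintype.sum_equiv (Equiv.mulRight x) _ _ fun g => ?_).symm
    simp [mergeRight]
  simp only [splitSum_eq_add_markSum_left (fun w₁ w₂ => tr (ev k (v₁ ++ _ :: w₂) φ * _)),
    splitSum_eq_add_markSum_right (fun w₁ w₂ => tr (mergeRight _ v₁ _ w₂ * _)),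
    Finset.sum_add_distrib, h, add_sub_add_right_eq_sub, mergeLeft_nil]
  simp only [mergeRight]
  rw [← sum_inv_eq]
  simp only [ev_chC_tens, ev_hcC_tens, Finset.sum_mul, Finset.mul_sum, map_sum, mul_assoc, inv_inv]

/-- The Stasheff identity with three inputs, paired with a fourth element, for two cochains and two
chains that alternate. -/
theorem dual_coD_chcC (φ ψ c d : WordMod k G) :
    dual (coD (sgn k (chcC φ c ψ))) (sgn k d) + dual (coD (sgn k (chcC ψ d φ))) (sgn k c) -
      dual φ (hchH (sgn k c) (coD ψ) d) - dual ψ (hchH (sgn k d) (coD φ) c) +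
      dual (hcC d φ) (hcH c ψ) + dual (hcC c ψ) (hcH d φ) -
      dual (chC φ c) (chH ψ d) - dual (chC ψ d) (chH φ c) = 0 := by
  induction c using Finsupp.induction_linear with
  | zero => simp
  | add c c' hc hc' =>
    simp only [map_add, LinearMap.add_apply] at hc hc' ⊢
    linear_combination hc + hc'
  | single w a =>
  induction d using Finsupp.induction_linear with
  | zero => simp
  | add c c' hc hc' =>
    simp only [map_add, LinearMap.add_apply] at hc hc' ⊢
    linear_combination hc + hc'
  | single v b =>
  rw [single_eq_tens (k := k), single_eq_tens (k := k), dual_coD_chcC_tens, dual_coD_chcC_tens,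
    dual_hchH_coD_tens, dual_hchH_coD_tens, dual_hcH, dual_hcH, dual_chH, dual_chH]
  linear_combination mergeLeftSum_sub_mergeRightSum φ ψ w.1 v.1 a b +
    mergeLeftSum_sub_mergeRightSum ψ φ v.1 w.1 b a

end Homotopy

/-! ### The Stasheff identities in cyclic form -/

section CyclicIdentities

variable {k : Type*} [Field k] {G : Type*} [Group G] [Fintype G]

/-- The degree involution of `𝒟^*(kG, kG)`: multiplication by `(-1)^n` in degree `n`. -/
noncomputable def koszul (x : D k G) : D k G := (sgn k x.1, -sgn k x.2)

theorem sgn_coD (φ : WordMod k G) : sgn k (coD φ) = -coD (sgn k φ) := by rw [coD_sgn, neg_neg]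

theorem sgn_bdry (c : WordMod k G) : sgn k (bdry c) = -bdry (sgn k c) := by rw [bdry_sgn, neg_neg]

theorem dual_chC_bdry (φ c d : WordMod k G) :
    dual (chC φ (bdry c)) d = dual (coD (hcC d φ)) c := by
  rw [← dual_hcC, dual_bdry]

/-- The trace is supported on the empty word, and `chC` evaluates its first argument on non-empty
words only. -/
theorem chC_trace (c d : WordMod k G) : chC (trace c) d = 0 := by
  refine eq_zero_of_dual_left fun e => ?_
  induction d using Finsupp.induction_linear with
  | zero => simp
  | add d d' hd hd' => simp only [map_add, LinearMap.add_apply, hd, hd', add_zero]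
  | single w a =>
    rw [single_eq_tens (k := k)]
    induction e using Finsupp.induction_linear with
    | zero => simp
    | add d d' hd hd' => simp only [map_add, hd, hd', add_zero]
    | single v b =>
      rw [single_eq_tens (k := k), dual_chC_tens]
      simp [ev_trace_append_cons]

/-- The Leibniz rule, paired with a third element. The three summands come from the three rotations
of `dual_chC_coD`. -/
theorem pairing_cup_hochDiff' (x y z : D k G) :
    pairing k G (hochDiff' k G (koszul x)) (cup k y z) +
      pairing k G x (cup k (hochDiff' k G y) z) +
      pairing k G x (cup k (koszul y) (hochDiff' k G z)) = 0 := by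
  have h1 := dual_chC_coD (sgn k x.1) y.2 z.2
  have h2 := dual_chC_coD y.1 z.2 x.2
  have h3 := dual_chC_coD z.1 x.2 (sgn k y.2)
  simp only [pairing_eq_dual, cup_fst, cup_snd, hochDiff'_apply, koszul, map_add, map_neg,
    LinearMap.add_apply, LinearMap.neg_apply, neg_neg, dual_bdry, dual_chH, dual_hcH, dual_hhH,
    dual_hcC, dual_chC_bdry, dual_sgn_right, sgn_sgn, sgn_ccC, sgn_chC, sgn_hcC, sgn_coD, sgn_trace,
    trace_sgn, coD_ccC, chC_trace, map_zero, LinearMap.zero_apply, neg_zero, add_zero] at *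
  linear_combination h1 + h2 - h3

theorem dual_trace_hchH (c d e φ : WordMod k G) : dual (trace c) (hchH d φ e) = 0 := by
  induction d using Finsupp.induction_linear with
  | zero => simp
  | add d d' hd hd' => simp only [map_add, LinearMap.add_apply, hd, hd', add_zero]
  | single w a =>
    rw [single_eq_tens (k := k)]
    induction e using Finsupp.induction_linear with
    | zero => simp
    | add d d' hd hd' => simp only [map_add, hd, hd', add_zero]
    | single v b =>
      rw [single_eq_tens (k := k), dual_hchH_tens]
      simp [ev_trace_append_cons, splitSum_zero]

theorem hchH_trace (c d e : WordMod k G) : hchH d (trace c) e = 0 :=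
  wordMod_ext_right fun φ => by rw [dual_hchH_rotate, dual_trace_hchH, neg_zero, map_zero]

theorem dual_sgn_chcC (φ c ψ d : WordMod k G) :
    dual (sgn k (chcC φ c ψ)) d = -dual φ (hchH (sgn k c) (sgn k ψ) d) := by
  rw [dual_sgn, dual_chcC, ← dual_sgn_hchH, sgn_sgn, sgn_sgn]

theorem dual_hchH_eq (φ c ψ d : WordMod k G) :
    dual φ (hchH c ψ d) = dual (sgn k (chcC ψ d φ)) c := by
  rw [dual_sgn_chcC, ← dual_hchH_rotate]

theorem dual_hchH_bdry_left (φ c ψ d : WordMod k G) :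
    dual φ (hchH (bdry c) ψ d) = dual (coD (sgn k (chcC ψ d φ))) c := by
  rw [dual_hchH_eq, dual_bdry]

theorem dual_hchH_bdry_right (φ c ψ d : WordMod k G) :
    dual φ (hchH (sgn k c) (sgn k ψ) (bdry d)) = -dual (coD (sgn k (chcC φ c ψ))) d := by
  rw [← dual_bdry, dual_sgn_chcC, neg_neg]

theorem dual_coD_hchH (φ c ψ d : WordMod k G) :
    dual (coD (sgn k φ)) (hchH c ψ d) = dual ψ (hchH (sgn k d) (coD φ) c) := by
  rw [dual_hchH_rotate, sgn_coD, sgn_sgn, map_neg, LinearMap.neg_apply, map_neg, neg_neg]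

/-- The quadrilinear form `⟨a, m₃(b, c, d)⟩`. -/
noncomputable def ternaryForm (a b c d : D k G) : k := pairing k G a (ternary k b c d)

theorem ternaryForm_apply (a b c d : D k G) : ternaryForm a b c d =
    dual a.1 (hchH b.2 c.1 d.2) - dual (sgn k b.1) (hchH c.2 d.1 a.2) := by
  rw [ternaryForm, pairing_eq_dual, ternary_fst, ternary_snd, dual_chcC]
  ring

/-- The Stasheff identity with three inputs, paired with a fourth element. -/
theorem ternaryForm_hochDiff' (a b c d : D k G) :
    ternaryForm a (hochDiff' k G b) c d + ternaryForm a (koszul b) (hochDiff' k G c) d +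
      ternaryForm a (koszul b) (koszul c) (hochDiff' k G d) +
      pairing k G (cup k d a) (cup k b c) - pairing k G (cup k a b) (cup k c d) -
      ternaryForm (hochDiff' k G (koszul a)) b c d = 0 := by
  have h1 := dual_coD_chcC a.1 c.1 b.2 d.2
  have h2 := dual_coD_chcC b.1 d.1 c.2 a.2
  have h3 : dual (sgn k b.1) (hchH c.2 d.1 (bdry a.2)) =
      dual (coD (sgn k (chcC b.1 c.2 d.1))) (sgn k a.2) := by
    rw [← dual_sgn_hchH, sgn_sgn, sgn_bdry, map_neg, map_neg, dual_hchH_bdry_right, neg_neg]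
  have hA2 := dual_ccC_hhH a.1 b.1 c.2 d.2
  have hA2' := dual_ccC_hhH b.1 c.1 d.2 a.2
  have hA2'' := dual_ccC_hhH c.1 d.1 a.2 b.2
  have hA2''' := dual_ccC_hhH d.1 a.1 b.2 c.2
  have hA3 := dual_hcC_hhH a.1 b.2 c.2 d.2
  have hA3' := dual_hcC_hhH b.1 c.2 d.2 a.2
  have hA3'' := dual_hcC_hhH c.1 d.2 a.2 b.2
  have hA3''' := dual_hcC_hhH d.1 a.2 b.2 c.2
  simp only [ternaryForm_apply, pairing_eq_dual, cup_fst, cup_snd, hochDiff'_apply, koszul, map_add, map_neg,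
    LinearMap.add_apply, LinearMap.neg_apply, sgn_trace, sgn_sgn, dual_hchH_bdry_left,
    dual_hchH_bdry_right, dual_coD_hchH, h3, sgn_coD,
    trace_sgn, dual_trace_hchH, hchH_trace, hchH_neg_left, dual_chH, dual_hcH, ccC_assoc,
    neg_zero, add_zero] at *
  linear_combination h1 - h2 + hA2 - hA2' + hA2'' - hA2''' + hA3 - hA3' + hA3'' - hA3'''

theorem dual_hcC_hchH_eq (φ ψ a b c : WordMod k G) :
    dual (hcC b φ) (hchH c ψ a) =
      dual (chC ψ a) (hchH (sgn k b) (sgn k φ) c) + dual φ (hchH c ψ (hhH a b)) := by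
  have h := dual_hcC_hchH (sgn k φ) ψ a (sgn k b) c
  simp only [sgn_hcC, sgn_sgn, map_neg, LinearMap.neg_apply] at h
  linear_combination -h

/-- The Stasheff identity with four inputs, paired with a fifth element. -/
theorem ternaryForm_cup (a b c d e : D k G) :
    ternaryForm a (cup k b c) d e - ternaryForm a b (cup k c d) e + ternaryForm a b c (cup k d e) -
      ternaryForm (cup k e a) b c d - ternaryForm (cup k a (koszul b)) c d e = 0 := by
  have hr := fun φ c ψ χ d => dual_hchH_rotate φ c (ccC ψ χ) (k := k) (G := G) d
  have hr1 := fun φ c ψ χ d => dual_hchH_rotate φ c (chC ψ χ) (k := k) (G := G) d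
  have hr2 := fun φ c ψ χ d => dual_hchH_rotate φ c (hcC ψ χ) (k := k) (G := G) d
  have hl := fun φ c c' ψ d => dual_hchH_rotate φ (hhH c c') ψ (k := k) (G := G) d
  have hl1 := fun φ c c' ψ d => dual_hchH_rotate φ (chH c c') ψ (k := k) (G := G) d
  have hl2 := fun φ c c' ψ d => dual_hchH_rotate φ (hcH c c') ψ (k := k) (G := G) d
  have hs : ∀ φ c ψ d : WordMod k G, dual (sgn k φ) (hchH c ψ d) =
      dual φ (hchH (sgn k c) (sgn k ψ) (sgn k d)) := fun φ c ψ d => by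
    rw [← dual_sgn_hchH, sgn_sgn]
  have hs2 : ∀ φ c d ψ e : WordMod k G, dual (chC (sgn k φ) c) (hchH d ψ e) =
      -dual (chC φ (sgn k c)) (hchH (sgn k d) (sgn k ψ) (sgn k e)) := fun φ c d ψ e => by
    rw [← hs, sgn_chC, sgn_sgn, map_neg, LinearMap.neg_apply, neg_neg]
  simp only [ternaryForm_apply, cup_fst, cup_snd, koszul, map_add, map_neg,
    LinearMap.add_apply, LinearMap.neg_apply, sgn_ccC, sgn_chC, sgn_hcC, sgn_sgn, sgn_hhH, sgn_chH,
    sgn_hcH, hr, hr1, hr2, hl, hl1, hl2, hs, hs2, dual_ccC_hchH, dual_hcC_hchH_eq, neg_neg]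
  ring

/-- The Stasheff identity with five inputs, paired with a sixth element. -/
theorem ternaryForm_ternary (a b c d e f : D k G) :
    ternaryForm a (ternary k b c d) e f + ternaryForm a (koszul b) (ternary k c d e) f +
      ternaryForm a (koszul b) (koszul c) (ternary k d e f) = 0 := by
  have h1 := dual_hchH_hchH a.1 c.1 e.1 b.2 d.2 f.2
  have h2 := dual_hchH_hchH b.1 d.1 f.1 c.2 e.2 a.2
  simp only [ternaryForm_apply, ternary_fst, ternary_snd, koszul, map_neg,
    hchH_neg_left] at *
  rw [sgn_sgn, dual_sgn_chcC]
  linear_combination h1 - h2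

end CyclicIdentities

/-! ### The Stasheff identities -/

section Stasheff

variable {k : Type*} [Field k] {G : Type*} [Group G] [Fintype G]

/-- The differential is cyclic. -/
theorem pairing_hochDiff' (x y : D k G) :
    pairing k G x (hochDiff' k G y) = -pairing k G (hochDiff' k G (koszul x)) y := by
  simp only [pairing_eq_dual, hochDiff'_apply, koszul, map_add, map_neg, LinearMap.add_apply,
    LinearMap.neg_apply, dual_bdry, sgn_sgn, trace_sgn, dual_sgn_right, sgn_coD]
  rw [dual_trace_comm]
  ring

theorem pairing_cup (x y z : D k G) :
    pairing k G x (cup k y z) = pairing k G (cup k x y) z := by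
  simp only [pairing_eq_dual, cup_fst, cup_snd, map_add, LinearMap.add_apply, dual_chH, dual_hcH,
    dual_hhH, dual_hcC]
  ring

theorem pairing_cup_rotate (x y z : D k G) :
    pairing k G x (cup k y z) = pairing k G (cup k z x) y := by
  rw [pairing_cup, pairing_comm, pairing_cup]

/-- The ternary operation is cyclic. -/
theorem pairing_ternary (a b c d : D k G) :
    pairing k G a (ternary k b c d) = -pairing k G (ternary k (koszul a) b c) d := by
  rw [pairing_comm _ d]
  show ternaryForm a b c d = -ternaryForm d (koszul a) b c
  rw [ternaryForm_apply, ternaryForm_apply, dual_hchH_rotate (sgn k b.1)]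
  simp only [koszul, sgn_sgn, hchH_neg_left, map_neg]
  ring

theorem hochDiff'_cup (x y : D k G) :
    hochDiff' k G (cup k x y) = cup k (hochDiff' k G x) y + cup k (koszul x) (hochDiff' k G y) := by
  refine sub_eq_zero.1 (eq_zero_of_pairing fun a => ?_)
  have h := pairing_cup_hochDiff' a x y
  rw [map_sub, map_add, pairing_hochDiff']
  linear_combination -h

theorem ternary_hochDiff' (x y z : D k G) :
    ternary k (hochDiff' k G x) y z + ternary k (koszul x) (hochDiff' k G y) z +
      ternary k (koszul x) (koszul y) (hochDiff' k G z) + cup k (cup k x y) z -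
      cup k x (cup k y z) + hochDiff' k G (ternary k x y z) = 0 := by
  refine eq_zero_of_pairing fun a => ?_
  have h := ternaryForm_hochDiff' a x y z
  simp only [map_add, map_sub]
  rw [pairing_hochDiff', pairing_cup_rotate a, pairing_cup a]
  simp only [ternaryForm] at h
  linear_combination h

theorem ternary_cup (x y z w : D k G) :
    ternary k (cup k x y) z w - ternary k x (cup k y z) w + ternary k x y (cup k z w) -
      cup k (ternary k x y z) w - cup k (koszul x) (ternary k y z w) = 0 := by
  refine eq_zero_of_pairing fun a => ?_
  have h := ternaryForm_cup a x y z w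
  simp only [map_add, map_sub]
  rw [pairing_cup_rotate a, pairing_cup a]
  simpa only [ternaryForm] using h

theorem ternary_ternary (x y z v w : D k G) :
    ternary k (ternary k x y z) v w + ternary k (koszul x) (ternary k y z v) w +
      ternary k (koszul x) (koszul y) (ternary k z v w) = 0 :=
  eq_zero_of_pairing fun a => by
    simpa only [map_add, ternaryForm] using ternaryForm_ternary a x y z v w

end Stasheff

section Internal

/-- A family of submodules is an internal direct sum if it has a family of projections. -/
theorem isInternal_of_projections {k V ι : Type*} [Field k] [AddCommGroup V] [Module k V]
    [DecidableEq ι] {A : ι → Submodule k V} (π : ι → V →ₗ[k] V) (hmem : ∀ i x, π i x ∈ A i)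
    (hself : ∀ i, ∀ x ∈ A i, π i x = x) (hne : ∀ i j, i ≠ j → ∀ x ∈ A j, π i x = 0)
    (hsum : ∀ x, ∃ s : Finset ι, ∑ i ∈ s, π i x = x) : DirectSum.IsInternal A := by
  refine ⟨(injective_iff_map_eq_zero _).2 fun f hf => ?_, fun x => ?_⟩
  · have key : ∀ (f : DirectSum ι fun i => A i) i, π i (DirectSum.coeAddMonoidHom A f) = f i := by
      intro f i
      induction f using DirectSum.induction_on with
      | zero => simp
      | of j y =>
        rw [DirectSum.coeAddMonoidHom_of]
        by_cases h : i = j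
        · subst h
          rw [hself _ _ y.2, DirectSum.of_eq_same]
        · rw [hne _ _ h _ y.2, DirectSum.of_eq_of_ne _ _ _ (h)]
          rfl
      | add f g hf hg =>
        rw [map_add, map_add, hf, hg]
        rfl
    ext i
    rw [← key, hf, map_zero]
    rfl
  · obtain ⟨s, hs⟩ := hsum x
    refine ⟨∑ i ∈ s, DirectSum.of (fun i => A i) i ⟨π i x, hmem i x⟩, ?_⟩
    rw [map_sum, ← hs]
    simp only [DirectSum.coeAddMonoidHom_of, hs]

end Internal

/-! ### Degrees and conjugacy classes -/

section Degree

variable {k : Type*} [Field k] {G : Type*} [Group G] {M : Type*} [AddCommGroup M] [Module k M]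

open Classical in
/-- The restriction of a finitely supported function to the words with a given property, as a
linear map. -/
noncomputable def filterL (k : Type*) [Field k] {M : Type*} [AddCommGroup M] [Module k M]
    (p : Word G → Prop) : (Word G →₀ M) →ₗ[k] (Word G →₀ M) where
  toFun φ := φ.filter p
  map_add' _ _ := Finsupp.filter_add
  map_smul' _ _ := Finsupp.filter_smul

theorem filterL_apply_pos {p : Word G → Prop} {w : Word G} (h : p w) (φ : Word G →₀ M) :
    filterL k p φ w = φ w := by
  classical exact Finsupp.filter_apply_pos _ _ h

theorem filterL_apply_neg {p : Word G → Prop} {w : Word G} (h : ¬p w) (φ : Word G →₀ M) :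
    filterL k p φ w = 0 := by
  classical exact Finsupp.filter_apply_neg _ _ h

/-- The projection to the homogeneous component of degree `n`. -/
noncomputable def degProj (n : ℤ) :
    ((Word G →₀ M) × (Word G →₀ M)) →ₗ[k] ((Word G →₀ M) × (Word G →₀ M)) :=
  (filterL k fun w : Word G => (w.1.length : ℤ) = n).prodMap
    (filterL k fun w : Word G => -(w.1.length : ℤ) - 1 = n)

theorem mem_degreePart {n : ℤ} {x : (Word G →₀ M) × (Word G →₀ M)} :
    x ∈ degreePart k G M n ↔ (∀ w : Word G, (w.1.length : ℤ) ≠ n → x.1 w = 0) ∧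
      ∀ w : Word G, -(w.1.length : ℤ) - 1 ≠ n → x.2 w = 0 := by
  simp only [degreePart, Submodule.mem_prod, Finsupp.mem_supported', Set.mem_ofPred_eq]

theorem degProj_mem (n : ℤ) (x : (Word G →₀ M) × (Word G →₀ M)) :
    degProj (k := k) n x ∈ degreePart k G M n :=
  mem_degreePart.2 ⟨fun _ h => filterL_apply_neg (k := k) h _, fun _ h => filterL_apply_neg (k := k) h _⟩

theorem degProj_self {n : ℤ} {x : (Word G →₀ M) × (Word G →₀ M)} (hx : x ∈ degreePart k G M n) :
    degProj (k := k) n x = x := by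
  rw [mem_degreePart] at hx
  refine Prod.ext (Finsupp.ext fun w => ?_) (Finsupp.ext fun w => ?_)
  · by_cases h : (w.1.length : ℤ) = n
    · exact filterL_apply_pos (k := k) (p := fun w : Word G => (w.1.length : ℤ) = n) h _
    · rw [hx.1 w h]
      exact filterL_apply_neg (k := k) (p := fun w : Word G => (w.1.length : ℤ) = n) h _
  · by_cases h : -(w.1.length : ℤ) - 1 = n
    · exact filterL_apply_pos (k := k) (p := fun w : Word G => -(w.1.length : ℤ) - 1 = n) h _
    · rw [hx.2 w h]
      exact filterL_apply_neg (k := k) (p := fun w : Word G => -(w.1.length : ℤ) - 1 = n) h _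

theorem degProj_of_ne {m n : ℤ} (hmn : m ≠ n) {x : (Word G →₀ M) × (Word G →₀ M)}
    (hx : x ∈ degreePart k G M n) : degProj (k := k) m x = 0 := by
  rw [mem_degreePart] at hx
  refine Prod.ext (Finsupp.ext fun w => ?_) (Finsupp.ext fun w => ?_)
  · by_cases h : (w.1.length : ℤ) = m
    · exact (filterL_apply_pos (k := k) (p := fun w : Word G => (w.1.length : ℤ) = m) h _).trans
        (hx.1 w fun h' => hmn (h.symm.trans h'))
    · exact filterL_apply_neg (k := k) (p := fun w : Word G => (w.1.length : ℤ) = m) h _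
  · by_cases h : -(w.1.length : ℤ) - 1 = m
    · exact (filterL_apply_pos (k := k) (p := fun w : Word G => -(w.1.length : ℤ) - 1 = m) h _).trans
        (hx.2 w fun h' => hmn (h.symm.trans h'))
    · exact filterL_apply_neg (k := k) (p := fun w : Word G => -(w.1.length : ℤ) - 1 = m) h _

theorem sum_filterL (f : Word G → ℤ) (φ : Word G →₀ M) (s : Finset ℤ)
    (hs : ∀ w ∈ φ.support, f w ∈ s) : ∑ n ∈ s, filterL k (fun w => f w = n) φ = φ := by
  ext w
  rw [Finsupp.finsetSum_apply]
  by_cases h : φ w = 0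
  · rw [h]
    refine Finset.sum_eq_zero fun n _ => ?_
    by_cases hn : f w = n
    · rw [filterL_apply_pos (k := k) hn, h]
    · rw [filterL_apply_neg (k := k) hn]
  · rw [Finset.sum_eq_single (f w)]
    · exact filterL_apply_pos (k := k) (p := fun v => f v = f w) rfl _
    · exact fun n _ hn => filterL_apply_neg (k := k) (p := fun v => f v = n) hn.symm _
    · exact fun h' => absurd (hs w (Finsupp.mem_support_iff.2 h)) h'

theorem exists_sum_degProj (x : (Word G →₀ M) × (Word G →₀ M)) :
    ∃ s : Finset ℤ, ∑ n ∈ s, degProj (k := k) n x = x := by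
  refine ⟨x.1.support.image (fun w => (w.1.length : ℤ)) ∪
    x.2.support.image (fun w => -(w.1.length : ℤ) - 1), ?_⟩
  refine Prod.ext ?_ ?_
  · rw [Prod.fst_sum]
    exact sum_filterL (k := k) _ _ _ fun w hw =>
      Finset.mem_union_left _ (Finset.mem_image_of_mem _ hw)
  · rw [Prod.snd_sum]
    exact sum_filterL (k := k) _ _ _ fun w hw =>
      Finset.mem_union_right _ (Finset.mem_image_of_mem _ hw)

theorem degreePart_isInternal : DirectSum.IsInternal (degreePart k G M) :=
  isInternal_of_projections (fun n => degProj n) degProj_mem (fun _ _ => degProj_self)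
    (fun _ _ h _ => degProj_of_ne h) exists_sum_degProj

/-- A submodule that is stable under the projections to the homogeneous components is graded. -/
theorem degreePart_comap_isInternal (N : Submodule k ((Word G →₀ M) × (Word G →₀ M)))
    (hN : ∀ n, ∀ x ∈ N, degProj (k := k) n x ∈ N) :
    DirectSum.IsInternal fun n => (degreePart k G M n).comap N.subtype := by
  refine isInternal_of_projections (fun n => (degProj n).restrict (hN n))
    (fun n x => degProj_mem n _) (fun n x hx => Subtype.ext (degProj_self hx))
    (fun m n h x hx => Subtype.ext (degProj_of_ne h hx)) fun x => ?_
  obtain ⟨s, hs⟩ := exists_sum_degProj (k := k) (x : (Word G →₀ M) × (Word G →₀ M))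
  refine ⟨s, Subtype.ext ?_⟩
  conv_rhs => rw [← hs]
  rw [AddSubmonoidClass.coe_finsetSum]
  rfl

end Degree

section Span

theorem el_mem_spanOf {k G : Type*} [Field k] {S : Set G} {g : G} (h : g ∈ S) :
    el k g ∈ spanOf k S :=
  Submodule.subset_span ⟨g, h, rfl⟩

variable {k : Type*} [Field k] {G : Type*} [Group G]

theorem mem_spanOf_iff [Fintype G] {S : Set G} {a : MonoidAlgebra k G} :
    a ∈ spanOf k S ↔ ∀ g, g ∉ S → a.coeff g = 0 := by
  classical
  refine ⟨fun ha => ?_, fun h => ?_⟩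
  · refine Submodule.span_induction ?_ ?_ ?_ ?_ ha
    · rintro _ ⟨s, hs, rfl⟩ g hg
      simp only [el, MonoidAlgebra.coeff_single]
      exact Finsupp.single_eq_of_ne fun h => hg (h ▸ hs)
    · simp
    · intro a b _ _ ha hb g hg
      simp [ha g hg, hb g hg]
    · intro r a _ ha g hg
      simp [ha g hg]
  · rw [← sum_coeff_smul_el a]
    refine Submodule.sum_mem _ fun g _ => ?_
    by_cases hg : g ∈ S
    · exact Submodule.smul_mem _ _ (Submodule.subset_span ⟨g, hg, rfl⟩)
    · rw [h g hg, zero_smul]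
      exact zero_mem _

theorem mul_mem_spanOf {S T U : Set G} (h : ∀ s ∈ S, ∀ t ∈ T, s * t ∈ U) {a b : MonoidAlgebra k G}
    (ha : a ∈ spanOf k S) (hb : b ∈ spanOf k T) : a * b ∈ spanOf k U := by
  refine Submodule.span_induction ?_ ?_ ?_ ?_ ha
  · rintro _ ⟨s, hs, rfl⟩
    refine Submodule.span_induction ?_ ?_ ?_ ?_ hb
    · rintro _ ⟨t, ht, rfl⟩
      rw [el_mul_el]
      exact el_mem_spanOf (h s hs t ht)
    · rw [mul_zero]; exact zero_mem _
    · intro x y _ _ hx hy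
      rw [mul_add]; exact add_mem hx hy
    · intro r x _ hx
      rw [mul_smul_comm]; exact Submodule.smul_mem _ _ hx
  · rw [zero_mul]; exact zero_mem _
  · intro x y _ _ hx hy
    rw [add_mul]; exact add_mem hx hy
  · intro r x _ hx
    rw [smul_mul_assoc]; exact Submodule.smul_mem _ _ hx

end Span

section Graded

variable {k : Type*} [Field k] {G : Type*} [Group G]

/-- A grading of group elements: a family of subsets of `G`, stable under conjugation. -/
structure ConjFamily (G : Type*) [Group G] where
  /-- The subset of degree `n`. -/
  sets : ℤ → Set G
  conj_mem : ∀ n u g, u ∈ sets n → g * u * g⁻¹ ∈ sets n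

/-- The span of the translates `p u` of the elements `u` of degree `n`. -/
noncomputable def ConjFamily.cls (k : Type*) [Field k] (E : ConjFamily G) (n : ℤ) (p : G) :
    Submodule k (MonoidAlgebra k G) :=
  spanOf k {g | p⁻¹ * g ∈ E.sets n}

/-- The cochains and chains whose value at a word `w`, of degree `n`, lies in the span of the
`w u`, respectively `w⁻¹ u`, with `u` of degree `n`. -/
noncomputable def ConjFamily.graded (k : Type*) [Field k] (E : ConjFamily G) :
    Submodule k (D k G) where
  carrier := {x | (∀ w : Word G, x.1 w ∈ E.cls k w.1.length w.1.prod) ∧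
    ∀ w : Word G, x.2 w ∈ E.cls k (-w.1.length - 1) w.1.prod⁻¹}
  add_mem' ha hb := ⟨fun w => add_mem (ha.1 w) (hb.1 w), fun w => add_mem (ha.2 w) (hb.2 w)⟩
  zero_mem' := ⟨fun _ => zero_mem _, fun _ => zero_mem _⟩
  smul_mem' r _ ha :=
    ⟨fun w => Submodule.smul_mem _ r (ha.1 w), fun w => Submodule.smul_mem _ r (ha.2 w)⟩

/-- The product of elements of degrees `m` and `n` of two families has degree `m + n + i`. -/
def ConjFamily.MulLE (i : ℤ) (E F K : ConjFamily G) : Prop :=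
  ∀ m n u v, u ∈ E.sets m → v ∈ F.sets n → u * v ∈ K.sets (m + n + i)

theorem mul_mem_cls {E F K : ConjFamily G} {i : ℤ} (h : E.MulLE i F K) {m n : ℤ} {p q : G}
    {a b : MonoidAlgebra k G} (ha : a ∈ E.cls k m p) (hb : b ∈ F.cls k n q) :
    a * b ∈ K.cls k (m + n + i) (p * q) := by
  refine mul_mem_spanOf (fun s hs t ht => ?_) ha hb
  have := h m n _ _ (E.conj_mem m _ q⁻¹ hs) ht
  simpa [mul_assoc] using this

theorem mul_el_mem_cls {E : ConjFamily G} {m : ℤ} {p : G} {a : MonoidAlgebra k G}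
    (ha : a ∈ E.cls k m p) (g : G) : a * el k g ∈ E.cls k m (p * g) := by
  refine mul_mem_spanOf (T := {g}) (fun s hs t ht => ?_) ha (el_mem_spanOf rfl)
  have := E.conj_mem m _ g⁻¹ hs
  rw [Set.mem_singleton_iff.1 ht]
  simpa [mul_assoc] using this

theorem el_mul_mem_cls {E : ConjFamily G} {m : ℤ} {p : G} {a : MonoidAlgebra k G}
    (ha : a ∈ E.cls k m p) (g : G) : el k g * a ∈ E.cls k m (g * p) := by
  refine mul_mem_spanOf (S := {g}) (fun s hs t ht => ?_) (el_mem_spanOf rfl) ha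
  rw [Set.mem_singleton_iff.1 hs]
  simpa [mul_assoc] using ht

end Graded

section Closure

variable {k : Type*} [Field k] {G : Type*} [Group G]

theorem splitSum_mem {N α : Type*} [AddCommGroup N] [Module k N] (A : Submodule k N)
    {F : List α → List α → N} {l : List α} (h : ∀ u v, u ++ v = l → F u v ∈ A) :
    splitSum F l ∈ A := by
  induction l generalizing F with
  | nil => exact h _ _ rfl
  | cons g t ih => exact add_mem (h _ _ rfl) (ih fun u v huv => h _ _ (by simp [huv]))

/-- The cochains whose values are homogeneous for a family of subsets. -/
noncomputable def ConjFamily.cochains (k : Type*) [Field k] (E : ConjFamily G) :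
    Submodule k (WordMod k G) :=
  (E.graded k).comap (LinearMap.inl k _ _)

/-- The chains whose values are homogeneous for a family of subsets. -/
noncomputable def ConjFamily.chains (k : Type*) [Field k] (E : ConjFamily G) :
    Submodule k (WordMod k G) :=
  (E.graded k).comap (LinearMap.inr k _ _)

variable {E F K L : ConjFamily G}

theorem mem_cochains {φ : WordMod k G} :
    φ ∈ E.cochains k ↔ ∀ l : List G, ev k l φ ∈ E.cls k l.length l.prod := by
  refine ⟨fun h l => ?_, fun h => ⟨fun w => ?_, fun _ => zero_mem _⟩⟩
  · by_cases hl : (1 : G) ∈ l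
    · rw [ev_of_mem hl]; exact zero_mem _
    · rw [ev_of_notMem hl]
      exact h.1 ⟨l, hl⟩
  · have := h w.1
    rwa [ev_of_notMem w.2] at this

theorem mem_chains {c : WordMod k G} :
    c ∈ E.chains k ↔ ∀ w : Word G, c w ∈ E.cls k (-w.1.length - 1) w.1.prod⁻¹ :=
  ⟨fun h => h.2, fun h => ⟨fun _ => zero_mem _, h⟩⟩

theorem mem_graded {x : D k G} : x ∈ E.graded k ↔ x.1 ∈ E.cochains k ∧ x.2 ∈ E.chains k :=
  ⟨fun h => ⟨⟨h.1, fun _ => zero_mem _⟩, ⟨fun _ => zero_mem _, h.2⟩⟩, fun h => ⟨h.1.1, h.2.2⟩⟩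

theorem tens_mem_chains {l : List G} {a : MonoidAlgebra k G}
    (h : a ∈ E.cls k (-l.length - 1) l.prod⁻¹) : tens k l a ∈ E.chains k := by
  classical
  rw [mem_chains]
  intro w
  have := ev_tens_self (k := k) w.1 l a
  rw [ev_of_notMem w.2] at this
  change tens k l a w = _ at this
  rw [this]
  split_ifs with hw
  · rw [hw.1]; exact h
  · exact zero_mem _

/-- Homogeneous chains are sums of homogeneous chains `a ⊗ l`. -/
theorem chains_induction {P : WordMod k G → Prop} {c : WordMod k G} (hc : c ∈ E.chains k)
    (zero : P 0) (add : ∀ c d, P c → P d → P (c + d))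
    (tens_mem : ∀ (l : List G) (a : MonoidAlgebra k G), a ∈ E.cls k (-l.length - 1) l.prod⁻¹ →
      P (tens k l a)) : P c := by
  rw [mem_chains] at hc
  rw [← Finsupp.sum_single c, Finsupp.sum]
  refine Finset.sum_induction _ P add zero fun w _ => ?_
  rw [single_eq_tens (k := k)]
  exact tens_mem _ _ (hc w)

theorem mem_cls_of_eq {m n : ℤ} {p q : G} {a : MonoidAlgebra k G} (ha : a ∈ E.cls k m p)
    (hm : m = n) (hp : p = q) : a ∈ E.cls k n q := hm ▸ hp ▸ ha

theorem bar_mem {N : Type*} [AddCommGroup N] [Module k N] (A : Submodule k N) {l : List G}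
    {f : List G → N} (h : ∀ s : List G, s.length + 1 = l.length → s.prod = l.prod → f s ∈ A) :
    bar l f ∈ A := by
  induction l generalizing f with
  | nil => exact zero_mem _
  | cons g l ih =>
    rcases l with _ | ⟨x, l⟩
    · exact zero_mem _
    · rw [bar_cons_cons]
      exact sub_mem (h _ (by simp) (by simp [mul_assoc]))
        (ih fun s hs hp => h _ (by simp [hs]) (by simp [hp]))

theorem sgn_mem_chains {c : WordMod k G} (hc : c ∈ E.chains k) :
    sgn k c ∈ E.chains k := by
  refine chains_induction (P := fun c => sgn k c ∈ _) hc (by simp)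
    (fun c d hc hd => by simpa using add_mem hc hd) fun w a ha => ?_
  rw [sgn_tens]
  exact Submodule.smul_mem _ _ (tens_mem_chains ha)

/-- The elements of degree `n` of a family have degree `n + 1` in another one. -/
def ConjFamily.SuccLE (E F : ConjFamily G) : Prop := ∀ n u, u ∈ E.sets n → u ∈ F.sets (n + 1)

theorem mem_cls_succ (h : E.SuccLE F) {m : ℤ} {p : G} {a : MonoidAlgebra k G}
    (ha : a ∈ E.cls k m p) : a ∈ F.cls k (m + 1) p := by
  rw [ConjFamily.cls, spanOf] at *
  refine Submodule.span_mono (Set.image_mono ?_) ha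
  exact fun g hg => h m (p⁻¹ * g) hg

variable [Fintype G] {φ ψ c d : WordMod k G} {i j : ℤ}

theorem ccC_mem (h : E.MulLE 0 F K) (hφ : φ ∈ E.cochains k) (hψ : ψ ∈ F.cochains k) :
    ccC φ ψ ∈ K.cochains k := by
  rw [mem_cochains] at *
  intro l
  rw [ev_ccC]
  refine splitSum_mem _ fun u v huv => ?_
  refine mem_cls_of_eq (mul_mem_cls h (hφ u) (hψ v)) ?_ ?_
  · rw [← huv]; simp only [List.length_append]; push_cast; ring
  · rw [← huv]; simp

theorem chC_mem (h : E.MulLE 0 F K) (hφ : φ ∈ E.cochains k) (hc : c ∈ F.chains k) :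
    chC φ c ∈ K.cochains k := by
  refine chains_induction (P := fun c => chC φ c ∈ _) hc (by simp)
    (fun c d hc hd => by simpa using add_mem hc hd) fun w a ha => ?_
  rw [mem_cochains] at *
  intro l
  rw [ev_chC_tens]
  refine Submodule.sum_mem _ fun g _ => ?_
  refine mem_cls_of_eq (mul_el_mem_cls (mul_mem_cls h (hφ _) ha) g) ?_ ?_
  · simp only [List.length_append, List.length_cons]; push_cast; ring
  · simp [mul_assoc]

theorem hcC_mem (h : E.MulLE 0 F K) (hc : c ∈ E.chains k) (hφ : φ ∈ F.cochains k) :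
    hcC c φ ∈ K.cochains k := by
  refine chains_induction (P := fun c => hcC c φ ∈ _) hc (by simp)
    (fun c d hc hd => by simpa using add_mem hc hd) fun w a ha => ?_
  rw [mem_cochains] at *
  intro l
  rw [ev_hcC_tens]
  refine Submodule.sum_mem _ fun g _ => ?_
  rw [mul_assoc]
  refine mem_cls_of_eq (el_mul_mem_cls (mul_mem_cls h ha (hφ _)) g) ?_ ?_
  · simp only [List.length_append, List.length_cons]; push_cast; ring
  · simp

theorem chH_mem (h : E.MulLE 0 F K) (hφ : φ ∈ E.cochains k) (hc : c ∈ F.chains k) :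
    chH φ c ∈ K.chains k := by
  refine chains_induction (P := fun c => chH φ c ∈ _) hc (by simp)
    (fun c d hc hd => by simpa using add_mem hc hd) fun w a ha => ?_
  rw [mem_cochains] at hφ
  rw [chH_tens]
  refine splitSum_mem _ fun u v huv => tens_mem_chains ?_
  refine mem_cls_of_eq (mul_mem_cls h (hφ _) ha) ?_ ?_
  · rw [← huv]; simp only [List.length_append]; push_cast; ring
  · rw [← huv]; simp

theorem hcH_mem (h : E.MulLE 0 F K) (hc : c ∈ E.chains k) (hφ : φ ∈ F.cochains k) :
    hcH c φ ∈ K.chains k := by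
  refine chains_induction (P := fun c => hcH c φ ∈ _) hc (by simp)
    (fun c d hc hd => by simpa using add_mem hc hd) fun w a ha => ?_
  rw [mem_cochains] at hφ
  rw [hcH_tens]
  refine splitSum_mem _ fun u v huv => tens_mem_chains ?_
  refine mem_cls_of_eq (mul_mem_cls h ha (hφ _)) ?_ ?_
  · rw [← huv]; simp only [List.length_append]; push_cast; ring
  · rw [← huv]; simp

theorem hhH_mem (h : E.MulLE 0 F K) (hc : c ∈ E.chains k) (hd : d ∈ F.chains k) :
    hhH c d ∈ K.chains k := by
  refine chains_induction (P := fun c => hhH c d ∈ _) hc (by simp)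
    (fun c d hc hd => by simpa using add_mem hc hd) fun w a ha => ?_
  refine chains_induction (P := fun d => hhH (tens k w a) d ∈ _) hd (by simp)
    (fun c d hc hd => by simpa using add_mem hc hd) fun v b hb => ?_
  rw [hhH_tens]
  refine Submodule.sum_mem _ fun g _ => tens_mem_chains ?_
  refine mem_cls_of_eq (mul_mem_cls h (mul_el_mem_cls ha g) hb) ?_ ?_
  · simp only [List.length_append, List.length_cons]; push_cast; ring
  · simp [mul_assoc]

theorem cup_mem_graded (h : E.MulLE 0 F K) {x y : D k G} (hx : x ∈ E.graded k)
    (hy : y ∈ F.graded k) : cup k x y ∈ K.graded k := by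
  rw [mem_graded] at *
  rw [cup_fst, cup_snd]
  exact ⟨add_mem (add_mem (ccC_mem h hx.1 hy.1) (chC_mem h hx.1 hy.2)) (hcC_mem h hx.2 hy.1),
    add_mem (add_mem (hhH_mem h hx.2 hy.2) (chH_mem h hx.1 hy.2)) (hcH_mem h hx.2 hy.1)⟩

theorem chcC_mem {E' : ConjFamily G} (h : E.MulLE 0 F K) (h' : K.MulLE (-1) E' L)
    (hφ : φ ∈ E.cochains k) (hc : c ∈ F.chains k) (hψ : ψ ∈ E'.cochains k) :
    chcC φ c ψ ∈ L.cochains k := by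
  refine chains_induction (P := fun c => chcC φ c ψ ∈ _) hc (by simp)
    (fun c d hc hd => by simpa using add_mem hc hd) fun w a ha => ?_
  rw [mem_cochains] at *
  intro l
  rw [ev_chcC_tens]
  refine neg_mem (Submodule.sum_mem _ fun g _ => splitSum_mem _ fun l₁ l₂ hl =>
    splitSum_mem _ fun w₁ w₂ hw => Submodule.smul_mem _ _ ?_)
  refine mem_cls_of_eq (mul_mem_cls h' (mul_mem_cls h (hφ _) ha) (hψ _)) ?_ ?_
  · rw [← hl, ← hw]; simp only [List.length_append, List.length_cons]; push_cast; ring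
  · rw [← hl, ← hw]; simp [mul_assoc]

theorem hchH_mem {E' : ConjFamily G} (h : E.MulLE 0 F K) (h' : K.MulLE (-1) E' L)
    (hc : c ∈ E.chains k) (hφ : φ ∈ F.cochains k) (hd : d ∈ E'.chains k) :
    hchH c φ d ∈ L.chains k := by
  refine chains_induction (P := fun c => hchH c φ d ∈ _) hc (by simp)
    (fun c d hc hd => by simpa using add_mem hc hd) fun u a ha => ?_
  refine chains_induction (P := fun d => hchH (tens k u a) φ d ∈ _) hd (by simp)
    (fun c d hc hd => by simpa using add_mem hc hd) fun v b hb => ?_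
  rw [mem_cochains] at hφ
  rw [hchH_tens]
  refine neg_mem (Submodule.sum_mem _ fun g _ => splitSum_mem _ fun u₁ u₂ hu =>
    splitSum_mem _ fun v₁ v₂ hv => Submodule.smul_mem _ _ (tens_mem_chains ?_))
  refine mem_cls_of_eq (mul_mem_cls h' (mul_mem_cls h ha (hφ _)) hb) ?_ ?_
  · rw [← hu, ← hv]; simp only [List.length_append, List.length_cons]; push_cast; ring
  · rw [← hu, ← hv]; simp [mul_assoc]

theorem ternary_mem_graded {E' : ConjFamily G} (h : E.MulLE 0 F K) (h' : K.MulLE (-1) E' L)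
    {x y z : D k G} (hx : x ∈ E.graded k) (hy : y ∈ F.graded k) (hz : z ∈ E'.graded k) :
    ternary k x y z ∈ L.graded k := by
  rw [mem_graded] at *
  exact ⟨chcC_mem h h' hx.1 hy.2 hz.1, hchH_mem h h' hx.2 hy.1 hz.2⟩

theorem coD_mem (h : E.SuccLE F) (hφ : φ ∈ E.cochains k) : coD φ ∈ F.cochains k := by
  rw [mem_cochains] at *
  intro l
  rw [ev_coD, cob]
  refine add_mem (sub_mem ?_ ?_) (Submodule.smul_mem _ _ ?_)
  · rcases l with _ | ⟨x, l⟩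
    · exact zero_mem _
    · exact mem_cls_of_eq (mem_cls_succ h (el_mul_mem_cls (hφ l) x)) (by simp) (by simp)
  · exact bar_mem _ fun s hs hp => mem_cls_of_eq (mem_cls_succ h (hφ s)) (by simp [← hs]) hp
  · rcases List.eq_nil_or_concat' l with rfl | ⟨l, x, rfl⟩
    · exact zero_mem _
    · rw [lastFace_concat]
      exact mem_cls_of_eq (mem_cls_succ h (mul_el_mem_cls (hφ l) x)) (by simp) (by simp)

theorem bdry_mem (h : E.SuccLE F) (hc : c ∈ E.chains k) : bdry c ∈ F.chains k := by
  rw [mem_chains] at hc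
  rw [← Finsupp.sum_single c, Finsupp.sum, map_sum]
  refine Submodule.sum_mem _ fun w _ => ?_
  have hw := hc w
  rw [bdry_single]
  generalize c w = a at hw
  rcases w with ⟨_ | ⟨x, t⟩, hx⟩
  · exact zero_mem _
  · have hl : lmul k = fun g : G => LinearMap.mulLeft k (el k g) := rfl
    rw [boundaryAt]
    simp only [LinearMap.add_apply, LinearMap.sum_apply, LinearMap.smul_apply,
      LinearMap.comp_apply, lmul, rmul, LinearMap.mulLeft_apply, LinearMap.mulRight_apply]
    rw [sum_merge (fun s => tens k s a)]
    refine add_mem (add_mem ?_ (neg_mem (bar_mem _ fun s hs hp => ?_)))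
      (Submodule.smul_mem _ _ ?_) <;> refine tens_mem_chains ?_
    · exact mem_cls_of_eq (mem_cls_succ h (mul_el_mem_cls hw x)) (by simp; ring) (by simp)
    · exact mem_cls_of_eq (mem_cls_succ h hw) (by simp [← hs]; ring) (by rw [hp])
    · rcases List.eq_nil_or_concat' (x :: t) with h' | ⟨l, y, h'⟩
      · simp at h'
      · simp only [h', List.dropLast_concat, List.getLast_append_singleton] at hw ⊢
        exact mem_cls_of_eq (mem_cls_succ h (el_mul_mem_cls hw y)) (by simp; ring) (by simp)

theorem trace_mem (h : E.SuccLE F) (hc : c ∈ E.chains k) : trace c ∈ F.cochains k := by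
  refine chains_induction (P := fun c => trace c ∈ _) hc (by simp)
    (fun c d hc hd => by simpa using add_mem hc hd) fun w a ha => ?_
  rcases w with _ | ⟨x, w⟩
  · classical
    rw [trace_tens_nil, mem_cochains]
    intro l
    rw [ev_tens_self]
    split_ifs with hl
    · rw [hl.1]
      exact Submodule.sum_mem _ fun g _ => mem_cls_of_eq (mem_cls_succ h
        (mul_el_mem_cls (el_mul_mem_cls ha g) g⁻¹)) (by simp) (by simp)
    · exact zero_mem _
  · rw [trace_tens_of_ne_nil (by simp)]
    exact zero_mem _

theorem hochDiff_mem_graded (h : E.SuccLE F) {x : D k G} (hx : x ∈ E.graded k) :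
    hochDiff k G x ∈ F.graded k := by
  rw [mem_graded] at *
  rw [hochDiff_apply]
  exact ⟨add_mem (coD_mem h hx.1) (trace_mem h hx.2), bdry_mem h hx.2⟩

theorem hochDiff'_mem_graded (h : E.SuccLE F) {x : D k G} (hx : x ∈ E.graded k) :
    hochDiff' k G x ∈ F.graded k := by
  rw [mem_graded] at *
  rw [hochDiff'_apply]
  exact ⟨add_mem (coD_mem h hx.1) (trace_mem h hx.2), bdry_mem h (sgn_mem_chains hx.2)⟩

end Closure

/-! ### The cyclic `A_∞`-algebra `𝒟^*(kG, kG)` -/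

section ThreeOperations

/-- The Stasheff identities for an algebra with at most three non-zero operations. -/
theorem stasheff_of_relations {k V : Type*} [Field k] [AddCommGroup V] [Module k V]
    {A : ℤ → Submodule k V} (m : (n : ℕ) → MultilinearMap k (fun _ : Fin n => V) V)
    {m₁ : V → V} {m₂ : V → V → V} {m₃ : V → V → V → V} (h₁ : ∀ a, m 1 a = m₁ (a 0))
    (h₂ : ∀ a, m 2 a = m₂ (a 0) (a 1)) (h₃ : ∀ a, m 3 a = m₃ (a 0) (a 1) (a 2))
    (h₄ : ∀ n, 3 < n → m n = 0) (neg₂ : ∀ x y, m₂ (-x) y = -m₂ x y)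
    (neg₃ : ∀ x y z, m₃ (-x) y z = -m₃ x y z) (neg₃' : ∀ x y z, m₃ x (-y) z = -m₃ x y z)
    (r₁ : ∀ x, m₁ (m₁ x) = 0)
    (r₂ : ∀ n x y, x ∈ A n → m₁ (m₂ x y) = m₂ (m₁ x) y + m₂ (Int.negOnePow n • x) (m₁ y))
    (r₃ : ∀ n p x y z, x ∈ A n → y ∈ A p →
      m₃ (m₁ x) y z + m₃ (Int.negOnePow n • x) (m₁ y) z +
        m₃ (Int.negOnePow n • x) (Int.negOnePow p • y) (m₁ z) + m₂ (m₂ x y) z - m₂ x (m₂ y z) +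
        m₁ (m₃ x y z) = 0)
    (r₄ : ∀ n x y z w, x ∈ A n →
      m₃ (m₂ x y) z w - m₃ x (m₂ y z) w + m₃ x y (m₂ z w) - m₂ (m₃ x y z) w -
        m₂ (Int.negOnePow n • x) (m₃ y z w) = 0)
    (r₅ : ∀ n p x y z v w, x ∈ A n → y ∈ A p →
      m₃ (m₃ x y z) v w + m₃ (Int.negOnePow n • x) (m₃ y z v) w +
        m₃ (Int.negOnePow n • x) (Int.negOnePow p • y) (m₃ z v w) = 0)
    (n : ℕ) (hn : 1 ≤ n) (d : ℕ → ℤ) (a : ℕ → V) (ha : ∀ i < n, a i ∈ A (d i)) :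
    ∑ s ∈ Finset.Icc 1 n, ∑ r ∈ Finset.range (n - s + 1),
      Int.negOnePow ((r : ℤ) + s * ((n : ℤ) - r - s) + (2 - (s : ℤ)) * degSum d r) •
        m (n - s + 1) (fun i => splice a r s (m s (fun j => a (r + j))) i) = 0 := by
  have e2 : Int.negOnePow 2 = 1 := rfl
  have e3 : Int.negOnePow 3 = -1 := rfl
  have e4 : Int.negOnePow 4 = 1 := rfl
  have e6 : Int.negOnePow 6 = 1 := rfl
  have z₁ : m₁ 0 = 0 := (h₁ fun _ => 0).symm.trans ((m 1).map_coord_zero 0 rfl)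
  have z₂ : ∀ x, m₂ 0 x = 0 := fun x =>
    (h₂ ![0, x]).symm.trans ((m 2).map_coord_zero 0 rfl)
  have z₂' : ∀ x, m₂ x 0 = 0 := fun x =>
    (h₂ ![x, 0]).symm.trans ((m 2).map_coord_zero 1 rfl)
  match n, hn with
  | 1, _ => simp [splice, degSum, h₁, r₁]
  | 2, _ =>
    have h := r₂ _ _ (a 1) (ha 0 (by norm_num))
    simp [Finset.sum_Icc_succ_top, Finset.sum_range_succ, splice, degSum, Int.negOnePow_add, h₁, h₂]
    rcases Int.units_eq_one_or (Int.negOnePow (d 0)) with h0 | h0 <;>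
      simp [h0, neg₂] at h ⊢ <;> rw [h] <;> abel
  | 3, _ =>
    have h := r₃ _ _ _ _ (a 2) (ha 0 (by norm_num)) (ha 1 (by norm_num))
    rw [← h]
    simp [Finset.sum_Icc_succ_top, Finset.sum_range_succ, splice, degSum, Int.negOnePow_add, h₁, h₂,
      h₃]
    rcases Int.units_eq_one_or (Int.negOnePow (d 0)) with h0 | h0 <;>
    rcases Int.units_eq_one_or (Int.negOnePow (d 1)) with h1 | h1 <;>
      simp [h0, h1, neg₃, neg₃', e2] <;> abel
  | 4, _ =>
    have h := r₄ _ _ (a 1) (a 2) (a 3) (ha 0 (by norm_num))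
    rw [← h]
    simp [Finset.sum_Icc_succ_top, Finset.sum_range_succ, splice, degSum, Int.negOnePow_add, h₁, h₂,
      h₃, h₄]
    rcases Int.units_eq_one_or (Int.negOnePow (d 0)) with h0 | h0 <;>
      simp [h0, neg₂, e2, e3, z₁] <;> abel
  | 5, _ =>
    have h := r₅ _ _ _ _ (a 2) (a 3) (a 4) (ha 0 (by norm_num)) (ha 1 (by norm_num))
    rw [← h]
    simp [Finset.sum_Icc_succ_top, Finset.sum_range_succ, splice, degSum, Int.negOnePow_add, h₁, h₂,
      h₃, h₄]
    rcases Int.units_eq_one_or (Int.negOnePow (d 0)) with h0 | h0 <;>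
    rcases Int.units_eq_one_or (Int.negOnePow (d 1)) with h1 | h1 <;>
      simp [h0, h1, neg₃, neg₃', e2, e3, e4, e6, z₁, z₂, z₂']
  | n + 6, _ =>
    refine Finset.sum_eq_zero fun s hs => Finset.sum_eq_zero fun r hr => ?_
    rw [Finset.mem_Icc] at hs
    rw [Finset.mem_range] at hr
    by_cases h : 3 < s
    · rw [h₄ s h, (m _).map_coord_zero ⟨r, hr⟩ (by simp [splice]), smul_zero]
    · rw [h₄ _ (by omega), zero_apply, smul_zero]

end ThreeOperations

section AInfinityD

variable {k : Type*} [Field k] {G : Type*} [Group G]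

/-- The family whose graded part is the homogeneous component of degree `n`. -/
def degreeFamily (G : Type*) [Group G] (n : ℤ) : ConjFamily G where
  sets m := {_u | m = n}
  conj_mem _ _ _ h := h

theorem graded_degreeFamily [Fintype G] (n : ℤ) :
    (degreeFamily G n).graded k = degreePart k G (MonoidAlgebra k G) n := by
  have key : ∀ (m : ℤ) (p : G) (a : MonoidAlgebra k G),
      a ∈ (degreeFamily G n).cls k m p ↔ (m ≠ n → a = 0) := by
    intro m p a
    rw [ConjFamily.cls, mem_spanOf_iff]
    refine ⟨fun h hm => ?_, fun h g hg => ?_⟩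
    · apply MonoidAlgebra.coeff_injective
      ext g
      exact h g hm
    · rw [h hg]; rfl
  ext x
  rw [mem_degreePart, mem_graded, mem_chains]
  simp only [key]
  refine and_congr_left' ⟨fun h w => ?_, fun h => ⟨fun w => (key _ _ _).2 (h w), fun w => zero_mem _⟩⟩
  exact (key _ _ _).1 (h.1 w)

theorem sgn_apply {M : Type*} [AddCommGroup M] [Module k M] (c : Word G →₀ M) (w : Word G) :
    sgn k c w = (-1 : k) ^ w.1.length • c w := by
  classical
  induction c using Finsupp.induction_linear with
  | zero => simp
  | add c c' hc hc' => rw [map_add, Finsupp.add_apply, hc, hc', Finsupp.add_apply, smul_add]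
  | single v a =>
    rcases eq_or_ne v w with rfl | h
    · simp [sgn]
    · simp [sgn, h]

theorem koszul_of_mem {n : ℤ} {x : D k G} (hx : x ∈ degreePart k G (MonoidAlgebra k G) n) :
    koszul x = Int.negOnePow n • x := by
  have h : ∀ m : ℕ, ∀ a : MonoidAlgebra k G, (-1 : k) ^ m • a = Int.negOnePow m • a := by
    intro m a
    rw [Int.negOnePow_def]
    rcases Nat.even_or_odd m with hm | hm <;> simp [hm.neg_one_pow, Units.smul_def]
  rw [mem_degreePart] at hx
  refine Prod.ext (Finsupp.ext fun w => ?_) (Finsupp.ext fun w => ?_)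
  · change sgn k x.1 w = Int.negOnePow n • x.1 w
    rw [sgn_apply, h]
    by_cases hw : (w.1.length : ℤ) = n
    · rw [hw]
    · rw [hx.1 w hw, smul_zero, smul_zero]
  · change -sgn k x.2 w = Int.negOnePow n • x.2 w
    rw [sgn_apply, h]
    by_cases hw : -(w.1.length : ℤ) - 1 = n
    · rw [← hw, Int.negOnePow_sub, Int.negOnePow_neg, Int.negOnePow_one, mul_neg, mul_one,
        Units.neg_smul]
    · rw [hx.2 w hw, smul_zero, smul_zero, neg_zero]

theorem cup_neg_left [Fintype G] (x y : D k G) : cup k (-x) y = -cup k x y :=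
  (AddMonoidHom.mk' (cup k · y) fun x x' => cup_add_left k x x' y).map_neg x

theorem ternary_neg_left [Fintype G] (x y z : D k G) :
    ternary k (-x) y z = -ternary k x y z :=
  (AddMonoidHom.mk' (ternary k · y z) fun x x' => ternary_add_left k x x' y z).map_neg x

theorem ternary_neg_mid [Fintype G] (x y z : D k G) :
    ternary k x (-y) z = -ternary k x y z :=
  (AddMonoidHom.mk' (ternary k x · z) fun y y' => ternary_add_mid k x y y' z).map_neg y

@[simp] theorem ops_one [Fintype G] (a : Fin 1 → D k G) : ops k G 1 a = hochDiff' k G (a 0) := rfl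

@[simp] theorem ops_two [Fintype G] (a : Fin 2 → D k G) : ops k G 2 a = cup k (a 0) (a 1) := rfl

@[simp] theorem ops_three [Fintype G] (a : Fin 3 → D k G) :
    ops k G 3 a = ternary k (a 0) (a 1) (a 2) := rfl

theorem ops_of_lt [Fintype G] {n : ℕ} (h : 3 < n) : ops k G n = 0 := by
  obtain ⟨n, rfl⟩ := Nat.exists_eq_add_of_lt h
  rw [show 3 + n + 1 = n + 4 by ring]
  rfl

theorem ops_mem_degreePart [Fintype G] (n : ℕ) (hn : 1 ≤ n) (d : Fin n → ℤ) (a : Fin n → D k G)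
    (ha : ∀ i, a i ∈ degreePart k G (MonoidAlgebra k G) (d i)) :
    ops k G n a ∈ degreePart k G (MonoidAlgebra k G) (∑ i, d i + 2 - n) := by
  simp only [← graded_degreeFamily] at *
  match n, hn with
  | 1, _ =>
    rw [ops_one]
    refine hochDiff'_mem_graded (E := degreeFamily G (d 0)) (fun n _ h => ?_) (ha 0)
    change n + 1 = _
    change n = _ at h
    simp [h]; ring
  | 2, _ =>
    rw [ops_two]
    refine cup_mem_graded (E := degreeFamily G (d 0)) (F := degreeFamily G (d 1))
      (fun m n _ _ h h' => ?_) (ha 0) (ha 1)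
    change m + n + 0 = _
    change m = _ at h
    change n = _ at h'
    simp [h, h', Fin.sum_univ_two]
  | 3, _ =>
    rw [ops_three]
    refine ternary_mem_graded (E := degreeFamily G (d 0)) (F := degreeFamily G (d 1))
      (K := degreeFamily G (d 0 + d 1)) (E' := degreeFamily G (d 2))
      (fun m n _ _ h h' => ?_) (fun m n _ _ h h' => ?_) (ha 0) (ha 1) (ha 2)
    · change m + n + 0 = _
      change m = _ at h
      change n = _ at h'
      simp [h, h']
    · change m + n + -1 = _
      change m = _ at h
      change n = _ at h'
      simp [h, h', Fin.sum_univ_three]; ring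
  | n + 4, _ =>
    rw [ops_of_lt (by omega)]
    exact zero_mem _

theorem ops_stasheff [Fintype G] (n : ℕ) (hn : 1 ≤ n) (d : ℕ → ℤ) (a : ℕ → D k G)
    (ha : ∀ i < n, a i ∈ degreePart k G (MonoidAlgebra k G) (d i)) :
    ∑ s ∈ Finset.Icc 1 n, ∑ r ∈ Finset.range (n - s + 1),
      Int.negOnePow ((r : ℤ) + s * ((n : ℤ) - r - s) + (2 - (s : ℤ)) * degSum d r) •
        ops k G (n - s + 1) (fun i => splice a r s (ops k G s (fun j => a (r + j))) i) = 0 := by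
  refine stasheff_of_relations (ops k G) ops_one ops_two ops_three (fun n h => ops_of_lt h)
    cup_neg_left ternary_neg_left ternary_neg_mid hochDiff'_hochDiff'
    (fun n x y hx => ?_) (fun m n x y z hx hy => ?_) (fun n x y z w hx => ?_)
    (fun m n x y z v w hx hy => ?_) n hn d a ha
  · rw [← koszul_of_mem hx]
    exact hochDiff'_cup x y
  · rw [← koszul_of_mem hx, ← koszul_of_mem hy]
    exact ternary_hochDiff' x y z
  · rw [← koszul_of_mem hx]
    exact ternary_cup x y z w
  · rw [← koszul_of_mem hx, ← koszul_of_mem hy]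
    exact ternary_ternary x y z v w

/-- The pairing has degree `-1`. -/
theorem pairingOf_eq_zero {M : Type*} [AddCommGroup M] [Module k M] (b : M →ₗ[k] M →ₗ[k] k)
    {i j : ℤ} (hij : i + j ≠ -1) {x y : (Word G →₀ M) × (Word G →₀ M)}
    (hx : x ∈ degreePart k G M i) (hy : y ∈ degreePart k G M j) : pairingOf k G b x y = 0 := by
  rw [mem_degreePart] at hx hy
  have h₁ : (y.2.sum fun w a => b (x.1 w) a) = 0 := Finset.sum_eq_zero fun w _ => by
    change b (x.1 w) (y.2 w) = 0
    by_cases hw : (w.1.length : ℤ) = i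
    · rw [hy.2 w (by omega), map_zero]
    · rw [hx.1 w hw, map_zero, LinearMap.zero_apply]
  have h₂ : (x.2.sum fun w a => b (y.1 w) a) = 0 := Finset.sum_eq_zero fun w _ => by
    change b (y.1 w) (x.2 w) = 0
    by_cases hw : (w.1.length : ℤ) = j
    · rw [hx.2 w (by omega), map_zero]
    · rw [hy.1 w hw, map_zero, LinearMap.zero_apply]
  change (y.2.sum fun w a => b (x.1 w) a) + (x.2.sum fun w a => b (y.1 w) a) = 0
  rw [h₁, h₂, add_zero]

theorem ops_cyclic [Fintype G] (n : ℕ) (hn : 1 ≤ n) (d : ℕ → ℤ) (a : ℕ → D k G)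
    (ha : ∀ i ≤ n, a i ∈ degreePart k G (MonoidAlgebra k G) (d i)) :
    pairing k G (a 0) (ops k G n fun i => a (i + 1)) =
      Int.negOnePow (d 0 * (2 - (n : ℤ)) + n) • pairing k G (ops k G n fun i => a i) (a n) := by
  have ha0 := koszul_of_mem (ha 0 (Nat.zero_le n))
  match n, hn with
  | 1, _ =>
    rw [ops_one, ops_one]
    refine (pairing_hochDiff' _ _).trans ?_
    rw [ha0, Int.negOnePow_add]
    rcases Int.units_eq_one_or (Int.negOnePow (d 0)) with h0 | h0 <;> simp [h0]
  | 2, _ =>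
    rw [ops_two, ops_two]
    refine (pairing_cup _ _ _).trans ?_
    simp [Int.negOnePow_even 2 even_two]
  | 3, _ =>
    rw [ops_three, ops_three]
    refine (pairing_ternary _ _ _ _).trans ?_
    have e3 : Int.negOnePow 3 = -1 := rfl
    rw [ha0, Int.negOnePow_add]
    rcases Int.units_eq_one_or (Int.negOnePow (d 0)) with h0 | h0 <;>
      simp [h0, e3, ternary_neg_left]
  | n + 4, _ => simp [ops_of_lt]

theorem isCyclicAInfinityAlgebra_ops [Fintype G] :
    IsCyclicAInfinityAlgebra (-1) (degreePart k G (MonoidAlgebra k G)) (ops k G)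
      (pairing k G) where
  internal := degreePart_isInternal
  zero := rfl
  degree := ops_mem_degreePart
  stasheff := ops_stasheff
  pairing_degree _ _ hij _ ha _ hb := pairingOf_eq_zero _ hij ha hb
  nondegenerate := pairing_nondegenerate
  cyclic := ops_cyclic

end AInfinityD

/-! ### The decomposition by conjugacy classes -/

section Wordwise

variable {k : Type*} [Field k] {G : Type*} [Group G]
  {M N : Type*} [AddCommGroup M] [Module k M] [AddCommGroup N] [Module k N]

/-- The map of finitely supported functions on words that applies `F w` to the value at `w`. -/
noncomputable def wordwise (F : Word G → M →ₗ[k] N) : (Word G →₀ M) →ₗ[k] (Word G →₀ N) :=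
  Finsupp.lsum k fun w => Finsupp.lsingle w ∘ₗ F w

@[simp] theorem wordwise_apply (F : Word G → M →ₗ[k] N) (φ : Word G →₀ M) (w : Word G) :
    wordwise F φ w = F w (φ w) := by
  classical
  induction φ using Finsupp.induction_linear with
  | zero => simp
  | add c c' hc hc' => rw [map_add, Finsupp.add_apply, hc, hc', Finsupp.add_apply, map_add]
  | single v a =>
    rcases eq_or_ne v w with rfl | h
    · simp [wordwise]
    · simp [wordwise, h]

end Wordwise

section Classes

variable {k : Type*} [Field k] {G : Type*} [Group G]

/-- The conjugacy class of `x`, in all degrees. Its graded part is the summand of `x`. -/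
def classFamily (x : G) : ConjFamily G where
  sets _ := {u | IsConj x u}
  conj_mem _ _ g h := h.trans (isConj_iff.2 ⟨g, rfl⟩)

theorem classFamily_cls (x : G) (n : ℤ) (p : G) :
    (classFamily x).cls k n p = spanOf k {g | ∃ u, IsConj x u ∧ g = p * u} := by
  rw [ConjFamily.cls]
  congr 1
  ext g
  refine ⟨fun h => ⟨p⁻¹ * g, h, by group⟩, ?_⟩
  rintro ⟨u, hu, rfl⟩
  simpa [classFamily] using hu

theorem graded_classFamily (x : G) : (classFamily x).graded k = summand k x := by
  ext y
  change ((∀ w, _ ∈ _) ∧ ∀ w, _ ∈ _) ↔ ((∀ w, _ ∈ _) ∧ ∀ w, _ ∈ _)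
  simp only [classFamily_cls]

theorem hochDiff_mem_summand [Fintype G] {x : G} {a : D k G} (ha : a ∈ summand k x) :
    hochDiff k G a ∈ summand k x := by
  rw [← graded_classFamily] at *
  exact hochDiff_mem_graded (fun _ _ h => h) ha

theorem degProj_mem_summand {x : G} (n : ℤ) {a : D k G} (ha : a ∈ summand k x) :
    degProj (k := k) n a ∈ summand k x := by
  refine ⟨fun w => ?_, fun w => ?_⟩
  · by_cases h : (w.1.length : ℤ) = n
    · rw [show (degProj (k := k) n a).1 w = a.1 w from
        filterL_apply_pos (k := k) (p := fun w : Word G => (w.1.length : ℤ) = n) h _]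
      exact ha.1 w
    · rw [show (degProj (k := k) n a).1 w = 0 from
        filterL_apply_neg (k := k) (p := fun w : Word G => (w.1.length : ℤ) = n) h _]
      exact zero_mem _
  · by_cases h : -(w.1.length : ℤ) - 1 = n
    · rw [show (degProj (k := k) n a).2 w = a.2 w from
        filterL_apply_pos (k := k) (p := fun w : Word G => -(w.1.length : ℤ) - 1 = n) h _]
      exact ha.2 w
    · rw [show (degProj (k := k) n a).2 w = 0 from
        filterL_apply_neg (k := k) (p := fun w : Word G => -(w.1.length : ℤ) - 1 = n) h _]
      exact zero_mem _

theorem summandPart_isInternal (x : G) : DirectSum.IsInternal (summandPart k x) :=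
  degreePart_comap_isInternal _ fun n _ h => degProj_mem_summand n h

open Classical in
/-- The projection of `kG` to `k[S]`. -/
noncomputable def restrictTo (k : Type*) [Field k] [Fintype G] (S : Set G) :
    MonoidAlgebra k G →ₗ[k] MonoidAlgebra k G where
  toFun a := ∑ g, (if g ∈ S then a.coeff g else 0) • el k g
  map_add' a b := by
    rw [← Finset.sum_add_distrib]
    exact Finset.sum_congr rfl fun g _ => by split_ifs <;> simp [add_smul]
  map_smul' r a := by
    rw [RingHom.id_apply, Finset.smul_sum]
    exact Finset.sum_congr rfl fun g _ => by split_ifs <;> simp [mul_smul]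

open Classical in
theorem coeff_restrictTo [Fintype G] (S : Set G) (a : MonoidAlgebra k G) (g : G) :
    (restrictTo k S a).coeff g = if g ∈ S then a.coeff g else 0 := by
  change (∑ h, (if h ∈ S then a.coeff h else 0) • el k h).coeff g = _
  rw [MonoidAlgebra.coeff_sum, Finsupp.finsetSum_apply, Finset.sum_eq_single g]
  · split_ifs <;> simp [el]
  · intro h _ hne
    split_ifs <;> simp [el, hne]
  · simp

theorem restrictTo_mem [Fintype G] (S : Set G) (a : MonoidAlgebra k G) :
    restrictTo k S a ∈ spanOf k S :=
  mem_spanOf_iff.2 fun g hg => by rw [coeff_restrictTo, if_neg hg]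

theorem restrictTo_self [Fintype G] {S : Set G} {a : MonoidAlgebra k G} (ha : a ∈ spanOf k S) :
    restrictTo k S a = a := by
  rw [mem_spanOf_iff] at ha
  refine MonoidAlgebra.coeff_injective (Finsupp.ext fun g => ?_)
  rw [coeff_restrictTo]
  split_ifs with h
  · rfl
  · exact (ha g h).symm

theorem restrictTo_of_disjoint [Fintype G] {S T : Set G} (h : Disjoint S T)
    {a : MonoidAlgebra k G} (ha : a ∈ spanOf k T) : restrictTo k S a = 0 := by
  rw [mem_spanOf_iff] at ha
  refine MonoidAlgebra.coeff_injective (Finsupp.ext fun g => ?_)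
  rw [coeff_restrictTo]
  split_ifs with hg
  · exact ha g (Set.disjoint_left.1 h hg)
  · rfl

/-- A partition of `G` gives a decomposition of `kG`. -/
theorem sum_restrictTo [Fintype G] {ι : Type*} [Fintype ι] {S : ι → Set G}
    (hS : ∀ g, ∃! i, g ∈ S i) (a : MonoidAlgebra k G) : ∑ i, restrictTo k (S i) a = a := by
  classical
  refine MonoidAlgebra.coeff_injective (Finsupp.ext fun g => ?_)
  obtain ⟨i, hi, hu⟩ := hS g
  rw [MonoidAlgebra.coeff_sum, Finsupp.finsetSum_apply, Finset.sum_eq_single i]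
  · rw [coeff_restrictTo, if_pos hi]
  · intro j _ hj
    rw [coeff_restrictTo, if_neg fun h => hj (hu j h)]
  · simp

/-- The translate of the conjugacy class of `x` by `p`. -/
def classTranslate (x p : G) : Set G := {g | ∃ u, IsConj x u ∧ g = p * u}

theorem mem_classTranslate {x p g : G} : g ∈ classTranslate x p ↔ IsConj x (p⁻¹ * g) := by
  refine ⟨?_, fun h => ⟨_, h, by group⟩⟩
  rintro ⟨u, hu, rfl⟩
  simpa using hu

/-- The projection to the summand of the conjugacy class of `x`. -/
noncomputable def classProj (k : Type*) [Field k] [Fintype G] (x : G) : D k G →ₗ[k] D k G :=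
  (wordwise fun w => restrictTo k (classTranslate x w.1.prod)).prodMap
    (wordwise fun w => restrictTo k (classTranslate x w.1.prod⁻¹))

theorem classProj_fst [Fintype G] (x : G) (a : D k G) (w : Word G) :
    (classProj k x a).1 w = restrictTo k (classTranslate x w.1.prod) (a.1 w) :=
  wordwise_apply _ _ _

theorem classProj_snd [Fintype G] (x : G) (a : D k G) (w : Word G) :
    (classProj k x a).2 w = restrictTo k (classTranslate x w.1.prod⁻¹) (a.2 w) :=
  wordwise_apply _ _ _

theorem summand_isInternal [Fintype G] [DecidableEq G] {X : Set G}
    (hX : ∀ g : G, ∃! x, x ∈ X ∧ IsConj x g) :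
    DirectSum.IsInternal fun x : X => summand k (x : G) := by
  classical
  have hdisj : ∀ (x y : X) (p : G), x ≠ y →
      Disjoint (classTranslate (x : G) p) (classTranslate (y : G) p) := by
    intro x y p hxy
    refine Set.disjoint_left.2 fun g hx hy => hxy (Subtype.ext ?_)
    rw [mem_classTranslate] at hx hy
    exact (hX (p⁻¹ * g)).unique ⟨x.2, hx⟩ ⟨y.2, hy⟩
  have hpart : ∀ p g : G, ∃! x : X, g ∈ classTranslate (x : G) p := by
    intro p g
    obtain ⟨x, hx, hu⟩ := hX (p⁻¹ * g)
    exact ⟨⟨x, hx.1⟩, mem_classTranslate.2 hx.2,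
      fun y hy => Subtype.ext (hu y ⟨y.2, mem_classTranslate.1 hy⟩)⟩
  refine isInternal_of_projections (fun x => classProj k (x : G))
    (fun x a => ⟨fun w => ?_, fun w => ?_⟩) (fun x a ha => ?_) (fun x y hxy a ha => ?_)
    fun a => ⟨Finset.univ, ?_⟩
  · rw [classProj_fst]
    exact restrictTo_mem _ _
  · rw [classProj_snd]
    exact restrictTo_mem _ _
  · refine Prod.ext (Finsupp.ext fun w => ?_) (Finsupp.ext fun w => ?_)
    · rw [classProj_fst]
      exact restrictTo_self (ha.1 w)
    · rw [classProj_snd]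
      exact restrictTo_self (ha.2 w)
  · refine Prod.ext (Finsupp.ext fun w => ?_) (Finsupp.ext fun w => ?_)
    · rw [classProj_fst]
      exact restrictTo_of_disjoint (hdisj x y _ hxy) (ha.1 w)
    · rw [classProj_snd]
      exact restrictTo_of_disjoint (hdisj x y _ hxy) (ha.2 w)
  · refine Prod.ext (Finsupp.ext fun w => ?_) (Finsupp.ext fun w => ?_)
    · rw [Prod.fst_sum, Finsupp.finsetSum_apply]
      exact (Finset.sum_congr rfl fun x _ => classProj_fst _ _ _).trans
        (sum_restrictTo (hpart w.1.prod) (a.1 w))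
    · rw [Prod.snd_sum, Finsupp.finsetSum_apply]
      exact (Finset.sum_congr rfl fun x _ => classProj_snd _ _ _).trans
        (sum_restrictTo (hpart w.1.prod⁻¹) (a.2 w))

/-- With one input in the summand of `x` and all other ones in the summand of `1`, the operations
take values in the summand of `x`. -/
theorem ops_mem_summand [Fintype G] {x : G} {n : ℕ} (j : Fin n) {a : Fin n → D k G}
    (hj : a j ∈ summand k x) (ha : ∀ i, i ≠ j → a i ∈ summand k 1) :
    ops k G n a ∈ summand k x := by
  have h₁ : (classFamily (1 : G)).MulLE 0 (classFamily x) (classFamily x) := by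
    intro _ _ u v hu hv
    have hu : IsConj 1 u := hu
    rwa [isConj_one_right.1 hu, one_mul]
  have h₂ : ∀ i, (classFamily x).MulLE i (classFamily (1 : G)) (classFamily x) := by
    intro _ _ _ u v hu hv
    have hv : IsConj 1 v := hv
    rwa [isConj_one_right.1 hv, mul_one]
  have h₃ : (classFamily (1 : G)).MulLE 0 (classFamily (1 : G)) (classFamily 1) := by
    intro _ _ u v hu hv
    have hu : IsConj 1 u := hu
    rwa [isConj_one_right.1 hu, one_mul]
  have h₄ : (classFamily (1 : G)).MulLE (-1) (classFamily x) (classFamily x) := by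
    intro _ _ u v hu hv
    have hu : IsConj 1 u := hu
    rwa [isConj_one_right.1 hu, one_mul]
  simp only [← graded_classFamily] at *
  match n with
  | 0 => exact j.elim0
  | 1 =>
    rw [ops_one]
    exact hochDiff'_mem_graded (fun _ _ h => h) (Subsingleton.elim j 0 ▸ hj)
  | 2 =>
    rw [ops_two]
    fin_cases j
    · exact cup_mem_graded (h₂ 0) hj (ha 1 (by decide))
    · exact cup_mem_graded h₁ (ha 0 (by decide)) hj
  | 3 =>
    rw [ops_three]
    fin_cases j
    · exact ternary_mem_graded (h₂ 0) (h₂ _) hj (ha 1 (by decide)) (ha 2 (by decide))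
    · exact ternary_mem_graded h₁ (h₂ _) (ha 0 (by decide)) hj (ha 2 (by decide))
    · exact ternary_mem_graded h₃ h₄ (ha 0 (by decide)) (ha 1 (by decide)) hj
  | n + 4 =>
    rw [ops_of_lt (by omega)]
    exact zero_mem _

end Classes

/-! ### The embedding of the Tate complex -/

section Embedding

variable {k : Type*} [Field k] {G : Type*} [Group G]

theorem prod_merge (i : ℕ) (l : List G) : (merge i l).prod = l.prod := by
  induction i generalizing l with
  | zero => rcases l with _ | ⟨a, _ | ⟨b, l⟩⟩ <;> simp [merge, mul_assoc]
  | succ i ih =>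
    rcases l with _ | ⟨a, l⟩
    · simp [merge]
    · simp [merge, ih l]

theorem tateEmb_fst (a : Tate k G) (w : Word G) :
    (tateEmb k G a).1 w = a.1 w • el k w.1.prod :=
  wordwise_apply (fun w : Word G => LinearMap.toSpanSingleton k _ (el k w.1.prod)) a.1 w

theorem tateEmb_snd (a : Tate k G) (w : Word G) :
    (tateEmb k G a).2 w = a.2 w • el k w.1.prod⁻¹ :=
  wordwise_apply (fun w : Word G => LinearMap.toSpanSingleton k _ (el k w.1.prod⁻¹)) a.2 w

theorem smul_el_eq_zero {c : k} {g : G} : c • el k g = 0 ↔ c = 0 := by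
  simp [el]

theorem tateEmb_injective : Function.Injective (tateEmb k G) := by
  refine (injective_iff_map_eq_zero _).2 fun a ha => ?_
  refine Prod.ext (Finsupp.ext fun w => ?_) (Finsupp.ext fun w => ?_)
  · exact smul_el_eq_zero.1 ((tateEmb_fst a w).symm.trans (by rw [ha]; rfl))
  · exact smul_el_eq_zero.1 ((tateEmb_snd a w).symm.trans (by rw [ha]; rfl))

theorem tateEmb_mem_degreePart {n : ℤ} {a : Tate k G} :
    tateEmb k G a ∈ degreePart k G (MonoidAlgebra k G) n ↔ a ∈ degreePart k G k n := by
  simp only [mem_degreePart, tateEmb_fst, tateEmb_snd, smul_el_eq_zero]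

theorem classTranslate_one (p : G) : {g : G | ∃ u, IsConj 1 u ∧ g = p * u} = {p} := by
  ext g
  constructor
  · rintro ⟨u, hu, rfl⟩
    rw [isConj_one_right.1 hu, mul_one]
    rfl
  · rintro rfl
    exact ⟨1, IsConj.refl 1, (mul_one g).symm⟩

theorem mem_span_el {p : G} {a : MonoidAlgebra k G} :
    a ∈ spanOf k {p} ↔ ∃ c : k, c • el k p = a := by
  rw [spanOf, Set.image_singleton, Submodule.mem_span_singleton]

theorem range_tateEmb : LinearMap.range (tateEmb k G) = summand k (1 : G) := by
  refine le_antisymm ?_ fun x hx => ?_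
  · rintro _ ⟨a, rfl⟩
    refine ⟨fun w => ?_, fun w => ?_⟩
    · rw [classTranslate_one, tateEmb_fst, mem_span_el]
      exact ⟨_, rfl⟩
    · rw [classTranslate_one, tateEmb_snd, mem_span_el]
      exact ⟨_, rfl⟩
  · have h₁ : ∀ w : Word G, (x.1 w).coeff w.1.prod • el k w.1.prod = x.1 w := fun w => by
      have h := hx.1 w
      rw [classTranslate_one, mem_span_el] at h
      obtain ⟨c, hc⟩ := h
      rw [← hc]
      simp [el]
    have h₂ : ∀ w : Word G, (x.2 w).coeff w.1.prod⁻¹ • el k w.1.prod⁻¹ = x.2 w := fun w => by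
      have h := hx.2 w
      rw [classTranslate_one, mem_span_el] at h
      obtain ⟨c, hc⟩ := h
      rw [← hc]
      simp [el]
    -- the preimage takes at each word the only coefficient that can be non-zero
    let coeffAt : G → MonoidAlgebra k G →ₗ[k] k := fun g =>
      { toFun := fun a => a.coeff g
        map_add' := fun a b => by simp
        map_smul' := fun r a => by simp }
    refine ⟨(wordwise (fun w => coeffAt w.1.prod) x.1, wordwise (fun w => coeffAt w.1.prod⁻¹) x.2),
      Prod.ext (Finsupp.ext fun w => ?_) (Finsupp.ext fun w => ?_)⟩
    · rw [tateEmb_fst, wordwise_apply]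
      exact h₁ w
    · rw [tateEmb_snd, wordwise_apply]
      exact h₂ w

theorem ev_tateEmb (a : Tate k G) (l : List G) :
    ev k l (tateEmb k G a).1 = ev k l a.1 • el k l.prod := by
  by_cases h : (1 : G) ∈ l
  · rw [ev_of_mem h, ev_of_mem h, zero_smul]
  · rw [ev_of_notMem h, ev_of_notMem h, tateEmb_fst]

theorem ev_tateEmb_snd (a : Tate k G) (l : List G) :
    ev k l (tateEmb k G a).2 = ev k l a.2 • el k l.prod⁻¹ := by
  by_cases h : (1 : G) ∈ l
  · rw [ev_of_mem h, ev_of_mem h, zero_smul]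
  · rw [ev_of_notMem h, ev_of_notMem h, tateEmb_snd]

theorem prod_dropLast_mul_getLast {l : List G} (h : l ≠ []) :
    l.dropLast.prod * l.getLast h = l.prod := by
  conv_rhs => rw [← List.dropLast_append_getLast h]
  rw [List.prod_append, List.prod_singleton]

theorem coboundaryAt_tateEmb (a : Tate k G) (l : List G) :
    coboundaryAt k (lmul k) (rmul k) (tateEmb k G a).1 l =
      coboundaryAt k (fun _ => LinearMap.id) (fun _ => LinearMap.id) a.1 l • el k l.prod := by
  rcases l with _ | ⟨g, t⟩
  · simp [coboundaryAt]
  · have hlast := prod_dropLast_mul_getLast (List.cons_ne_nil g t)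
    simp only [coboundaryAt, ev_tateEmb, prod_merge, lmul, rmul, LinearMap.mulLeft_apply,
      LinearMap.mulRight_apply, mul_smul_comm, smul_mul_assoc, el_mul_el, hlast, ← List.prod_cons,
      LinearMap.id_apply, add_smul, Finset.sum_smul, smul_assoc]

/-- The embedding of the Tate chains. -/
noncomputable def chainEmb (k : Type*) [Field k] (G : Type*) [Group G] :
    (Word G →₀ k) →ₗ[k] (Word G →₀ MonoidAlgebra k G) :=
  wordwise fun w => LinearMap.toSpanSingleton k _ (el k w.1.prod⁻¹)

theorem chainEmb_tens (l : List G) (c : k) :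
    chainEmb k G (tens k l c) = tens k l (c • el k l.prod⁻¹) := by
  by_cases h : (1 : G) ∈ l
  · rw [tens_of_mem h, tens_of_mem h, map_zero]
  · rw [tens_of_notMem h, tens_of_notMem h]
    simp [chainEmb, wordwise]

theorem boundaryAt_tateEmb (l : List G) (c : k) :
    boundaryAt k (lmul k) (rmul k) l (c • el k l.prod⁻¹) =
      chainEmb k G (boundaryAt k (fun _ => LinearMap.id) (fun _ => LinearMap.id) l c) := by
  rcases l with _ | ⟨g, t⟩
  · simp [boundaryAt]
  · have hlast : (g :: t).getLast (List.cons_ne_nil g t) * (g :: t).prod⁻¹ =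
        (g :: t).dropLast.prod⁻¹ := by
      rw [← prod_dropLast_mul_getLast (List.cons_ne_nil g t), mul_inv_rev, mul_inv_cancel_left]
    have hfirst : (g :: t).prod⁻¹ * g = t.prod⁻¹ := by simp
    simp only [boundaryAt, LinearMap.add_apply, LinearMap.sum_apply, LinearMap.smul_apply,
      LinearMap.comp_apply, LinearMap.id_apply, map_add, map_sum, map_smul (chainEmb k G),
      chainEmb_tens, prod_merge, lmul, rmul, LinearMap.mulLeft_apply, LinearMap.mulRight_apply,
      mul_smul_comm, smul_mul_assoc, el_mul_el, hlast, hfirst]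

theorem sum_wordwise {M N P : Type*} [AddCommGroup M] [Module k M] [AddCommGroup N] [Module k N]
    [AddCommGroup P] [Module k P] (F : Word G → M →ₗ[k] N) (B : Word G → N →ₗ[k] P)
    (c : Word G →₀ M) :
    ((wordwise F c).sum fun w a => B w a) = c.sum fun w a => B w (F w a) := by
  have h : Finsupp.lsum k B ∘ₗ wordwise F = Finsupp.lsum k fun w => B w ∘ₗ F w :=
    Finsupp.lhom_ext' fun w => LinearMap.ext fun a => by simp [wordwise]
  exact LinearMap.congr_fun h c

theorem tateEmb_tateDiff [Fintype G] (a : Tate k G) :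
    tateEmb k G (tateDiff k G a) = hochDiff k G (tateEmb k G a) := by
  refine Prod.ext (Finsupp.ext fun w => ?_) ?_
  · rw [tateEmb_fst]
    change (coboundaryAt k (fun _ => LinearMap.id) (fun _ => LinearMap.id) a.1 w.1 +
      tens k ([] : List G) (∑ _g : G, ev k [] a.2) w) • el k w.1.prod =
      coboundaryAt k (lmul k) (rmul k) (tateEmb k G a).1 w.1 +
      tens k ([] : List G) (∑ g : G, lmul k g (rmul k g⁻¹ (ev k [] (tateEmb k G a).2))) w
    rw [add_smul, coboundaryAt_tateEmb]
    congr 1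
    rw [tens_of_notMem (List.not_mem_nil), tens_of_notMem (List.not_mem_nil), ev_tateEmb_snd]
    rcases eq_or_ne ⟨[], List.not_mem_nil⟩ w with rfl | h
    · simp [lmul, rmul, el_mul_el]
      rw [mul_comm, mul_smul, Nat.cast_smul_eq_nsmul, nsmul_one]
    · rw [Finsupp.single_eq_of_ne h.symm, Finsupp.single_eq_of_ne h.symm, zero_smul]
  · change chainEmb k G (a.2.sum fun w c =>
        boundaryAt k (fun _ => LinearMap.id) (fun _ => LinearMap.id) w.1 c) =
      (chainEmb k G a.2).sum fun w b => boundaryAt k (lmul k) (rmul k) w.1 b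
    rw [chainEmb, sum_wordwise (B := fun w : Word G => boundaryAt k (lmul k) (rmul k) w.1),
      ← chainEmb, Finsupp.sum, map_sum]
    exact Finset.sum_congr rfl fun w _ => (boundaryAt_tateEmb w.1 _).symm

theorem tateEmb_tateDiff' [Fintype G] (a : Tate k G) :
    tateEmb k G (tateDiff' k G a) = hochDiff' k G (tateEmb k G a) := by
  change tateEmb k G (tateDiff k G (signTwist k a)) = hochDiff k G (signTwist k (tateEmb k G a))
  rw [tateEmb_tateDiff]
  congr 1
  refine Prod.ext rfl (Finsupp.ext fun w => ?_)
  rw [signTwist_apply, signTwist_apply, tateEmb_snd, sgn_apply, sgn_apply, tateEmb_snd, smul_assoc]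

theorem tatePairing_eq (a b : Tate k G) :
    tatePairing k G a b = pairing k G (tateEmb k G a) (tateEmb k G b) := by
  have key : ∀ x y : Tate k G, ((tateEmb k G y).2.sum fun w b => symmForm k ((tateEmb k G x).1 w) b)
      = y.2.sum fun w b => LinearMap.mul k k (x.1 w) b := by
    intro x y
    refine (sum_wordwise (fun w : Word G => LinearMap.toSpanSingleton k _ (el k w.1.prod⁻¹))
      (fun w => symmForm k ((tateEmb k G x).1 w)) y.2).trans ?_
    refine Finset.sum_congr rfl fun w _ => ?_
    change symmForm k ((tateEmb k G x).1 w) (y.2 w • el k w.1.prod⁻¹) = x.1 w * y.2 w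
    rw [tateEmb_fst, symmForm_apply]
    simp [el_mul_el, tr_apply, mul_comm]
  change (b.2.sum fun w c => LinearMap.mul k k (a.1 w) c) +
      (a.2.sum fun w c => LinearMap.mul k k (b.1 w) c) =
    ((tateEmb k G b).2.sum fun w c => symmForm k ((tateEmb k G a).1 w) c) +
      ((tateEmb k G a).2.sum fun w c => symmForm k ((tateEmb k G b).1 w) c)
  rw [key, key]

theorem tatePairing_comm (a b : Tate k G) : tatePairing k G a b = tatePairing k G b a := by
  rw [tatePairing_eq, tatePairing_eq, pairing_comm]

theorem tatePairing_nondegenerate : (tatePairing k G).Nondegenerate := by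
  have h : ∀ a : Tate k G, (∀ b, tatePairing k G a b = 0) → a = 0 := by
    intro a ha
    refine Prod.ext (Finsupp.ext fun w => ?_) (Finsupp.ext fun w => ?_)
    · have := ha (0, Finsupp.single w 1)
      change ((Finsupp.single w 1).sum fun w c => LinearMap.mul k k (a.1 w) c) +
        (a.2.sum fun w c => LinearMap.mul k k ((0 : Word G →₀ k) w) c) = 0 at this
      simpa using this
    · have := ha (Finsupp.single w 1, 0)
      change ((0 : Word G →₀ k).sum fun w c => LinearMap.mul k k (a.1 w) c) +
        (a.2.sum fun v c => LinearMap.mul k k (Finsupp.single w (1 : k) v) c) = 0 at this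
      classical
      simpa [Finsupp.sum, Finsupp.single_apply] using this
  exact ⟨h, fun b hb => h b fun a => by rw [tatePairing_comm]; exact hb a⟩

end Embedding

/-! ### Subalgebras of `A_∞`-algebras and modules over them -/

section Sequences

theorem map_splice {V V' : Type*} (f : V' → V) (a : ℕ → V') (r s : ℕ) (b : V') (i : ℕ) :
    f (splice a r s b i) = splice (fun j => f (a j)) r s (f b) i := by
  simp only [splice]
  split_ifs <;> rfl

theorem snoc_eq {V : Type*} (n : ℕ) (b : ℕ → V) (y : V) :
    (Fin.snoc (α := fun _ => V) (fun i : Fin n => b i) y : Fin (n + 1) → V) =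
      fun i : Fin (n + 1) => if (i : ℕ) < n then b i else y := by
  funext i
  simp only [Fin.snoc]
  split_ifs <;> rfl

theorem cons_eq {V : Type*} (n : ℕ) (b : ℕ → V) (y : V) :
    (Fin.cons (α := fun _ => V) y (fun i : Fin n => b i) : Fin (n + 1) → V) =
      fun i : Fin (n + 1) => if (i : ℕ) = 0 then y else b (i - 1) := by
  funext i
  refine Fin.cases ?_ (fun j => ?_) i
  · simp
  · simp

end Sequences

section Transport

variable {k V V' : Type*} [Field k] [AddCommGroup V] [Module k V] [AddCommGroup V'] [Module k V']

theorem multilinear_congr_length (m : (n : ℕ) → MultilinearMap k (fun _ : Fin n => V) V)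
    {n n' : ℕ} (h : n = n') {b c : ℕ → V} (hbc : ∀ i < n, b i = c i) :
    m n (fun i => b i) = m n' (fun i => c i) := by
  subst h
  congr 1
  funext i
  exact hbc i i.2

variable {A : ℤ → Submodule k V} {m : (n : ℕ) → MultilinearMap k (fun _ : Fin n => V) V}
  {A' : ℤ → Submodule k V'} {m' : (n : ℕ) → MultilinearMap k (fun _ : Fin n => V') V'}
  {ι : V' →ₗ[k] V}

/-- A graded subspace that is stable under the operations of an `A_∞`-algebra is an
`A_∞`-algebra. The subspace is given by an injective map. -/
theorem IsAInfinityAlgebra.of_injective (h : IsAInfinityAlgebra A m)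
    (hι : Function.Injective ι) (hA : ∀ n a, ι a ∈ A n ↔ a ∈ A' n)
    (hm : ∀ n a, ι (m' n a) = m n fun i => ι (a i)) (hint : DirectSum.IsInternal A') :
    IsAInfinityAlgebra A' m' where
  internal := hint
  zero := MultilinearMap.ext fun a => hι <| by
    rw [hm, h.zero]
    simp
  degree n hn d a ha := by
    rw [← hA, hm]
    exact h.degree n hn d _ fun i => (hA _ _).2 (ha i)
  stasheff n hn d a ha := hι <| by
    rw [map_zero, ← h.stasheff n hn d (fun i => ι (a i)) fun i hi => (hA _ _).2 (ha i hi), map_sum]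
    refine Finset.sum_congr rfl fun s _ => ?_
    rw [map_sum]
    refine Finset.sum_congr rfl fun r _ => ?_
    rw [Units.smul_def, Units.smul_def, map_zsmul, hm]
    simp only [map_splice ι, hm]

theorem IsCyclicAInfinityAlgebra.of_injective {p : ℤ} {B : V →ₗ[k] V →ₗ[k] k}
    {B' : V' →ₗ[k] V' →ₗ[k] k} (h : IsCyclicAInfinityAlgebra p A m B)
    (hι : Function.Injective ι) (hA : ∀ n a, ι a ∈ A n ↔ a ∈ A' n)
    (hm : ∀ n a, ι (m' n a) = m n fun i => ι (a i)) (hint : DirectSum.IsInternal A')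
    (hB : ∀ a b, B' a b = B (ι a) (ι b)) (hnd : B'.Nondegenerate) :
    IsCyclicAInfinityAlgebra p A' m' B' where
  toIsAInfinityAlgebra := h.toIsAInfinityAlgebra.of_injective hι hA hm hint
  pairing_degree i j hij a ha b hb := by
    rw [hB]
    exact h.pairing_degree i j hij _ ((hA _ _).2 ha) _ ((hA _ _).2 hb)
  nondegenerate := hnd
  cyclic n hn d a ha := by
    rw [hB, hB, hm, hm]
    exact h.cyclic n hn d (fun i => ι (a i)) fun i hi => (hA _ _).2 (ha i hi)

end Transport

section Sums

variable {V : Type*} [AddCommGroup V]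

/-- The blocks of `s` consecutive inputs out of `n + 1` that avoid the last input, and those that
contain it. -/
theorem sum_blocks_last (f : ℕ → ℕ → V) (n : ℕ) :
    ∑ s ∈ Finset.Icc 1 (n + 1), ∑ r ∈ Finset.range (n + 1 - s + 1), f s r =
      ∑ s ∈ Finset.Icc 1 n, ∑ r ∈ Finset.range (n - s + 1), f s r +
        ∑ r ∈ Finset.range (n + 1), f (n - r + 1) r := by
  simp only [Finset.sum_range_succ _ (n + 1 - _), Finset.sum_add_distrib]
  congr 1
  · rw [Finset.sum_Icc_succ_top (Nat.le_add_left 1 n), Nat.sub_self, Finset.range_zero,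
      Finset.sum_empty, add_zero]
    refine Finset.sum_congr rfl fun s hs => ?_
    rw [Nat.sub_add_comm (Finset.mem_Icc.1 hs).2]
  · rw [← Finset.sum_range_reflect]
    refine Finset.sum_bij' (fun s _ => s - 1) (fun i _ => i + 1) ?_ ?_ ?_ ?_ ?_ <;>
      simp only [Finset.mem_Icc, Finset.mem_range] <;> intro i hi
    · omega
    · omega
    · omega
    · omega
    · congr 1 <;> omega

/-- The blocks of `s` consecutive inputs out of `n + 1` that avoid the first input, and those that
contain it. -/
theorem sum_blocks_first (f : ℕ → ℕ → V) (n : ℕ) :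
    ∑ s ∈ Finset.Icc 1 (n + 1), ∑ r ∈ Finset.range (n + 1 - s + 1), f s r =
      ∑ s ∈ Finset.Icc 1 n, ∑ r ∈ Finset.range (n - s + 1), f s (r + 1) +
        ∑ q ∈ Finset.range (n + 1), f (q + 1) 0 := by
  simp only [Finset.sum_range_succ' _ (n + 1 - _), Finset.sum_add_distrib]
  congr 1
  · rw [Finset.sum_Icc_succ_top (Nat.le_add_left 1 n), Nat.sub_self, Finset.range_zero,
      Finset.sum_empty, add_zero]
    refine Finset.sum_congr rfl fun s hs => ?_
    rw [Nat.sub_add_comm (Finset.mem_Icc.1 hs).2]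
  · refine Finset.sum_bij' (fun s _ => s - 1) (fun i _ => i + 1) ?_ ?_ ?_ ?_ ?_ <;>
      simp only [Finset.mem_Icc, Finset.mem_range] <;> intro i hi
    · omega
    · omega
    · omega
    · omega
    · congr 1; omega

end Sums

section Modules

variable {k V V' : Type*} [Field k] [AddCommGroup V] [Module k V] [AddCommGroup V'] [Module k V']
  {A : ℤ → Submodule k V} {m : (n : ℕ) → MultilinearMap k (fun _ : Fin n => V) V}
  {A' : ℤ → Submodule k V'} {m' : (n : ℕ) → MultilinearMap k (fun _ : Fin n => V') V'}
  {ι : V' →ₗ[k] V} {W : Submodule k V}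

/-- A graded subspace `W` of an `A_∞`-algebra `V` that is stable under the operations with last
input in `W` and all other inputs from a subalgebra is a left module over this subalgebra. -/
theorem IsAInfinityAlgebra.isLeftAInfinityModule (h : IsAInfinityAlgebra A m)
    (hA : ∀ n a, a ∈ A' n → ι a ∈ A n) (hm : ∀ n a, ι (m' n a) = m n fun i => ι (a i))
    (hW : DirectSum.IsInternal fun n => (A n).comap W.subtype)
    {mM : (n : ℕ) → MultilinearMap k (fun _ : Fin n => V') (W →ₗ[k] W)}
    (hM : ∀ n a (y : W), (mM n a y : V) =
      m (n + 1) (Fin.snoc (α := fun _ => V) (fun i => ι (a i)) y)) :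
    IsLeftAInfinityModule A' m' (fun n => (A n).comap W.subtype) mM where
  internal := hW
  degree n d e a y ha hy := by
    change (mM n a y : V) ∈ A _
    rw [hM]
    have := h.degree (n + 1) (Nat.le_add_left 1 n) (Fin.snoc (α := fun _ => ℤ) d e)
      (Fin.snoc (α := fun _ => V) (fun i => ι (a i)) y)
      (fun i => Fin.lastCases (by simpa using hy) (fun j => by simpa using hA _ _ (ha j)) i)
    rw [Fin.sum_univ_castSucc] at this
    simpa using this
  stasheff n d e a y ha hy := by
    -- the identity in `V` for the `n + 1` inputs `ι (a 0), …, ι (a (n - 1)), y`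
    let b : ℕ → V := fun i => if i < n then ι (a i) else y
    let d' : ℕ → ℤ := fun i => if i < n then d i else e
    have hb : ∀ i < n + 1, b i ∈ A (d' i) := by
      intro i _
      by_cases hi : i < n
      · simp only [b, d', if_pos hi]
        exact hA _ _ (ha i hi)
      · simp only [b, d', if_neg hi]
        exact hy
    have hd : ∀ r ≤ n, degSum d' r = degSum d r := fun r hr =>
      Finset.sum_congr rfl fun i hi => if_pos (by rw [Finset.mem_range] at hi; omega)
    have key := h.stasheff (n + 1) (Nat.le_add_left 1 n) d' b hb
    rw [sum_blocks_last] at key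
    apply Subtype.ext
    rw [ZeroMemClass.coe_zero, ← key, Submodule.coe_add, AddSubmonoidClass.coe_finsetSum,
      AddSubmonoidClass.coe_finsetSum]
    congr 1
    · refine Finset.sum_congr rfl fun s hs => ?_
      rw [AddSubmonoidClass.coe_finsetSum]
      refine Finset.sum_congr rfl fun r hr => ?_
      rw [Finset.mem_Icc] at hs
      rw [Finset.mem_range] at hr
      rw [Units.smul_def, Units.smul_def, Submodule.coe_smul_of_tower, hM, hd r (by omega)]
      push_cast
      congr 1
      rw [snoc_eq (n - s + 1) (fun i => ι (splice a r s (m' s fun j => a (r + j)) i)) (y : V)]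
      have hin : (m s fun j => b (r + j)) = ι (m' s fun j => a (r + j)) := by
        rw [hm]
        congr 1
        funext j
        exact if_pos (by omega)
      rw [hin]
      refine multilinear_congr_length m (b := fun i => if i < n - s + 1 then
        ι (splice a r s (m' s fun j => a (r + j)) i) else (y : V)) (by omega) fun i hi => ?_
      simp only [splice, b]
      split_ifs <;> first | rfl | omega
    · refine Finset.sum_congr rfl fun r hr => ?_
      rw [Finset.mem_range] at hr
      rw [Units.smul_def, Units.smul_def, Submodule.coe_smul_of_tower, hM, hM, hd r (by omega)]
      congr 1
      · congr 2
        push_cast [show r ≤ n by omega]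
        ring
      · rw [snoc_eq r (fun i => ι (a i)), snoc_eq (n - r) (fun i => ι (a (r + i)))]
        have hin : (m (n - r + 1) fun i => if (i : ℕ) < n - r then ι (a (r + i)) else (y : V)) =
            m (n - r + 1) fun j => b (r + j) :=
          multilinear_congr_length m rfl
            (b := fun i => if i < n - r then ι (a (r + i)) else (y : V))
            (c := fun j => b (r + j)) fun i hi => by
            simp only [b]
            split_ifs <;> first | rfl | omega
        rw [hin]
        refine multilinear_congr_length m (b := fun i => if i < r then ι (a i) else
          m (n - r + 1) fun j => b (r + j)) (by omega) fun i hi => ?_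
        simp only [splice, b]
        split_ifs <;> first | rfl | omega

/-- A graded subspace `W` of an `A_∞`-algebra `V` that is stable under the operations with first
input in `W` and all other inputs from a subalgebra is a right module over this subalgebra. -/
theorem IsAInfinityAlgebra.isRightAInfinityModule (h : IsAInfinityAlgebra A m)
    (hA : ∀ n a, a ∈ A' n → ι a ∈ A n) (hm : ∀ n a, ι (m' n a) = m n fun i => ι (a i))
    (hW : DirectSum.IsInternal fun n => (A n).comap W.subtype)
    {mM : (n : ℕ) → MultilinearMap k (fun _ : Fin n => V') (W →ₗ[k] W)}
    (hM : ∀ n a (y : W), (mM n a y : V) =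
      m (n + 1) (Fin.cons (α := fun _ => V) y fun i => ι (a i))) :
    IsRightAInfinityModule A' m' (fun n => (A n).comap W.subtype) mM where
  internal := hW
  degree n d e a y ha hy := by
    change (mM n a y : V) ∈ A _
    rw [hM]
    have := h.degree (n + 1) (Nat.le_add_left 1 n) (Fin.cons (α := fun _ => ℤ) e d)
      (Fin.cons (α := fun _ => V) y fun i => ι (a i))
      (fun i => Fin.cases (by simpa using hy) (fun j => by simpa using hA _ _ (ha j)) i)
    rw [Fin.sum_univ_succ] at this
    simpa using this
  stasheff n d e a y ha hy := by
    -- the identity in `V` for the `n + 1` inputs `y, ι (a 0), …, ι (a (n - 1))`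
    let b : ℕ → V := fun i => if i = 0 then (y : V) else ι (a (i - 1))
    let d' : ℕ → ℤ := fun i => if i = 0 then e else d (i - 1)
    have hb : ∀ i < n + 1, b i ∈ A (d' i) := by
      intro i hin
      by_cases hi : i = 0
      · simp only [b, d', if_pos hi]
        exact hy
      · simp only [b, d', if_neg hi]
        exact hA _ _ (ha (i - 1) (by omega))
    have hd : ∀ r, degSum d' (r + 1) = e + degSum d r := fun r => by
      rw [degSum, Finset.sum_range_succ', add_comm]
      simp [d', degSum]
    have key := h.stasheff (n + 1) (Nat.le_add_left 1 n) d' b hb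
    rw [sum_blocks_first] at key
    apply Subtype.ext
    rw [ZeroMemClass.coe_zero, ← key, Submodule.coe_add, AddSubmonoidClass.coe_finsetSum,
      AddSubmonoidClass.coe_finsetSum]
    congr 1
    · refine Finset.sum_congr rfl fun s hs => ?_
      rw [AddSubmonoidClass.coe_finsetSum]
      refine Finset.sum_congr rfl fun r hr => ?_
      rw [Finset.mem_Icc] at hs
      rw [Finset.mem_range] at hr
      rw [Units.smul_def, Units.smul_def, Submodule.coe_smul_of_tower, hM, hd r]
      congr 1
      · congr 2
        push_cast
        ring
      rw [cons_eq (n - s + 1) (fun i => ι (splice a r s (m' s fun j => a (r + j)) i)) (y : V)]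
      have hin : (m s fun j => b (r + 1 + j)) = ι (m' s fun j => a (r + j)) := by
        rw [hm]
        congr 1
        funext j
        simp only [b]
        rw [if_neg (by omega)]
        congr 2
        omega
      rw [hin]
      refine multilinear_congr_length m (b := fun i => if i = 0 then (y : V) else
        ι (splice a r s (m' s fun j => a (r + j)) (i - 1))) (by omega) fun i hi => ?_
      simp only [splice, b]
      split_ifs <;> first | rfl | omega | (congr 2; omega)
    · refine Finset.sum_congr rfl fun q hq => ?_
      rw [Finset.mem_range] at hq
      rw [Units.smul_def, Units.smul_def, Submodule.coe_smul_of_tower, hM, hM]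
      congr 1
      · congr 2
        simp only [degSum, Finset.range_zero, Finset.sum_empty]
        push_cast
        ring
      · rw [cons_eq q (fun i => ι (a i)), cons_eq (n - q) (fun i => ι (a (q + i)))]
        have hin : (m (q + 1) fun i => if (i : ℕ) = 0 then (y : V) else ι (a (i - 1))) =
            m (q + 1) fun j => b (0 + j) := by
          simp only [b, zero_add]
        rw [hin]
        refine multilinear_congr_length m (b := fun i => if i = 0 then
          m (q + 1) (fun j => b (0 + j)) else ι (a (q + (i - 1)))) (by omega) fun i hi => ?_
        simp only [splice, b]
        split_ifs <;> first | rfl | omega | (congr 2; omega)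

end Modules

/-! ### The operations on the Tate complex and on the summands -/

section Operations

variable {k V V' : Type*} [Field k] [AddCommGroup V] [Module k V] [AddCommGroup V'] [Module k V']

/-- The operation on a subspace of `V`, the image of an injective map `ι`, that is induced by an
operation on `V`. -/
noncomputable def pullbackOp {n : ℕ} (f : MultilinearMap k (fun _ : Fin n => V) V) (ι : V' →ₗ[k] V)
    (hι : Function.Injective ι) (hf : ∀ a : Fin n → V', f (fun i => ι (a i)) ∈ LinearMap.range ι) :
    MultilinearMap k (fun _ : Fin n => V') V' :=
  (LinearEquiv.ofInjective ι hι).symm.toLinearMap.compMultilinearMap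
    ((f.compLinearMap fun _ => ι).codRestrict (LinearMap.range ι) hf)

theorem apply_pullbackOp {n : ℕ} (f : MultilinearMap k (fun _ : Fin n => V) V) (ι : V' →ₗ[k] V)
    (hι : Function.Injective ι) (hf : ∀ a : Fin n → V', f (fun i => ι (a i)) ∈ LinearMap.range ι)
    (a : Fin n → V') : ι (pullbackOp f ι hι hf a) = f fun i => ι (a i) :=
  congrArg Subtype.val ((LinearEquiv.ofInjective ι hι).apply_symm_apply
    (((f.compLinearMap fun _ => ι).codRestrict (LinearMap.range ι) hf) a))

/-- The operation with last input in a subspace `W` and values in `W`. -/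
noncomputable def leftOp {n : ℕ} (f : MultilinearMap k (fun _ : Fin (n + 1) => V) V)
    (ι : V' →ₗ[k] V) (W : Submodule k V)
    (hf : ∀ (a : Fin n → V') (y : W),
      f (Fin.snoc (α := fun _ => V) (fun i => ι (a i)) y) ∈ W) :
    MultilinearMap k (fun _ : Fin n => V') (W →ₗ[k] W) :=
  MultilinearMap.mk'
    (fun a => ((f.curryRight.compLinearMap fun _ => ι) a).restrict fun y hy => hf a ⟨y, hy⟩)
    (fun a i x y => LinearMap.ext fun w => Subtype.ext <| by
      change (f.curryRight.compLinearMap fun _ => ι) _ (w : V) = _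
      rw [MultilinearMap.map_update_add]
      rfl)
    (fun a i c x => LinearMap.ext fun w => Subtype.ext <| by
      change (f.curryRight.compLinearMap fun _ => ι) _ (w : V) = _
      rw [MultilinearMap.map_update_smul]
      rfl)

/-- The operation with first input in a subspace `W` and values in `W`. -/
noncomputable def rightOp {n : ℕ} (f : MultilinearMap k (fun _ : Fin (n + 1) => V) V)
    (ι : V' →ₗ[k] V) (W : Submodule k V)
    (hf : ∀ (a : Fin n → V') (y : W),
      f (Fin.cons (α := fun _ => V) y fun i => ι (a i)) ∈ W) :
    MultilinearMap k (fun _ : Fin n => V') (W →ₗ[k] W) :=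
  MultilinearMap.mk'
    (fun a =>
      { toFun := fun y => ⟨(f.curryLeft (y : V)).compLinearMap (fun _ => ι) a, hf a y⟩
        map_add' := fun x y => Subtype.ext <| by
          change (f.curryLeft (x + y : V)).compLinearMap (fun _ => ι) a = _
          rw [map_add]
          rfl
        map_smul' := fun c x => Subtype.ext <| by
          change (f.curryLeft (c • x : V)).compLinearMap (fun _ => ι) a = _
          rw [map_smul]
          rfl })
    (fun a i x y => LinearMap.ext fun w => Subtype.ext <|
      ((f.curryLeft (w : V)).compLinearMap fun _ => ι).map_update_add a i x y)
    (fun a i c x => LinearMap.ext fun w => Subtype.ext <|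
      ((f.curryLeft (w : V)).compLinearMap fun _ => ι).map_update_smul a i c x)

end Operations

section Tate

variable {k : Type*} [Field k] {G : Type*} [Group G]

theorem tateEmb_mem_summand (a : Tate k G) : tateEmb k G a ∈ summand k (1 : G) :=
  range_tateEmb (k := k) (G := G) ▸ LinearMap.mem_range_self _ a

variable [Fintype G]

theorem ops_tateEmb_mem_range {n : ℕ} (a : Fin n → Tate k G) :
    ops k G n (fun i => tateEmb k G (a i)) ∈ LinearMap.range (tateEmb k G) := by
  rcases n with _ | n
  · exact zero_mem _
  · rw [range_tateEmb]
    exact ops_mem_summand 0 (tateEmb_mem_summand _) fun i _ => tateEmb_mem_summand _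

theorem ops_snoc_mem_summand (x : G) (n : ℕ) (a : Fin n → Tate k G) (y : summand k x) :
    ops k G (n + 1) (Fin.snoc (α := fun _ => D k G) (fun i => tateEmb k G (a i)) y) ∈
      summand k x := by
  refine ops_mem_summand (Fin.last n) (by simp) fun i hi => ?_
  obtain ⟨j, rfl⟩ := Fin.exists_castSucc_eq.2 hi
  rw [Fin.snoc_castSucc]
  exact tateEmb_mem_summand _

theorem ops_cons_mem_summand (x : G) (n : ℕ) (a : Fin n → Tate k G) (y : summand k x) :
    ops k G (n + 1) (Fin.cons (α := fun _ => D k G) y fun i => tateEmb k G (a i)) ∈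
      summand k x := by
  refine ops_mem_summand 0 (by simp) fun i hi => ?_
  obtain ⟨j, rfl⟩ := Fin.exists_succ_eq.2 hi
  rw [Fin.cons_succ]
  exact tateEmb_mem_summand _

end Tate
end TateHochschild

open TateHochschild in
theorem theorem4p7 (k : Type*) [Field k] (G : Type*) [Group G] [Fintype G]
    [DecidableEq G] :
    IsCyclicAInfinityAlgebra (-1) (degreePart k G (MonoidAlgebra k G)) (ops k G) (pairing k G) ∧
    (∀ a, tateEmb k G (tateDiff k G a) = hochDiff k G (tateEmb k G a)) ∧
    Function.Injective (tateEmb k G) ∧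
    (∀ n, ∀ a ∈ degreePart k G k n, tateEmb k G a ∈ degreePart k G (MonoidAlgebra k G) n) ∧
    LinearMap.range (tateEmb k G) = summand k (1 : G) ∧
    (∀ X : Set G, (∀ g : G, ∃! x, x ∈ X ∧ IsConj x g) →
      DirectSum.IsInternal fun x : X => summand k (x : G)) ∧
    (∀ x : G, ∀ a ∈ summand k x, hochDiff k G a ∈ summand k x) ∧
    ∃ mT : (n : ℕ) → MultilinearMap k (fun _ : Fin n => Tate k G) (Tate k G),
      IsCyclicAInfinityAlgebra (-1) (degreePart k G k) mT (tatePairing k G) ∧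
      (∀ a, mT 1 a = tateDiff' k G (a 0)) ∧
      (∀ n a, tateEmb k G (mT n a) = ops k G n fun i => tateEmb k G (a i)) ∧
      (∀ a b, tatePairing k G a b = pairing k G (tateEmb k G a) (tateEmb k G b)) ∧
      ∀ x : G,
        (∃ mM : (n : ℕ) →
            MultilinearMap k (fun _ : Fin n => Tate k G) (summand k x →ₗ[k] summand k x),
          (∀ n a (y : summand k x), (mM n a y : D k G) =
            ops k G (n + 1) (Fin.snoc (α := fun _ => D k G) (fun i => tateEmb k G (a i)) y)) ∧
          IsLeftAInfinityModule (W := summand k x) (degreePart k G k) mT (summandPart k x) mM) ∧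
        (∃ mM : (n : ℕ) →
            MultilinearMap k (fun _ : Fin n => Tate k G) (summand k x →ₗ[k] summand k x),
          (∀ n a (y : summand k x), (mM n a y : D k G) =
            ops k G (n + 1) (Fin.cons (α := fun _ => D k G) y fun i => tateEmb k G (a i))) ∧
          IsRightAInfinityModule (W := summand k x) (degreePart k G k) mT (summandPart k x) mM) := by
  have hD := isCyclicAInfinityAlgebra_ops (k := k) (G := G)
  have hT : ∀ (n : ℕ) (a : Fin n → Tate k G),
      tateEmb k G (pullbackOp (ops k G n) (tateEmb k G) tateEmb_injective ops_tateEmb_mem_range a) =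
        ops k G n fun i => tateEmb k G (a i) :=
    fun n => apply_pullbackOp (ops k G n) (tateEmb k G) tateEmb_injective ops_tateEmb_mem_range
  refine ⟨hD, tateEmb_tateDiff, tateEmb_injective, fun n a => tateEmb_mem_degreePart.2,
    range_tateEmb, fun X => summand_isInternal, fun x a => hochDiff_mem_summand,
    fun n => pullbackOp (ops k G n) (tateEmb k G) tateEmb_injective ops_tateEmb_mem_range,
    hD.of_injective tateEmb_injective (fun n a => tateEmb_mem_degreePart) hT
      degreePart_isInternal tatePairing_eq tatePairing_nondegenerate,
    fun a => tateEmb_injective ((hT 1 a).trans (tateEmb_tateDiff' (a 0)).symm), hT,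
    tatePairing_eq, fun x => ⟨?_, ?_⟩⟩
  · have hM : ∀ (n : ℕ) (a : Fin n → Tate k G) (y : summand k x),
        (leftOp (ops k G (n + 1)) (tateEmb k G) (summand k x) (ops_snoc_mem_summand x n) a y :
          D k G) =
        ops k G (n + 1) (Fin.snoc (α := fun _ => D k G) (fun i => tateEmb k G (a i)) y) :=
      fun _ _ _ => rfl
    exact ⟨_, hM, hD.isLeftAInfinityModule (fun n a => tateEmb_mem_degreePart.2) hT
      (summandPart_isInternal x) hM⟩
  · have hM : ∀ (n : ℕ) (a : Fin n → Tate k G) (y : summand k x),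
        (rightOp (ops k G (n + 1)) (tateEmb k G) (summand k x) (ops_cons_mem_summand x n) a y :
          D k G) =
        ops k G (n + 1) (Fin.cons (α := fun _ => D k G) y fun i => tateEmb k G (a i)) :=
      fun _ _ _ => rfl
    exact ⟨_, hM, hD.isRightAInfinityModule (fun n a => tateEmb_mem_degreePart.2) hT
      (summandPart_isInternal x) hM⟩
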